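/- **Setting.** Let $Q\ge 1$ and $0\le M<|\mathcal N|$ be integers, $K=|\mathcal N|+M$, and let $P_0,\dots,P_Q$ be probability densities on $\mathbb R$. There are $K$ sensors, of which an unknown set of at most $M$ is compromised. Under hypothesis $q\in\{1,\dots,Q\}$ with change time $\nu\in\{0,1,2,\dots\}$ all observations $X^k_t$ ($1\le k\le K$, $t\ge1$) are independent, with density $P_0$ for $t\le\nu$ and $P_q$ for $t>\nu$; under $q=0$ all have density $P_0$. Write $I(q,j)=\int\log\frac{P_q}{P_j}\,P_q\,dx$, $\sigma^2(q,j)$ for the variance of $\log\frac{P_q}{P_j}$ under $P_q$, $I^q=\min_{0\le j\le Q,\,j\ne q}I(q,j)$ for $1\le q\le Q$, and $I^*=\min_{1\le q\le Q}I^q$. Assume for all $1\le q\le Q$ and $0\le j\le Q$, $j\neq q$, that $0<I(q,j)<\infty$ and $\sigma^2(q,j)<\infty$, that the minimum defining each $I^q$ is attained at a unique $j$, and that $\min_{1\le j\le Q}I(j,0)$ is attained at a unique $j$. An attack $g$ consists of a set of at most $M$ compromised sensors and of measurable functions that determine the signals these send at time $t$ from the observations of all sensors up to time $t$; it may depend on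 the hypothesis, on $\nu$ and on the detection rule. Let $\mathsf E^{q,g}_\nu$ be the corresponding expectation. A detection rule produces alarm times $0=T_0<T_1<T_2<\cdots$ with decisions $\hat q_\rho\in\{1,\dots,Q\}$ at $T_\rho$. Put $T=T_1$, $T^{q}=\inf\{T_\rho:\rho\ge1,\ \hat q_\rho=q\}$ ($\inf\emptyset=\infty$), $$\mathcal D[T]=\sup_{1\le q\le Q}\ \sup_{g,\nu}\ \operatorname{ess\,sup}\ \mathsf E^{q,g}_\nu\big[(T-\nu)^+\mid X_1,\dots,X_\nu\big],\qquad \mathcal A[T]=\inf_{0\le q\le Q}\ \inf_g\ \inf_{1\le\hat q\le Q,\ \hat q\ne q}\mathsf E^{q,g}_0\big[T^{\hat q}\big].$$ **Rules.** Fix a threshold $h>0$. Sensor $k$ computes $Y^k_0(q,j)=0$, $Y^k_t(q,j)=\big(Y^k_{t-1}(q,j)+\log\frac{P_q(X^k_t)}{P_j(X^k_t)}\big)^+$ and $Y^k_{t,q}=\min_{j\ne q}Y^k_t(q,j)$; hypothesis $q\in\{1,\dots,Q\}$ is acceptable at sensor $k$ and time $t$ if $Y^k_{t,q}\ge h$.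 *Simultaneous $d$-th alarm* $\tau^s_{(d)}(h)$: at every time each honest sensor sends the set of its currently acceptable hypotheses ($Q$ bits), each compromised sensor sends an arbitrary subset of $\{1,\dots,Q\}$, and the fusion center raises an alarm of type $q$ as soon as at least $d$ sensors accept $q$ at the same time. *Multi-shot $d$-th alarm* $\tau^m_{(d)}(h)$: each honest sensor reports every hypothesis once, when it first becomes acceptable there; it sends at most one hypothesis per time step, further ones wait in a first-come first-served queue, and hypotheses that become acceptable at the same time are queued by decreasing $Y^k_{t,q}$, with equal values in random order. A compromised sensor sends at each time an arbitrary hypothesis or nothing. The fusion center raises an alarm of type $q$ as soon as at least $d$ different sensors have reported $q$. If several hypotheses qualify for an alarm at the same time, the fusion center selects one of them by an arbitrary fixed rule. After an alarm the whole procedure either restarts from its initial state, using only later observations (restarting version), or stops, $T_\rho=\infty$ for $\rho>1$ (one-alarm version); $\mathcal D$ is the same for both. For $\gamma\to\infty$, write $f\lesssim b$ if $\limsup f/b\le1$ and $f\gtrsim b$ if $\liminf f/b\ge1$. **Theorem.** (a) There are thresholds $h_\gamma>0$ such that $\mathcal A[\tau^s_{(|\mathcal N|)}(h_\gamma)]\ge\gamma$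 for all $\gamma$, in the restarting as well as in the one-alarm version, and $$\mathcal D[\tau^s_{(|\mathcal N|)}(h_\gamma)]\lesssim\frac{\log\gamma}{(|\mathcal N|-M)I^*}\qquad(\gamma\to\infty).$$ This is the best first-order delay among the simultaneous $d$-th alarms: for every $d$ and all thresholds $h_\gamma>0$ such that $\mathcal A[\tau^s_{(d)}(h_\gamma)]\ge\gamma$ in the restarting version for all large $\gamma$, one has $\mathcal D[\tau^s_{(d)}(h_\gamma)]\gtrsim\frac{\log\gamma}{(|\mathcal N|-M)I^*}$. (b) For every $d$ with $M+1\le d\le|\mathcal N|$ there are thresholds $h_\gamma>0$ such that $\mathcal A[\tau^m_{(d)}(h_\gamma)]\ge\gamma$ for all $\gamma$, in the restarting as well as in the one-alarm version, and $$\mathcal D[\tau^m_{(d)}(h_\gamma)]\lesssim\frac{\log\gamma}{I^*}\qquad(\gamma\to\infty).$$ -/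

import Mathlib

open MeasureTheory ProbabilityTheory InformationTheory Filter
open scoped ENNReal NNReal

noncomputable section

namespace ByzantineQCD

/-! ### Hypotheses, divergences, standing assumption -/

/-- The `Q + 1` probability density functions on the line: index `0` is the pre-change density,
index `q.succ` (for `q : Fin Q`) is the post-change density of type `q`. -/
structure Densities (Q : ℕ) where
  pdf : Fin (Q + 1) → ℝ → ℝ≥0
  measurable_pdf : ∀ j, Measurable (pdf j)
  lintegral_pdf : ∀ j, ∫⁻ x, (pdf j x : ℝ≥0∞) = 1

variable {Q K : ℕ}

/-- The distribution of one observation under density `j`. -/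
def Densities.law (P : Densities Q) (j : Fin (Q + 1)) : Measure ℝ :=
  volume.withDensity fun x => (P.pdf j x : ℝ≥0∞)

instance Densities.isProbabilityMeasure_law (P : Densities Q) (j : Fin (Q + 1)) :
    IsProbabilityMeasure (P.law j) :=
  ⟨by simpa [Densities.law] using P.lintegral_pdf j⟩

/-- `I(q, j) = ∫ log (P_q / P_j) P_q dx`, as an extended nonnegative real. -/
def Densities.I (P : Densities Q) (q j : Fin (Q + 1)) : ℝ≥0∞ :=
  klDiv (P.law q) (P.law j)

/-- `σ²(q, j)`: the variance under `P_q` of the log-likelihood ratio of `P_q` to `P_j`. -/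
def Densities.sigmaSq (P : Densities Q) (q j : Fin (Q + 1)) : ℝ≥0∞ :=
  evariance (llr (P.law q) (P.law j)) (P.law q)

/-- `I^q = min_{j ≠ q} I(q, j)` for a post-change type `q`. -/
def Densities.Imin (P : Densities Q) (q : Fin Q) : ℝ≥0∞ :=
  ⨅ j : {j : Fin (Q + 1) // j ≠ q.succ}, P.I q.succ j

/-- `I^0 = min_{j ∈ [Q]} I(j, 0)`. -/
def Densities.Izero (P : Densities Q) : ℝ≥0∞ :=
  ⨅ j : Fin Q, P.I j.succ 0

/-- `I^* = min_{q ∈ [Q]} I^q`. -/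
def Densities.Istar (P : Densities Q) : ℝ≥0∞ :=
  ⨅ q : Fin Q, P.Imin q

/-- The standing assumption on the densities. -/
structure Densities.Regular (P : Densities Q) : Prop where
  I_pos : ∀ (q : Fin Q) (j : Fin (Q + 1)), j ≠ q.succ → 0 < P.I q.succ j
  I_lt_top : ∀ (q : Fin Q) (j : Fin (Q + 1)), j ≠ q.succ → P.I q.succ j < ⊤
  sigmaSq_lt_top : ∀ (q : Fin Q) (j : Fin (Q + 1)), j ≠ q.succ → P.sigmaSq q.succ j < ⊤
  unique_min : ∀ q : Fin Q, ∃! j : Fin (Q + 1), j ≠ q.succ ∧ P.I q.succ j = P.Imin q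
  unique_min_zero : ∃! j : Fin Q, P.I j.succ 0 = P.Izero

/-! ### Probability space -/

/-- A point of the sample space. The first component gives the observations, `ω.1 i k` being
the observation of sensor `k` at time `i + 1`; the second one gives the random numbers with which
honest sensors break ties, `ω.2 i k q` being used by sensor `k` at time `i + 1`. -/
abbrev Sample (Q K : ℕ) : Type :=
  (ℕ → Fin K → ℝ) × (ℕ → Fin K → Fin Q → ℝ)

/-- The uniform distribution on `[0, 1]`. -/
def uniform01 : Measure ℝ := volume.restrict (Set.Icc 0 1)

instance isProbabilityMeasure_uniform01 : IsProbabilityMeasure uniform01 :=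
  ⟨by simp [uniform01]⟩

/-- Law of the observations when a change to density `q` happens at time `ν`: all observations are
independent, with density `P_0` at the times `1, …, ν` and `P_q` at the times `ν + 1, …`. For
`q = 0` no change ever happens. -/
def obsLaw (K : ℕ) (P : Densities Q) (q : Fin (Q + 1)) (ν : ℕ) : Measure (ℕ → Fin K → ℝ) :=
  Measure.infinitePi fun i => Measure.pi fun _ : Fin K => P.law (if i < ν then 0 else q)

/-- Law of the tie-breaking random numbers: independent and uniform. -/
def coinLaw (Q K : ℕ) : Measure (ℕ → Fin K → Fin Q → ℝ) :=
  Measure.infinitePi fun _ => Measure.pi fun _ => Measure.pi fun _ => uniform01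

/-- The underlying probability measure: observations and tie-breaking are independent. -/
def sampleLaw (K : ℕ) (P : Densities Q) (q : Fin (Q + 1)) (ν : ℕ) : Measure (Sample Q K) :=
  (obsLaw K P q ν).prod (coinLaw Q K)

/-- The σ-algebra generated by the observations of all sensors at the times `1, …, ν`. -/
@[reducible] def past (Q K ν : ℕ) : MeasurableSpace (Sample Q K) :=
  MeasurableSpace.comap (fun (ω : Sample Q K) (i : Fin ν) => ω.1 i) inferInstance

/-! ### Attacks -/

/-- An attack strategy with at most `M` compromised sensors and signals in the alphabet `A`:
at time `t` the compromised sensor `k` sends `signal t x k`, where `x` holds the observations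
of all the sensors at the times `1, …, t`. The performance metrics take a worst case over
attacks separately for every type, change time and detection rule, so an attack may depend on
these. -/
structure Attack (K M : ℕ) (A : Type) where
  compromised : Finset (Fin K)
  card_le : compromised.card ≤ M
  signal : (t : ℕ) → (Fin t → Fin K → ℝ) → Fin K → A
  measurable_signal : ∀ t k a, MeasurableSet {x | signal t x k = a}

/-! ### Matrix CUSUM -/

/-- The log-likelihood ratio `log (P_q(x) / P_j(x))`, which is `-∞` or `+∞` where only the
numerator or only the denominator vanishes. -/
def logRatio (P : Densities Q) (q j : Fin (Q + 1)) (x : ℝ) : EReal :=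
  ENNReal.log ((P.pdf q x : ℝ≥0∞) / (P.pdf j x : ℝ≥0∞))

/-- The CUSUM statistics `Y(q, j)` of one sensor. -/
abbrev CusumMatrix (Q : ℕ) : Type := Fin Q → Fin (Q + 1) → EReal

/-- One step of the CUSUM recursion, `Y ↦ (Y + ℓ)⁺`. -/
def cusumStep (P : Densities Q) (Y : CusumMatrix Q) (x : ℝ) : CusumMatrix Q :=
  fun q j => max (Y q j + logRatio P q.succ j x) 0

/-- The minimum `min_{j ≠ q} Y(q, j)` of row `q`. -/
def rowMin (Y : CusumMatrix Q) (q : Fin Q) : EReal :=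
  ⨅ j : {j : Fin (Q + 1) // j ≠ q.succ}, Y q j

open Classical in
/-- The hypotheses that are acceptable at a sensor: `rowMin Y q ≥ h`. -/
def acceptable (h : ℝ) (Y : CusumMatrix Q) : Finset (Fin Q) :=
  Finset.univ.filter fun q => (h : EReal) ≤ rowMin Y q

/-! ### Fusion center -/

/-- How the fusion center selects its decision if several hypotheses qualify at the same time. -/
structure TieBreak (Q : ℕ) where
  pick : Finset (Fin Q) → Fin Q
  pick_mem : ∀ S, S.Nonempty → pick S ∈ S

/-- The hypotheses supported by at least `d` sensors, where `support k` is the set of hypotheses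
that sensor `k` supports. -/
def qualified (d : ℕ) (support : Fin K → Finset (Fin Q)) : Finset (Fin Q) :=
  Finset.univ.filter fun q => d ≤ (Finset.univ.filter fun k => q ∈ support k).card

/-- The fusion center declares a hypothesis supported by at least `d` sensors, if there is one. -/
def fusion (sel : TieBreak Q) (d : ℕ) (support : Fin K → Finset (Fin Q)) : Option (Fin Q) :=
  if (qualified d support).Nonempty then some (sel.pick (qualified d support)) else none

/-! ### The simultaneous `d`-th alarm -/

/-- State after some time: all CUSUM matrices, and the declaration made at that time. -/
structure SimState (Q K : ℕ) where
  Y : Fin K → CusumMatrix Q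
  decision : Option (Fin Q)

def SimState.init (Q K : ℕ) : SimState Q K := ⟨fun _ _ _ => 0, none⟩

/-- After an alarm everything restarts from the initial state. -/
def SimState.restart (s : SimState Q K) : SimState Q K :=
  if s.decision.isSome then SimState.init Q K else s

/-- One time step: `x k` is the observation of sensor `k` and `a k` the set of hypotheses that
sensor `k` calls acceptable in case it is compromised. -/
def SimState.step (P : Densities Q) (sel : TieBreak Q) (d : ℕ) (h : ℝ) (B : Finset (Fin K))
    (s : SimState Q K) (x : Fin K → ℝ) (a : Fin K → Finset (Fin Q)) : SimState Q K :=
  let Y := fun k => cusumStep P (s.restart.Y k) (x k)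
  { Y := Y
    decision := fusion sel d fun k => if k ∈ B then a k else acceptable h (Y k) }

/-- State of the simultaneous `d`-th alarm with local threshold `h` at time `t`, with restart
after every alarm. Every sensor sends a subset of `[Q]`, that is `Q` bits, at every time. -/
def simState {M : ℕ} (P : Densities Q) (sel : TieBreak Q) (d : ℕ) (h : ℝ)
    (g : Attack K M (Finset (Fin Q))) (ω : Sample Q K) : ℕ → SimState Q K
  | 0 => SimState.init Q K
  | t + 1 => (simState P sel d h g ω t).step P sel d h g.compromised (ω.1 t)
      (g.signal (t + 1) fun i => ω.1 i)

/-- The declaration made at time `t` (`none` if no alarm is raised at time `t`). -/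
def simRule {M : ℕ} (P : Densities Q) (sel : TieBreak Q) (d : ℕ) (h : ℝ)
    (g : Attack K M (Finset (Fin Q))) (ω : Sample Q K) (t : ℕ) : Option (Fin Q) :=
  (simState P sel d h g ω t).decision

/-! ### The multi-shot `d`-th alarm -/

/-- State of an honest sensor: CUSUM matrix, hypotheses found acceptable so far, and the queue of
those which are still to be reported. -/
structure SensorState (Q : ℕ) where
  Y : CusumMatrix Q
  seen : Finset (Fin Q)
  queue : List (Fin Q)

def SensorState.init (Q : ℕ) : SensorState Q := ⟨fun _ _ => 0, ∅, []⟩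

open Classical in
/-- List the elements of `S` by decreasing `rowMin Y`; the random numbers `u` determine the order
of those with equal value. -/
def reportOrder (Y : CusumMatrix Q) (u : Fin Q → ℝ) (S : Finset (Fin Q)) : List (Fin Q) :=
  ((List.finRange Q).filter fun q => q ∈ S).insertionSort fun a b =>
    rowMin Y b < rowMin Y a ∨ (rowMin Y b = rowMin Y a ∧ u a ≤ u b)

/-- One time step of an honest sensor: update the statistics and enqueue the hypotheses that became
acceptable for the first time. The head of the resulting queue is reported at this time. -/
def SensorState.enqueue (P : Densities Q) (h : ℝ) (s : SensorState Q) (x : ℝ) (u : Fin Q → ℝ) :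
    SensorState Q :=
  let Y := cusumStep P s.Y x
  { Y := Y
    seen := s.seen ∪ acceptable h Y
    queue := s.queue ++ reportOrder Y u (acceptable h Y \ s.seen) }

def SensorState.report (s : SensorState Q) : Option (Fin Q) := s.queue.head?

def SensorState.dequeue (s : SensorState Q) : SensorState Q := { s with queue := s.queue.tail }

/-- State after some time: all sensors, the hypotheses that each sensor has reported so far,
and the declaration made at that time. -/
structure MultiState (Q K : ℕ) where
  sensor : Fin K → SensorState Q
  votes : Fin K → Finset (Fin Q)
  decision : Option (Fin Q)

def MultiState.init (Q K : ℕ) : MultiState Q K :=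
  ⟨fun _ => SensorState.init Q, fun _ => ∅, none⟩

/-- After an alarm everything restarts from the initial state. -/
def MultiState.restart (s : MultiState Q K) : MultiState Q K :=
  if s.decision.isSome then MultiState.init Q K else s

/-- One time step: `x k` is the observation of sensor `k`, `u k` its tie-breaking random numbers,
and `a k` its report (`none` if it stays silent) in case it is compromised. -/
def MultiState.step (P : Densities Q) (sel : TieBreak Q) (d : ℕ) (h : ℝ) (B : Finset (Fin K))
    (s : MultiState Q K) (x : Fin K → ℝ) (u : Fin K → Fin Q → ℝ) (a : Fin K → Option (Fin Q)) :
    MultiState Q K :=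
  let sensor := fun k => (s.restart.sensor k).enqueue P h (x k) (u k)
  let votes := fun k =>
    s.restart.votes k ∪ (if k ∈ B then a k else (sensor k).report).toFinset
  { sensor := fun k => (sensor k).dequeue
    votes := votes
    decision := fusion sel d votes }

/-- State of the multi-shot `d`-th alarm with local threshold `h` at time `t`, with restart after
every alarm. Every sensor sends at most one element of `[Q]` at every time. -/
def multiState {M : ℕ} (P : Densities Q) (sel : TieBreak Q) (d : ℕ) (h : ℝ)
    (g : Attack K M (Option (Fin Q))) (ω : Sample Q K) : ℕ → MultiState Q K
  | 0 => MultiState.init Q K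
  | t + 1 => (multiState P sel d h g ω t).step P sel d h g.compromised (ω.1 t) (ω.2 t)
      (g.signal (t + 1) fun i => ω.1 i)

/-- The declaration made at time `t` (`none` if no alarm is raised at time `t`). -/
def multiRule {M : ℕ} (P : Densities Q) (sel : TieBreak Q) (d : ℕ) (h : ℝ)
    (g : Attack K M (Option (Fin Q))) (ω : Sample Q K) (t : ℕ) : Option (Fin Q) :=
  (multiState P sel d h g ω t).decision

/-! ### Stopping times and performance metrics -/

/-- Whether the fusion center stops after its first alarm (so that `T_ρ = ∞` for `ρ > 1`), or
restarts after every alarm. -/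
inductive Mode
  | once
  | restart

/-- The alarm times `0 = T_0 < T_1 < T_2 < …` of a sequence of declarations. -/
def alarmTime (dec : ℕ → Option (Fin Q)) : ℕ → ℕ∞
  | 0 => 0
  | ρ + 1 => ⨅ (t : ℕ) (_ : alarmTime dec ρ < t ∧ (dec t).isSome), (t : ℕ∞)

/-- `T^q = inf {T_ρ : ρ ≥ 1, the decision at T_ρ is q}`, with `inf ∅ = ∞`. -/
def typeTime (mode : Mode) (dec : ℕ → Option (Fin Q)) (q : Fin Q) : ℕ∞ :=
  ⨅ (ρ : ℕ) (t : ℕ) (_ : 1 ≤ ρ ∧ (mode = Mode.once → ρ = 1) ∧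
    alarmTime dec ρ = t ∧ dec t = some q), (t : ℕ∞)

/-- A detection rule: the sequence of declarations under a given attack. -/
abbrev Rule (Q K M : ℕ) (A : Type) : Type :=
  Attack K M A → Sample Q K → ℕ → Option (Fin Q)

/-- `(T - ν)⁺` for the first alarm time `T = T_1`. -/
def delayAfter (dec : ℕ → Option (Fin Q)) (ν : ℕ) : ℝ≥0∞ :=
  (alarmTime dec 1 : ℝ≥0∞) - (ν : ℝ≥0∞)

/-- Worst-case mean detection delay
`sup_{q ∈ [Q]} sup_{g, ν} ess sup E_ν^{q, g}[(T - ν)⁺ | X_1, …, X_ν]`. -/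
def delay {M : ℕ} {A : Type} (P : Densities Q) (T : Rule Q K M A) : ℝ≥0∞ :=
  ⨆ (q : Fin Q) (g : Attack K M A) (ν : ℕ),
    essSup (condLExp (past Q K ν) (sampleLaw K P q.succ ν) fun ω => delayAfter (T g ω) ν)
      (sampleLaw K P q.succ ν)

/-- Worst-case mean time to a false alarm or a false isolation
`inf_{q ∈ [Q]⁺} inf_g inf_{q' ∈ [Q], q' ≠ q} E_0^{q, g}[T^{q'}]`. -/
def falseTime {M : ℕ} {A : Type} (P : Densities Q) (mode : Mode) (T : Rule Q K M A) : ℝ≥0∞ :=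
  ⨅ (q : Fin (Q + 1)) (g : Attack K M A) (q' : Fin Q) (_ : q'.succ ≠ q),
    ∫⁻ ω, (typeTime mode (T g ω) q' : ℝ≥0∞) ∂(sampleLaw K P q 0)

/-! ### First-order asymptotics -/

/-- `f ≲ b` as `γ → ∞`: `limsup f / b ≤ 1`. -/
def AsympLE (f : ℝ → ℝ≥0∞) (b : ℝ → ℝ) : Prop :=
  limsup (fun γ => f γ / ENNReal.ofReal (b γ)) atTop ≤ 1

/-- `f ≳ b` as `γ → ∞`: `liminf f / b ≥ 1`. -/
def AsympGE (f : ℝ → ℝ≥0∞) (b : ℝ → ℝ) : Prop :=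
  1 ≤ liminf (fun γ => f γ / ENNReal.ofReal (b γ)) atTop

end ByzantineQCD

end

/-!
The proof rests on two estimates for log-likelihood ratio walks. By the strong law of large numbers
all walks stay in cones around their means, with probability close to one
(`exists_linear_bound`, `exists_cone`); no rate is needed, so the second moments play no role. And
under the density in the denominator a CUSUM statistic exceeds `h` at a given time with probability
at most `exp (-h)`, independently for different sensors (`measure_expCusum_le`).

*Achievability.* A false alarm of the simultaneous `N`-th alarm needs `N - M` honest sensors that
are wrong at the same time, which has probability of order `exp (-(N - M) * h)` at each time, whereas
for the multi-shot alarm with `d > M` one wrong honest sensor at some earlier time is needed, which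
has probability of order `exp (-h)`. Restarts only decrease the statistics. Hence the mean time to a
false alarm exceeds `γ` for `h` close to `log γ / (N - M)` and `log γ` respectively (`le_falseTime`).
After the change, whatever the past and the attack, the statistics of all `N` honest sensors are
above `h` at the end of a block of about `h / I^*` observations, up to a small probability, and a
failed block is followed by independent ones (`eventually_delay_le`); the queues of the multi-shot
alarm cost at most `Q` further steps.

*Converse.* For `d ≤ M` the compromised sensors raise false alarms on their own, and for `d > N`
they suppress all alarms. For `M < d ≤ N` let `q` be a type and `j` the density closest to it. Under
`j`, the compromised sensors vote for `q` at all times. If `N - M` honest sensors had the density `q`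
for about `h / I(q, j)` observations, then an alarm of type `q` would be raised. Changing the
measure at these sensors costs a factor of about `exp ((N - M) * h)`, which bounds the mean time to a
false alarm from above (`eventually_falseTime_le`). For `j = 0` every alarm is false, and it suffices
that one of the `Q` types is declared first with probability at least `1 / Q`. For `j` a post-change
density, alarms of the type `j` are raised all the time, every one of them with a restart; such
cycles have a mean length linear in `h`, and each one ends with an alarm of type `q` with probability
of order `exp (-(N - M) * h)`. Both cases follow from a renewal inequality for the alarms
(`lintegral_waiting_mul_le`). So `h` is asymptotically at least `log γ / (N - M)`, while without any
attack the delay is at least about `h / I^*`, because no statistic climbs faster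
(`eventually_le_delay`).
-/

noncomputable section

namespace ByzantineQCD

/-! ### Sequences of independent observations -/

section Sequences

variable {X : Type*}

/-- The sequence that follows the first sequence up to index `n` and then runs through the
second one from its beginning. -/
def glue (n : ℕ) (p : (ℕ → X) × (ℕ → X)) : ℕ → X := fun i => if i < n then p.1 i else p.2 (i - n)

/-- The sequence without its first `n` terms. -/
def shift (n : ℕ) (x : ℕ → X) : ℕ → X := fun i => x (n + i)

@[simp] lemma shift_apply (n : ℕ) (x : ℕ → X) (i : ℕ) : shift n x i = x (n + i) := rfl

lemma shift_zero (x : ℕ → X) : shift 0 x = x := by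
  funext i; simp

lemma shift_shift (m n : ℕ) (x : ℕ → X) : shift m (shift n x) = shift (n + m) x := by
  funext i; simp [add_assoc]

@[simp] lemma shift_glue (n : ℕ) (p : (ℕ → X) × (ℕ → X)) : shift n (glue n p) = p.2 := by
  funext i; simp [glue]

lemma glue_apply_of_lt {n i : ℕ} (p : (ℕ → X) × (ℕ → X)) (hi : i < n) : glue n p i = p.1 i := by
  simp [glue, hi]

lemma dependsOn_indicator_one {E : Set (ℕ → X)} {s : Set ℕ} (hE : DependsOn (· ∈ E) s) :
    DependsOn (E.indicator (1 : (ℕ → X) → ℝ≥0∞)) s := fun x y hxy => by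
  have h : (x ∈ E) = (y ∈ E) := hE hxy
  by_cases hx : x ∈ E
  · have hy : y ∈ E := h ▸ hx
    simp [hx, hy]
  · have hy : y ∉ E := h ▸ hx
    simp [hx, hy]

/-- None of the first `m` blocks of length `l` belongs to `G`. -/
def badBlocks (l : ℕ) (G : Set (ℕ → X)) (m : ℕ) : Set (ℕ → X) :=
  {x | ∀ i < m, shift (i * l) x ∉ G}

/-- The index at which the first block in `G` ends, `∞` if there is none. -/
def blockTime (l : ℕ) (G : Set (ℕ → X)) (x : ℕ → X) : ℝ≥0∞ :=
  ∑' m, (badBlocks l G m).indicator (fun _ => (l : ℝ≥0∞)) x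

/-- A time that comes no later than the end of any good block is at most `blockTime`. -/
lemma le_blockTime {l : ℕ} (hl : 0 < l) {G : Set (ℕ → X)} {x : ℕ → X} {T : ℝ≥0∞}
    (hT : ∀ m, shift (m * l) x ∈ G → T ≤ ((m + 1) * l : ℕ)) : T ≤ blockTime l G x := by
  classical
  by_cases hex : ∃ m, shift (m * l) x ∈ G
  · refine (hT _ (Nat.find_spec hex)).trans ?_
    refine le_trans ?_ (ENNReal.sum_le_tsum (Finset.range (Nat.find hex + 1)))
    rw [Finset.sum_congr rfl (g := fun _ => (l : ℝ≥0∞))]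
    · simp
    · intro m hm
      refine Set.indicator_of_mem (fun i hi => ?_) _
      exact Nat.find_min hex (by have := Finset.mem_range.1 hm; omega)
  · push Not at hex
    have : blockTime l G x = ∑' _ : ℕ, (l : ℝ≥0∞) :=
      tsum_congr fun m =>
      Set.indicator_of_mem (show x ∈ badBlocks l G m from fun i _ => hex i) _
    rw [this, ENNReal.tsum_const_eq_top_of_ne_zero (by simpa using hl.ne')]
    exact le_top

variable [MeasurableSpace X]

@[fun_prop]
lemma measurable_glue (n : ℕ) : Measurable (glue (X := X) n) := by
  refine measurable_pi_lambda _ fun i => ?_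
  unfold glue
  by_cases hi : i < n <;> simp only [hi, if_true, if_false] <;> fun_prop

@[fun_prop]
lemma measurable_shift (n : ℕ) : Measurable (shift (X := X) n) :=
  measurable_pi_lambda _ fun i => by simp only [shift_apply]; fun_prop

/-- The prefix of one random sequence followed by an independent random sequence: this is how
independence of past and future enters all arguments below. -/
lemma map_glue (n : ℕ) (μ ν ρ : ℕ → Measure X) [∀ i, IsProbabilityMeasure (μ i)]
    [∀ i, IsProbabilityMeasure (ν i)] [∀ i, IsProbabilityMeasure (ρ i)]
    (h₁ : ∀ i < n, ρ i = μ i) (h₂ : ∀ i, ρ (n + i) = ν i) :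
    ((Measure.infinitePi μ).prod (Measure.infinitePi ν)).map (glue n) = Measure.infinitePi ρ := by
  classical
  refine Measure.eq_infinitePi _ fun s t ht => ?_
  rw [Measure.map_apply (measurable_glue n) (.pi s.countable_toSet fun i _ => ht i)]
  have hset : glue n ⁻¹' (Set.pi s t) =
      (Set.pi ((s.filter (· < n) : Finset ℕ) : Set ℕ) t) ×ˢ
        (Set.pi (((s.filter (¬ · < n)).image (· - n) : Finset ℕ) : Set ℕ)
          fun i => t (n + i)) := by
    ext ⟨x, y⟩
    simp only [Set.mem_preimage, Set.mem_pi, Finset.mem_coe, Set.mem_prod, Finset.mem_filter,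
      Finset.mem_image, glue]
    constructor
    · intro h
      refine ⟨fun i hi => by simpa [hi.2] using h i hi.1, ?_⟩
      rintro _ ⟨i, ⟨his, hin⟩, rfl⟩
      have := h i his
      rw [if_neg hin] at this
      rwa [Nat.add_sub_cancel' (not_lt.mp hin)]
    · rintro ⟨h1, h2⟩ i hi
      by_cases hin : i < n
      · simpa [hin] using h1 i ⟨hi, hin⟩
      · have := h2 (i - n) ⟨i, ⟨hi, hin⟩, rfl⟩
        rw [Nat.add_sub_cancel' (not_lt.mp hin)] at this
        simpa [hin] using this
  rw [hset, Measure.prod_prod, Measure.infinitePi_pi _ fun i _ => ht i,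
    Measure.infinitePi_pi _ fun i _ => ht (n + i), Finset.prod_image,
    ← Finset.prod_filter_mul_prod_filter_not s (· < n)]
  · congr 1
    · exact Finset.prod_congr rfl fun i hi => by rw [h₁ i (Finset.mem_filter.1 hi).2]
    · refine Finset.prod_congr rfl fun i hi => ?_
      have hin := not_lt.mp (Finset.mem_filter.1 hi).2
      rw [← h₂, Nat.add_sub_cancel' hin]
  · intro a ha b hb hab
    have ha := not_lt.mp (Finset.mem_filter.1 ha).2
    have hb := not_lt.mp (Finset.mem_filter.1 hb).2
    have : a - n = b - n := hab
    omega

/-- A function of the first `n` terms is independent of a function of the remaining ones. -/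
lemma lintegral_prefix_mul_shift (n : ℕ) (μ : ℕ → Measure X) [∀ i, IsProbabilityMeasure (μ i)]
    {u v : (ℕ → X) → ℝ≥0∞} (hu : Measurable u) (hv : Measurable v)
    (hun : DependsOn u (Set.Iio n)) :
    ∫⁻ x, u x * v (shift n x) ∂Measure.infinitePi μ =
      (∫⁻ x, u x ∂Measure.infinitePi μ) *
        ∫⁻ x, v x ∂Measure.infinitePi fun i => μ (n + i) := by
  conv_lhs => rw [← map_glue n μ (fun i => μ (n + i)) μ (fun _ _ => rfl) (fun _ => rfl)]
  rw [lintegral_map (by fun_prop) (by fun_prop), ← lintegral_prod_mul hu.aemeasurable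
    hv.aemeasurable]
  refine lintegral_congr fun p => ?_
  rw [shift_glue, hun fun i hi => glue_apply_of_lt p hi]

/-- The integral of a function of the first `n` terms only depends on the laws of these. -/
lemma lintegral_prefix_congr (n : ℕ) (μ ν : ℕ → Measure X) [∀ i, IsProbabilityMeasure (μ i)]
    [∀ i, IsProbabilityMeasure (ν i)] (h : ∀ i < n, μ i = ν i)
    {u : (ℕ → X) → ℝ≥0∞} (hu : Measurable u) (hun : DependsOn u (Set.Iio n)) :
    ∫⁻ x, u x ∂Measure.infinitePi μ = ∫⁻ x, u x ∂Measure.infinitePi ν := by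
  rw [← map_glue n ν (fun i => μ (n + i)) μ h (fun _ => rfl),
    lintegral_map hu (by fun_prop)]
  have : ∀ p : (ℕ → X) × (ℕ → X), u (glue n p) = u p.1 := fun p =>
    hun fun i hi => glue_apply_of_lt p hi
  simp_rw [this]
  rw [lintegral_prod _ (by fun_prop)]
  simp

/-- Law of a sequence of independent observations with common law `μ`. -/
abbrev iid (μ : Measure X) [IsProbabilityMeasure μ] : Measure (ℕ → X) :=
  Measure.infinitePi fun _ : ℕ => μ

variable (μ : Measure X) [IsProbabilityMeasure μ]

/-- Independence of the first `n` terms and the term with index `n`. -/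
lemma lintegral_prefix_prod_eval (n : ℕ) {u : (ℕ → X) → X → ℝ≥0∞}
    (hu : Measurable (Function.uncurry u))
    (hun : ∀ a, DependsOn (fun x => u x a) (Set.Iio n)) :
    ∫⁻ x, u x (x n) ∂iid μ = ∫⁻ a, ∫⁻ x, u x a ∂iid μ ∂μ := by
  have hm : Measurable fun x : ℕ → X => u x (x n) :=
    hu.comp (measurable_id.prodMk (measurable_pi_apply n))
  conv_lhs => rw [iid, ← map_glue n (fun _ => μ) (fun _ => μ) (fun _ => μ)
    (fun _ _ => rfl) (fun _ => rfl)]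
  rw [lintegral_map hm (by fun_prop)]
  have h0 : ∀ p : (ℕ → X) × (ℕ → X), u (glue n p) (glue n p n) = u p.1 (p.2 0) := fun p => by
    have : glue n p n = p.2 0 := by simp [glue]
    rw [this]
    exact hun _ fun i hi => glue_apply_of_lt p hi
  simp_rw [h0]
  have hm2 : Measurable fun p : (ℕ → X) × (ℕ → X) => u p.1 (p.2 0) :=
    hu.comp (measurable_fst.prodMk ((measurable_pi_apply 0).comp measurable_snd))
  rw [lintegral_prod_symm' _ hm2]
  have hm3 : Measurable fun a => ∫⁻ x, u x a ∂iid μ :=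
    Measurable.lintegral_prod_left' (f := Function.uncurry u) hu
  exact (measurePreserving_eval_infinitePi (fun _ : ℕ => μ) 0).lintegral_comp hm3

lemma measurableSet_badBlocks {l : ℕ} {G : Set (ℕ → X)} (hG : MeasurableSet G) (m : ℕ) :
    MeasurableSet (badBlocks l G m) := by
  have : badBlocks l G m = ⋂ i ∈ Finset.range m, shift (i * l) ⁻¹' Gᶜ := by
    ext x; simp [badBlocks]
  rw [this]
  exact Finset.measurableSet_biInter _ fun i _ => measurable_shift _ hG.compl

lemma measure_badBlocks {l : ℕ} {G : Set (ℕ → X)} (hG : MeasurableSet G)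
    (hGl : DependsOn (· ∈ G) (Set.Iio l)) (m : ℕ) :
    iid μ (badBlocks l G m) = (1 - iid μ G) ^ m := by
  induction m with
  | zero =>
    have : badBlocks l G 0 = Set.univ := by ext x; simp [badBlocks]
    simp [this]
  | succ m ih =>
    have hset : badBlocks l G (m + 1) = {x | x ∉ G ∧ shift l x ∈ badBlocks l G m} := by
      ext x
      simp only [badBlocks, Set.mem_ofPred_eq, shift_shift]
      constructor
      · intro h
        refine ⟨by simpa [shift_zero] using h 0 (by omega), fun i hi => ?_⟩
        have := h (i + 1) (by omega)
        rwa [Nat.succ_mul, add_comm] at this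
      · rintro ⟨h0, h1⟩ i hi
        rcases i with _ | i
        · simpa [shift_zero] using h0
        · have := h1 i (by omega)
          rwa [Nat.succ_mul, add_comm]
    have hB := measurableSet_badBlocks (l := l) hG m
    have hu : DependsOn (Gᶜ.indicator (1 : (ℕ → X) → ℝ≥0∞)) (Set.Iio l) :=
      dependsOn_indicator_one fun x y hxy => congrArg Not (hGl hxy)
    rw [← lintegral_indicator_one (measurableSet_badBlocks hG _)]
    have := lintegral_prefix_mul_shift l (fun _ : ℕ => μ)
      (measurable_one.indicator hG.compl) (measurable_one.indicator hB) hu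
    rw [pow_succ', ← ih, ← prob_compl_eq_one_sub hG, ← lintegral_indicator_one hG.compl,
      ← lintegral_indicator_one hB, ← this]
    refine lintegral_congr fun x => ?_
    by_cases h1 : x ∈ G <;> by_cases h2 : shift l x ∈ badBlocks l G m <;>
      simp [hset, h1, h2]

lemma measurable_blockTime {l : ℕ} {G : Set (ℕ → X)} (hG : MeasurableSet G) :
    Measurable (blockTime l G) :=
  Measurable.tsum fun m => measurable_const.indicator (measurableSet_badBlocks hG m)

lemma lintegral_blockTime {l : ℕ} {G : Set (ℕ → X)} (hG : MeasurableSet G)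
    (hGl : DependsOn (· ∈ G) (Set.Iio l)) :
    ∫⁻ x, blockTime l G x ∂iid μ = l / iid μ G := by
  unfold blockTime
  rw [lintegral_tsum fun m =>
    (measurable_const.indicator (measurableSet_badBlocks hG m)).aemeasurable]
  simp_rw [lintegral_indicator_const (measurableSet_badBlocks hG _), measure_badBlocks μ hG hGl]
  rw [ENNReal.tsum_mul_left, ENNReal.tsum_geometric, ENNReal.sub_sub_cancel (by simp) prob_le_one,
    div_eq_mul_inv]

end Sequences

/-! ### Regenerative alarms -/

section Regenerative

variable {X D : Type*}

/-- No alarm with a type in `S` is raised at the times `1, …, n`. -/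
def quiet (dec : (ℕ → X) → ℕ → Option D) (S : Set D) (n : ℕ) : Set (ℕ → X) :=
  {x | ∀ t, 1 ≤ t → t ≤ n → ∀ p ∈ S, dec x t ≠ some p}

/-- The time of the first alarm with a type in `S`, written as the sum of its tail indicators. -/
def waiting (dec : (ℕ → X) → ℕ → Option D) (S : Set D) (x : ℕ → X) : ℝ≥0∞ :=
  ∑' n, (quiet dec S n).indicator 1 x

/-- The first of all alarms has a type in `S`. -/
def firstAlarmIn (dec : (ℕ → X) → ℕ → Option D) (S : Set D) : Set (ℕ → X) :=
  {x | ∃ t, 1 ≤ t ∧ (∀ s, 1 ≤ s → s < t → dec x s = none) ∧ ∃ p ∈ S, dec x t = some p}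

/-- The first of all alarms is raised at time `t` and has a type outside `S`. -/
def firstAlarmNotIn (dec : (ℕ → X) → ℕ → Option D) (S : Set D) (t : ℕ) : Set (ℕ → X) :=
  {x | (∀ s, 1 ≤ s → s < t → dec x s = none) ∧ ∃ p ∉ S, dec x t = some p}

lemma le_waiting_of_mem_quiet {dec : (ℕ → X) → ℕ → Option D} {S : Set D} {n : ℕ} {x : ℕ → X}
    (h : x ∈ quiet dec S n) : ((n + 1 : ℕ) : ℝ≥0∞) ≤ waiting dec S x := by
  refine le_trans ?_ (ENNReal.sum_le_tsum (Finset.range (n + 1)))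
  rw [Finset.sum_congr rfl (g := fun _ => 1)]
  · simp
  · intro m hm
    have := Finset.mem_range.1 hm
    exact Set.indicator_of_mem
      (show x ∈ quiet dec S m from fun t h1 h2 => h t h1 (by omega)) _

/-- Cut at its first alarm: an alarm of type in `S` comes no later than the first alarm, or the
first alarm has another type and the procedure starts afresh. -/
lemma sum_quiet_le {dec : (ℕ → X) → ℕ → Option D} {S : Set D}
    (hreg : ∀ x n, (dec x n).isSome → ∀ t, 1 ≤ t → dec x (n + t) = dec (shift n x) t)
    (N : ℕ) (x : ℕ → X) :
    ∑ n ∈ Finset.range N, (quiet dec S n).indicator (1 : (ℕ → X) → ℝ≥0∞) x ≤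
      waiting dec Set.univ x + ∑ t ∈ Finset.Ico 1 N, (firstAlarmNotIn dec S t).indicator 1 x *
        ∑ n ∈ Finset.range N, (quiet dec S n).indicator 1 (shift t x) := by
  classical
  have hW : ∑ n ∈ Finset.range N, (quiet dec Set.univ n).indicator (1 : (ℕ → X) → ℝ≥0∞) x ≤
      waiting dec Set.univ x := ENNReal.sum_le_tsum _
  by_cases hex : ∃ t, 1 ≤ t ∧ dec x t ≠ none
  swap
  · push Not at hex
    refine le_trans (Finset.sum_le_sum fun n _ => ?_) (hW.trans le_self_add)
    refine le_trans (Set.indicator_le_self' (by simp) x) ?_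
    rw [Set.indicator_of_mem (show x ∈ quiet dec Set.univ n from fun t h1 _ p _ => by
      simp [hex t h1])]
  obtain ⟨h1, hne⟩ := Nat.find_spec hex
  have hmin : ∀ s, 1 ≤ s → s < Nat.find hex → dec x s = none := fun s h1 hs => by
    by_contra hc
    exact Nat.find_min hex hs ⟨h1, hc⟩
  set t₀ := Nat.find hex
  obtain ⟨p, hp⟩ := Option.ne_none_iff_exists'.1 hne
  have hbefore : ∀ n < t₀, x ∈ quiet dec Set.univ n := fun n hn t h1 h2 p _ => by
    simp [hmin t h1 (by omega)]
  by_cases hpS : p ∈ S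
  · refine le_trans (Finset.sum_le_sum fun n _ => ?_) (hW.trans le_self_add)
    by_cases hn : n < t₀
    · rw [Set.indicator_of_mem (hbefore n hn)]
      exact Set.indicator_le_self' (by simp) x
    · rw [Set.indicator_of_notMem]
      · exact zero_le
      · exact fun hq => hq t₀ h1 (by omega) p hpS hp
  · by_cases hN : t₀ < N
    swap
    · refine le_trans (Finset.sum_le_sum fun n hn => ?_) (hW.trans le_self_add)
      rw [Set.indicator_of_mem (hbefore n (by have := Finset.mem_range.1 hn; omega))]
      exact Set.indicator_le_self' (by simp) x
    have hterm : ∑ n ∈ Finset.range N, (quiet dec S n).indicator (1 : (ℕ → X) → ℝ≥0∞) (shift t₀ x) ≤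
        ∑ t ∈ Finset.Ico 1 N, (firstAlarmNotIn dec S t).indicator 1 x *
        ∑ n ∈ Finset.range N, (quiet dec S n).indicator 1 (shift t x) := by
      refine le_trans ?_ (Finset.single_le_sum (f := fun t =>
        (firstAlarmNotIn dec S t).indicator (1 : (ℕ → X) → ℝ≥0∞) x *
        ∑ n ∈ Finset.range N, (quiet dec S n).indicator 1 (shift t x)) (fun _ _ => zero_le)
        (Finset.mem_Ico.2 ⟨h1, hN⟩))
      rw [Set.indicator_of_mem (show x ∈ firstAlarmNotIn dec S t₀ from ⟨hmin, p, hpS, hp⟩)]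
      simp
    refine le_trans ?_ (add_le_add hW hterm)
    obtain ⟨m, rfl⟩ : ∃ m, N = t₀ + m := ⟨N - t₀, by omega⟩
    have hsplit := Finset.sum_range_add (fun n => (quiet dec S n).indicator (1 : (ℕ → X) → ℝ≥0∞) x) t₀ m
    rw [hsplit]
    refine add_le_add ?_ ?_
    · refine le_trans (Finset.sum_le_sum fun n hn => ?_)
        (Finset.sum_le_sum_of_subset (Finset.range_mono (Nat.le_add_right t₀ m)))
      rw [Set.indicator_of_mem (hbefore n (Finset.mem_range.1 hn))]
      exact Set.indicator_le_self' (by simp) x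
    · refine le_trans (Finset.sum_le_sum fun n hn => ?_)
        (Finset.sum_le_sum_of_subset (Finset.range_mono (Nat.le_add_left m t₀)))
      by_cases hq : x ∈ quiet dec S (t₀ + n)
      · rw [Set.indicator_of_mem hq, Set.indicator_of_mem]
        · rfl
        intro t h1 h2 p' hp'
        rw [← hreg x t₀ (by simp [hp]) t h1]
        exact hq _ (by omega) (by omega) p' hp'
      · rw [Set.indicator_of_notMem hq]
        exact zero_le

variable [MeasurableSpace X] {dec : (ℕ → X) → ℕ → Option D}

lemma measurableSet_quiet [Countable D] (hdec : ∀ t o, MeasurableSet {x | dec x t = o})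
    (S : Set D) (n : ℕ) : MeasurableSet (quiet dec S n) := by
  have : quiet dec S n = ⋂ t ∈ Finset.Icc 1 n, ⋂ p ∈ S, {x | dec x t = some p}ᶜ := by
    ext x; simp [quiet]
  rw [this]
  exact Finset.measurableSet_biInter _ fun t _ =>
    MeasurableSet.biInter S.to_countable fun p _ => (hdec t _).compl

lemma measurable_waiting [Countable D] (hdec : ∀ t o, MeasurableSet {x | dec x t = o})
    (S : Set D) : Measurable (waiting dec S) :=
  Measurable.tsum fun n => measurable_one.indicator (measurableSet_quiet hdec S n)

lemma measurableSet_firstAlarmNotIn [Countable D]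
    (hdec : ∀ t o, MeasurableSet {x | dec x t = o}) (S : Set D) (t : ℕ) :
    MeasurableSet (firstAlarmNotIn dec S t) := by
  have : firstAlarmNotIn dec S t =
      (⋂ s ∈ Finset.Ico 1 t, {x | dec x s = none}) ∩ ⋃ p ∈ Sᶜ, {x | dec x t = some p} := by
    ext x; simp [firstAlarmNotIn]
  rw [this]
  exact (Finset.measurableSet_biInter _ fun s _ => hdec s _).inter
    (MeasurableSet.biUnion (Set.to_countable _) fun p _ => hdec t _)

lemma measurableSet_firstAlarmIn [Countable D]
    (hdec : ∀ t o, MeasurableSet {x | dec x t = o}) (S : Set D) :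
    MeasurableSet (firstAlarmIn dec S) := by
  have : firstAlarmIn dec S = ⋃ t ∈ Set.Ici 1, (⋂ s ∈ Finset.Ico 1 t, {x | dec x s = none}) ∩
      ⋃ p ∈ S, {x | dec x t = some p} := by
    ext x
    simp only [firstAlarmIn, Set.mem_ofPred_eq, Set.mem_iUnion, Set.mem_inter_iff,
      Set.mem_iInter, Set.mem_Ici, Finset.mem_Ico, and_imp, exists_prop]
  rw [this]
  exact MeasurableSet.biUnion (Set.to_countable _) fun t _ =>
    (Finset.measurableSet_biInter _ fun s _ => hdec s _).inter
    (MeasurableSet.biUnion (Set.to_countable _) fun p _ => hdec t _)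

/-- A form of Wald's identity: the mean time to an alarm with type in `S`, multiplied by the
probability that the first alarm is of this kind, is at most the mean time to the first alarm. -/
lemma lintegral_waiting_mul_le [Countable D] (μ : Measure X) [IsProbabilityMeasure μ]
    (hdec : ∀ t o, MeasurableSet {x | dec x t = o})
    (hdep : ∀ t, DependsOn (fun x => dec x t) (Set.Iio t))
    (hreg : ∀ x n, (dec x n).isSome → ∀ t, 1 ≤ t → dec x (n + t) = dec (shift n x) t)
    (S : Set D) :
    (∫⁻ x, waiting dec S x ∂iid μ) * iid μ (firstAlarmIn dec S) ≤
      ∫⁻ x, waiting dec Set.univ x ∂iid μ := by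
  have hq := fun n => measurableSet_quiet hdec S n
  have hE := fun n => measurableSet_firstAlarmNotIn hdec S n
  have hR := measurableSet_firstAlarmIn hdec S
  have hqm : ∀ N, Measurable fun x => ∑ n ∈ Finset.range N,
      (quiet dec S n).indicator (1 : (ℕ → X) → ℝ≥0∞) x := fun N =>
    Finset.measurable_fun_sum _ fun n _ => measurable_one.indicator (hq n)
  -- The probabilities of the ways in which the first alarm can be raised add up to at most one.
  have hsum : ∀ N, ∑ t ∈ Finset.Ico 1 N, iid μ (firstAlarmNotIn dec S t) +
      iid μ (firstAlarmIn dec S) ≤ 1 := by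
    intro N
    have hdisj : (↑(Finset.Ico 1 N) : Set ℕ).PairwiseDisjoint (firstAlarmNotIn dec S) := by
      have key : ∀ a b, 1 ≤ a → a < b → ∀ x, x ∈ firstAlarmNotIn dec S a →
          x ∈ firstAlarmNotIn dec S b → False := by
        rintro a b ha hab x ⟨-, p, -, hp⟩ ⟨hb, -⟩
        simp [hb a ha hab] at hp
      intro a ha b hb hab
      have ha := (Finset.mem_Ico.1 (Finset.mem_coe.1 ha)).1
      have hb := (Finset.mem_Ico.1 (Finset.mem_coe.1 hb)).1
      refine Set.disjoint_left.2 fun x h1 h2 => ?_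
      rcases lt_or_gt_of_ne hab with h | h
      · exact key a b ha h x h1 h2
      · exact key b a hb h x h2 h1
    rw [← measure_biUnion_finset hdisj fun t _ => hE t, ← measure_union _ hR]
    · exact prob_le_one
    · refine Set.disjoint_left.2 fun x h1 h2 => ?_
      simp only [Set.mem_iUnion, Finset.mem_Ico] at h1
      obtain ⟨t, ⟨ht, -⟩, hb, p, hpS, hp⟩ := h1
      obtain ⟨t', ht', hb', p', hpS', hp'⟩ := h2
      rcases lt_trichotomy t t' with h | h | h
      · simp [hb' t ht h] at hp
      · subst h
        rw [hp] at hp'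
        exact hpS (by rw [Option.some.inj hp']; exact hpS')
      · simp [hb t' ht' h] at hp'
  -- The truncated time has finite mean, which allows to solve for it.
  have htrunc : ∀ N, (∫⁻ x, ∑ n ∈ Finset.range N, (quiet dec S n).indicator 1 x ∂iid μ) *
      iid μ (firstAlarmIn dec S) ≤ ∫⁻ x, waiting dec Set.univ x ∂iid μ := by
    intro N
    set u := ∫⁻ x, ∑ n ∈ Finset.range N, (quiet dec S n).indicator (1 : (ℕ → X) → ℝ≥0∞) x ∂iid μ
      with hu
    have hufin : u ≤ N := by
      refine (lintegral_mono (g := fun _ => (N : ℝ≥0∞)) fun x => ?_).trans (by simp)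
      refine (Finset.sum_le_sum (g := fun _ => 1) fun n _ =>
        Set.indicator_le_self' (by simp) x).trans (by simp)
    have hstep : u ≤ (∫⁻ x, waiting dec Set.univ x ∂iid μ) +
        (∑ t ∈ Finset.Ico 1 N, iid μ (firstAlarmNotIn dec S t)) * u := by
      refine (lintegral_mono fun x => sum_quiet_le hreg N x).trans ?_
      rw [lintegral_add_left (measurable_waiting hdec _), lintegral_finsetSum]
      · gcongr
        rw [Finset.sum_mul]
        refine Finset.sum_le_sum fun t _ => le_of_eq ?_
        have hdepE : DependsOn ((firstAlarmNotIn dec S t).indicator (1 : (ℕ → X) → ℝ≥0∞))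
            (Set.Iio t) := by
          refine dependsOn_indicator_one fun x y hxy => propext ?_
          have h1 : ∀ s ≤ t, dec x s = dec y s := fun s hs =>
            hdep s fun i hi => hxy i (lt_of_lt_of_le hi hs)
          exact and_congr (forall_congr' fun s => forall_congr' fun _ => forall_congr' fun hs =>
            by rw [h1 s hs.le]) (by rw [h1 t le_rfl])
        have := lintegral_prefix_mul_shift t (fun _ : ℕ => μ)
          (measurable_one.indicator (hE t)) (hqm N) hdepE
        rw [this, lintegral_indicator_one (hE t)]
      · exact fun t _ => (measurable_one.indicator (hE t)).mul
          ((hqm N).comp (measurable_shift t))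
    have h2 : u * iid μ (firstAlarmIn dec S) +
        (∑ t ∈ Finset.Ico 1 N, iid μ (firstAlarmNotIn dec S t)) * u ≤
        (∫⁻ x, waiting dec Set.univ x ∂iid μ) +
        (∑ t ∈ Finset.Ico 1 N, iid μ (firstAlarmNotIn dec S t)) * u := by
      refine le_trans ?_ hstep
      calc _ = u * (∑ t ∈ Finset.Ico 1 N, iid μ (firstAlarmNotIn dec S t) +
              iid μ (firstAlarmIn dec S)) := by ring
        _ ≤ u * 1 := by gcongr; exact hsum N
        _ = u := mul_one u
    refine (ENNReal.add_le_add_iff_right ?_).1 h2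
    refine ENNReal.mul_ne_top (ne_top_of_le_ne_top ENNReal.one_ne_top
      (le_self_add.trans (hsum N))) (ne_top_of_le_ne_top (ENNReal.natCast_ne_top N) hufin)
  have hlim : ∫⁻ x, waiting dec S x ∂iid μ =
      ⨆ N, ∫⁻ x, ∑ n ∈ Finset.range N, (quiet dec S n).indicator 1 x ∂iid μ := by
    rw [← lintegral_iSup hqm]
    · exact lintegral_congr fun x => ENNReal.tsum_eq_iSup_nat
    · intro a b hab x
      exact Finset.sum_le_sum_of_subset (Finset.range_mono hab)
  rw [hlim, ENNReal.iSup_mul]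
  exact iSup_le htrunc

/-- If the first alarm has a type in `S` with probability at least `π`, then some type in `S` has
a mean time to alarm of at most `|S| / π` times the mean time to the first alarm. -/
lemma exists_lintegral_waiting_le [Countable D] (μ : Measure X) [IsProbabilityMeasure μ]
    (hdec : ∀ t o, MeasurableSet {x | dec x t = o})
    (hdep : ∀ t, DependsOn (fun x => dec x t) (Set.Iio t))
    (hreg : ∀ x n, (dec x n).isSome → ∀ t, 1 ≤ t → dec x (n + t) = dec (shift n x) t)
    (S : Finset D) {π : ℝ≥0∞} (hπ : π ≠ 0) (hS : π ≤ iid μ (firstAlarmIn dec S)) :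
    ∃ p ∈ S, ∫⁻ x, waiting dec {p} x ∂iid μ ≤
      S.card * (∫⁻ x, waiting dec Set.univ x ∂iid μ) / π := by
  have hπtop : π ≠ ⊤ := ne_top_of_le_ne_top ENNReal.one_ne_top (hS.trans prob_le_one)
  have hU : firstAlarmIn dec (S : Set D) ⊆ ⋃ p ∈ S, firstAlarmIn dec {p} := by
    rintro x ⟨t, ht, hb, p, hp, hpx⟩
    simp only [Set.mem_iUnion]
    exact ⟨p, hp, t, ht, hb, p, rfl, hpx⟩
  have hle : π ≤ ∑ p ∈ S, iid μ (firstAlarmIn dec {p}) :=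
    hS.trans ((measure_mono hU).trans (measure_biUnion_finset_le _ _))
  have hne : S.Nonempty := by
    rcases S.eq_empty_or_nonempty with rfl | h
    · exact absurd (by simpa using hle) hπ
    · exact h
  obtain ⟨p, hp, hmax⟩ := S.exists_max_image (fun p => iid μ (firstAlarmIn dec {p})) hne
  refine ⟨p, hp, ?_⟩
  have h1 : π ≤ S.card * iid μ (firstAlarmIn dec {p}) := by
    refine hle.trans ((Finset.sum_le_sum hmax).trans ?_)
    simp
  rw [ENNReal.le_div_iff_mul_le (Or.inl hπ) (Or.inl hπtop)]
  calc _ ≤ (∫⁻ x, waiting dec {p} x ∂iid μ) * (S.card * iid μ (firstAlarmIn dec {p})) := by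
        gcongr
    _ = S.card * ((∫⁻ x, waiting dec {p} x ∂iid μ) * iid μ (firstAlarmIn dec {p})) := by ring
    _ ≤ _ := by
        gcongr
        exact lintegral_waiting_mul_le μ hdec hdep hreg {p}

end Regenerative

/-! ### The law of large numbers, changes of measure and exponential tails of CUSUM statistics -/

section Tools

variable {X : Type*}

/-- The exponential of a CUSUM statistic with likelihood ratio `r`. -/
def expCusum (r : X → ℝ≥0∞) (x : ℕ → X) : ℕ → ℝ≥0∞
  | 0 => 1
  | t + 1 => max (expCusum r x t * r (x t)) 1

lemma one_le_expCusum (r : X → ℝ≥0∞) (x : ℕ → X) (t : ℕ) : 1 ≤ expCusum r x t := by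
  cases t with
  | zero => exact le_rfl
  | succ t => exact le_max_right _ _

lemma dependsOn_expCusum (r : X → ℝ≥0∞) (t : ℕ) :
    DependsOn (fun x => expCusum r x t) (Set.Iio t) := by
  induction t with
  | zero => exact fun _ _ _ => rfl
  | succ t ih =>
    intro x y hxy
    have h1 : expCusum r x t = expCusum r y t := ih fun i hi => hxy i (lt_trans hi t.lt_succ_self)
    simp only [expCusum, h1, hxy t (Set.mem_Iio.2 t.lt_succ_self)]

variable [MeasurableSpace X]

/-- By the strong law of large numbers, all partial sums stay in a cone around their means, with
probability close to one. The constant does not depend on the horizon, so no maximal inequality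
(and no second moment) is needed below. -/
lemma exists_linear_bound (μ : Measure X) [IsProbabilityMeasure μ] {f : X → ℝ} (hf : Measurable f)
    (hint : Integrable f μ) {ε : ℝ} (hε : 0 < ε) {η : ℝ≥0∞} (hη : η ≠ 0) :
    ∃ C : ℝ, 0 ≤ C ∧ ∀ C', C ≤ C' → iid μ
      {x | ∀ t : ℕ, |∑ i ∈ Finset.range t, f (x i) - t * ∫ a, f a ∂μ| ≤ ε * t + C'}ᶜ ≤ η := by
  set m := ∫ a, f a ∂μ
  have hslln : ∀ᵐ x ∂iid μ, Tendsto (fun n : ℕ => (∑ i ∈ Finset.range n, f (x i)) / n) atTop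
      (nhds m) := by
    have hind : iIndepFun (fun (i : ℕ) (x : ℕ → X) => f (x i)) (iid μ) :=
      iIndepFun_infinitePi (P := fun _ : ℕ => μ) (X := fun _ => f) fun _ => hf
    have hev : ∀ i : ℕ, MeasurePreserving (fun x : ℕ → X => x i) (iid μ) μ := fun i =>
      measurePreserving_eval_infinitePi (fun _ : ℕ => μ) i
    have := strong_law_ae_real (μ := iid μ) (fun i x => f (x i))
      ((hev 0).integrable_comp_of_integrable hint)
      (fun i j hij => hind.indepFun hij)
      (fun i => by
        refine ⟨(hf.comp (hev i).measurable).aemeasurable,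
          (hf.comp (hev 0).measurable).aemeasurable, ?_⟩
        have h1 : ∀ i : ℕ, Measure.map (fun x : ℕ → X => f (x i)) (iid μ) = μ.map f := fun i => by
          exact (Measure.map_map hf (hev i).measurable).symm.trans (by rw [(hev i).map_eq])
        rw [h1, h1])
    have hm : ∫ x, f (x 0) ∂iid μ = m := by
      have h2 := integral_map (μ := iid μ) (hev 0).measurable.aemeasurable
        (f := f) (hf.aestronglyMeasurable)
      rw [(hev 0).map_eq] at h2
      exact h2.symm
    rwa [hm] at this
  set A : ℕ → Set (ℕ → X) := fun n =>
    {x | ∀ t : ℕ, |∑ i ∈ Finset.range t, f (x i) - t * m| ≤ ε * t + n} with hA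
  have hAm : ∀ n, MeasurableSet (A n) := fun n => by
    have : A n = ⋂ t : ℕ, {x | |∑ i ∈ Finset.range t, f (x i) - t * m| ≤ ε * t + n} := by
      ext x; simp [hA]
    rw [this]
    exact MeasurableSet.iInter fun t => measurableSet_le (by fun_prop) (by fun_prop)
  have hanti : Antitone fun n => (A n)ᶜ := fun a b hab => by
    refine Set.compl_subset_compl.2 fun x hx t => (hx t).trans ?_
    have : (a : ℝ) ≤ b := by exact_mod_cast hab
    linarith
  have hlim := tendsto_measure_iInter_atTop (μ := iid μ)
    (fun n => (hAm n).compl.nullMeasurableSet) hanti ⟨0, measure_ne_top _ _⟩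
  have hzero : iid μ (⋂ n, (A n)ᶜ) = 0 := by
    refine measure_mono_null ?_ (ae_iff.1 hslln)
    intro x hx hconv
    obtain ⟨n₀, hn₀⟩ := (Metric.tendsto_atTop.1 hconv) ε hε
    -- The finitely many times before the limit takes hold are absorbed into the constant.
    set C := ∑ t ∈ Finset.range n₀, |∑ i ∈ Finset.range t, f (x i) - t * m|
    obtain ⟨n, hn⟩ := exists_nat_ge C
    refine (Set.mem_iInter.1 hx n) fun t => ?_
    by_cases ht : t < n₀
    · have h1 : |∑ i ∈ Finset.range t, f (x i) - t * m| ≤ C :=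
        Finset.single_le_sum (f := fun t : ℕ => |∑ i ∈ Finset.range t, f (x i) - t * m|)
          (fun _ _ => abs_nonneg _) (Finset.mem_range.2 ht)
      have : 0 ≤ ε * t := by positivity
      linarith
    · rcases Nat.eq_zero_or_pos t with rfl | htpos
      · simp
      have h1 := hn₀ t (not_lt.1 ht)
      rw [Real.dist_eq] at h1
      have htp : (0 : ℝ) < t := by exact_mod_cast htpos
      have h2 : ∑ i ∈ Finset.range t, f (x i) - t * m =
          t * ((∑ i ∈ Finset.range t, f (x i)) / t - m) := by field_simp
      rw [h2, abs_mul, abs_of_pos htp]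
      have : (t : ℝ) * |(∑ i ∈ Finset.range t, f (x i)) / t - m| ≤ t * ε :=
        mul_le_mul_of_nonneg_left h1.le htp.le
      have h3 : (0 : ℝ) ≤ n := n.cast_nonneg
      linarith
  rw [hzero] at hlim
  obtain ⟨n, hn⟩ := (hlim.eventually (gt_mem_nhds (pos_iff_ne_zero.2 hη))).exists
  refine ⟨n, n.cast_nonneg, fun C' hC' => (measure_mono ?_).trans hn.le⟩
  refine Set.compl_subset_compl.2 fun x hx t => (hx t).trans ?_
  linarith

/-- Tilting finitely many coordinates of a product measure multiplies the densities. -/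
lemma infinitePi_withDensity {ι : Type*} {X : ι → Type*} [∀ i, MeasurableSpace (X i)]
    (μ ρ : (i : ι) → Measure (X i)) [∀ i, IsProbabilityMeasure (μ i)]
    [∀ i, IsProbabilityMeasure (ρ i)] (I : Finset ι) (r : (i : ι) → X i → ℝ≥0∞)
    (hr : ∀ i, Measurable (r i)) (hI : ∀ i ∈ I, ρ i = (μ i).withDensity (r i))
    (hIc : ∀ i ∉ I, ρ i = μ i) :
    Measure.infinitePi ρ = (Measure.infinitePi μ).withDensity fun x => ∏ i ∈ I, r i (x i) := by
  classical
  refine (Measure.eq_infinitePi _ fun s t ht => ?_).symm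
  rw [withDensity_apply _ (.pi s.countable_toSet fun i _ => ht i), ← lintegral_indicator
    (.pi s.countable_toSet fun i _ => ht i)]
  set w : (i : ι) → X i → ℝ≥0∞ := fun i a =>
    (if i ∈ s then (t i).indicator 1 a else 1) * (if i ∈ I then r i a else 1) with hw
  have hwm : ∀ i, Measurable (w i) := fun i => by
    refine Measurable.mul ?_ ?_
    · by_cases h : i ∈ s <;> simp only [h, if_true, if_false]
      · exact measurable_one.indicator (ht i)
      · exact measurable_const
    · by_cases h : i ∈ I <;> simp only [h, if_true, if_false]
      · exact hr i
      · exact measurable_const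
  have hpt : ∀ x : (i : ι) → X i, (Set.pi (s : Set ι) t).indicator
      (fun x => ∏ i ∈ I, r i (x i)) x = ∏ i ∈ s ∪ I, w i (x i) := by
    intro x
    rw [hw]
    simp only
    rw [Finset.prod_mul_distrib, Finset.prod_ite_mem, Finset.prod_ite_mem,
      Finset.union_inter_cancel_left, Finset.union_inter_cancel_right]
    by_cases hx : x ∈ Set.pi (s : Set ι) t
    · rw [Set.indicator_of_mem hx, Finset.prod_congr rfl fun i hi =>
        Set.indicator_of_mem (hx i hi) (1 : X i → ℝ≥0∞)]
      simp
    · rw [Set.indicator_of_notMem hx]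
      simp only [Set.mem_pi, not_forall] at hx
      obtain ⟨i, hi, hit⟩ := hx
      rw [Finset.prod_eq_zero (Finset.mem_coe.1 hi) (Set.indicator_of_notMem hit _), zero_mul]
  simp_rw [hpt]
  have hind : iIndepFun (fun (i : ι) (x : (i : ι) → X i) => w i (x i)) (Measure.infinitePi μ) :=
    iIndepFun_infinitePi (P := μ) hwm
  refine (lintegral_prod_eq_prod_lintegral_of_indepFun (s ∪ I)
    (fun i (x : (i : ι) → X i) => w i (x i)) hind
    fun i => (hwm i).comp (measurable_pi_apply i)).trans ?_
  have hfac : ∀ i, ∫⁻ x, w i (x i) ∂Measure.infinitePi μ = ρ i (if i ∈ s then t i else Set.univ) := by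
    intro i
    rw [(measurePreserving_eval_infinitePi μ i).lintegral_comp (hwm i)]
    have hin : MeasurableSet (if i ∈ s then t i else Set.univ) := by
      by_cases h : i ∈ s <;> simp [h, ht i]
    by_cases hiI : i ∈ I
    · rw [hI i hiI, withDensity_apply _ hin, ← lintegral_indicator hin]
      refine lintegral_congr fun a => ?_
      by_cases h : i ∈ s <;> by_cases ha : a ∈ t i <;> simp [hw, hiI, h, ha]
    · rw [hIc i hiI, ← lintegral_indicator_one hin]
      refine lintegral_congr fun a => ?_
      by_cases h : i ∈ s <;> by_cases ha : a ∈ t i <;> simp [hw, hiI, h, ha]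
  simp_rw [hfac]
  rw [← Finset.prod_subset (Finset.subset_union_left (s₁ := s) (s₂ := I))]
  · exact Finset.prod_congr rfl fun i hi => by simp [hi]
  · intro i _ hi
    simp [hi]

/-- Lower bound for a probability through a change of measure of the first `n` observations, on an
event where the likelihood ratio is at most `c`. -/
lemma measure_le_mul_of_tilt (μ ρ : Measure X) [IsProbabilityMeasure μ] [IsProbabilityMeasure ρ]
    {r : X → ℝ≥0∞} (hr : Measurable r) (hρ : ρ = μ.withDensity r) (n : ℕ) {E : Set (ℕ → X)}
    (hE : MeasurableSet E) (hEn : DependsOn (· ∈ E) (Set.Iio n)) {c : ℝ≥0∞}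
    (hc : ∀ x ∈ E, ∏ i ∈ Finset.range n, r (x i) ≤ c) : iid ρ E ≤ c * iid μ E := by
  have hdep := dependsOn_indicator_one hEn
  have hprob : ∀ i : ℕ, IsProbabilityMeasure (if i < n then ρ else μ) := fun i => by
    split_ifs <;> infer_instance
  have h1 := lintegral_prefix_congr n (fun _ => ρ) (fun i => if i < n then ρ else μ)
    (fun i hi => by simp [hi]) (measurable_one.indicator hE) hdep
  rw [← lintegral_indicator_one hE, h1, lintegral_indicator_one hE,
    infinitePi_withDensity (fun _ => μ) (fun i => if i < n then ρ else μ) (Finset.range n)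
      (fun _ => r) (fun _ => hr) (fun i hi => by simp [Finset.mem_range.1 hi, hρ])
      (fun i hi => if_neg fun h => hi (Finset.mem_range.2 h)), withDensity_apply _ hE]
  refine (setLIntegral_mono measurable_const hc).trans ?_
  rw [setLIntegral_const]

lemma measurable_expCusum {r : X → ℝ≥0∞} (hr : Measurable r) (t : ℕ) :
    Measurable fun x => expCusum r x t := by
  induction t with
  | zero => exact measurable_const
  | succ t ih =>
    exact (ih.mul (hr.comp (measurable_pi_apply t))).max measurable_const

/-- Under the law in the denominator of the likelihood ratio, a CUSUM statistic has an exponential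
tail, uniformly in time; statistics of independent components are jointly controlled. The induction
conditions on the last observation. -/
lemma measure_expCusum_le {κ : Type*} (μ : Measure X) [IsProbabilityMeasure μ] (A : Finset κ)
    (r : κ → X → ℝ≥0∞) (hr : ∀ k, Measurable (r k)) (hind : iIndepFun r μ)
    (hone : ∀ k ∈ A, ∫⁻ a, r k a ∂μ ≤ 1) (t : ℕ) (b : κ → ℝ≥0∞) :
    iid μ {x | ∀ k ∈ A, 1 ≤ b k * expCusum (r k) x t} ≤ ∏ k ∈ A, min 1 (b k) := by
  classical
  induction t generalizing b with
  | zero =>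
    by_cases h : ∀ k ∈ A, 1 ≤ b k
    · rw [Finset.prod_congr rfl (g := fun _ => 1) fun k hk => min_eq_left (h k hk)]
      simpa using prob_le_one
    · have : {x : ℕ → X | ∀ k ∈ A, 1 ≤ b k * expCusum (r k) x 0} = ∅ := by
        ext x; simpa [expCusum] using h
      rw [this]; simp
  | succ t ih =>
    set b' : X → κ → ℝ≥0∞ := fun a k => if 1 ≤ b k then 1 else b k * r k a with hb'
    have hb'm : ∀ k, Measurable fun a => b' a k := fun k => by
      by_cases h : 1 ≤ b k <;> simp only [hb', h, if_true, if_false]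
      · exact measurable_const
      · exact (hr k).const_mul _
    set B : Set ((ℕ → X) × X) := {p | ∀ k ∈ A, 1 ≤ b' p.2 k * expCusum (r k) p.1 t} with hB
    have hBm : MeasurableSet B := by
      have : B = ⋂ k ∈ A, {p | 1 ≤ b' p.2 k * expCusum (r k) p.1 t} := by ext p; simp [hB]
      rw [this]
      exact Finset.measurableSet_biInter _ fun k _ => measurableSet_le measurable_const
        (((hb'm k).comp measurable_snd).mul ((measurable_expCusum (hr k) t).comp measurable_fst))
    have hsub : {x : ℕ → X | ∀ k ∈ A, 1 ≤ b k * expCusum (r k) x (t + 1)} ⊆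
        {x | (x, x t) ∈ B} := by
      intro x hx k hk
      have := hx k hk
      by_cases h : 1 ≤ b k
      · simpa [hb', h] using one_le_expCusum (r k) x t
      · simp only [hb', h, if_false]
        simp only [expCusum] at this
        rcases le_total (expCusum (r k) x t * r k (x t)) 1 with h1 | h1
        · rw [max_eq_right h1, mul_one] at this
          exact absurd this h
        · rw [max_eq_left h1] at this
          rwa [mul_assoc, mul_comm (r k (x t))]
    have hmeas : MeasurableSet {x : ℕ → X | (x, x t) ∈ B} :=
      (measurable_id.prodMk (measurable_pi_apply t)) hBm
    refine (measure_mono hsub).trans ?_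
    rw [← lintegral_indicator_one hmeas]
    have hF := lintegral_prefix_prod_eval μ t (u := fun x a => B.indicator 1 (x, a))
      (measurable_one.indicator hBm) (fun a x y hxy => by
        have : ∀ k, expCusum (r k) x t = expCusum (r k) y t := fun k =>
          dependsOn_expCusum (r k) t hxy
        simp [Set.indicator_apply, hB, this])
    have hF' : ∫⁻ x, ({x : ℕ → X | (x, x t) ∈ B}).indicator (1 : (ℕ → X) → ℝ≥0∞) x ∂iid μ =
        ∫⁻ x, B.indicator 1 (x, x t) ∂iid μ := rfl
    rw [hF', hF]
    calc _ ≤ ∫⁻ a, ∏ k ∈ A, min 1 (b' a k) ∂μ := by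
          refine lintegral_mono fun a => ?_
          have hs : MeasurableSet {x : ℕ → X | (x, a) ∈ B} :=
            (measurable_id.prodMk measurable_const) hBm
          have : ∫⁻ x, B.indicator (1 : (ℕ → X) × X → ℝ≥0∞) (x, a) ∂iid μ =
              iid μ {x : ℕ → X | (x, a) ∈ B} := by
            rw [← lintegral_indicator_one hs]; rfl
          simp only
          rw [this]
          exact ih (b' a)
      _ = ∏ k ∈ A, ∫⁻ a, min 1 (b' a k) ∂μ := by
          refine lintegral_prod_eq_prod_lintegral_of_indepFun A (fun k a => min 1 (b' a k)) ?_
            fun k => measurable_const.min (hb'm k)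
          have := hind.comp (fun k (y : ℝ≥0∞) => min 1 (if 1 ≤ b k then 1 else b k * y))
            fun k => by
              by_cases h : 1 ≤ b k <;> simp only [h, if_true, if_false] <;> fun_prop
          exact this
      _ ≤ ∏ k ∈ A, min 1 (b k) := by
          refine Finset.prod_le_prod' fun k hk => ?_
          by_cases h : 1 ≤ b k
          · simp [hb', h]
          · simp only [hb', h, if_false]
            refine le_min ?_ ?_
            · refine (lintegral_mono (g := fun _ => (1 : ℝ≥0∞)) fun a => min_le_left _ _).trans
                (by simp)
            · refine (lintegral_mono (g := fun a => b k * r k a) fun a => min_le_right _ _).trans ?_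
              rw [lintegral_const_mul _ (hr k)]
              exact (mul_le_mul_right (hone k hk) _).trans (by simp)

end Tools

section

variable {Q K : ℕ}

/-! ### Likelihood ratios -/

/-- The likelihood ratio `P_q(x) / P_j(x)`. -/
def likelihoodRatio (P : Densities Q) (q j : Fin (Q + 1)) (x : ℝ) : ℝ≥0∞ :=
  (P.pdf q x : ℝ≥0∞) / (P.pdf j x : ℝ≥0∞)

lemma Densities.measurable_coe_pdf (P : Densities Q) (j : Fin (Q + 1)) :
    Measurable fun x => (P.pdf j x : ℝ≥0∞) := (P.measurable_pdf j).coe_nnreal_ennreal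

lemma measurable_likelihoodRatio (P : Densities Q) (q j : Fin (Q + 1)) :
    Measurable (likelihoodRatio P q j) :=
  (P.measurable_coe_pdf q).div (P.measurable_coe_pdf j)

lemma measurable_logRatio (P : Densities Q) (q j : Fin (Q + 1)) : Measurable (logRatio P q j) :=
  (measurable_likelihoodRatio P q j).ennreal_log

lemma exp_logRatio (P : Densities Q) (q j : Fin (Q + 1)) (x : ℝ) :
    EReal.exp (logRatio P q j x) = likelihoodRatio P q j x := ENNReal.exp_log _

lemma lintegral_likelihoodRatio_le_one (P : Densities Q) (q j : Fin (Q + 1)) :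
    ∫⁻ x, likelihoodRatio P q j x ∂P.law j ≤ 1 := by
  rw [Densities.law, lintegral_withDensity_eq_lintegral_mul _ (P.measurable_coe_pdf j)
    (measurable_likelihoodRatio P q j), ← P.lintegral_pdf q]
  exact lintegral_mono fun x => ENNReal.mul_div_le

lemma ae_pdf_ne_zero (P : Densities Q) (q : Fin (Q + 1)) : ∀ᵐ x ∂P.law q, P.pdf q x ≠ 0 := by
  rw [Densities.law, ae_withDensity_iff (P.measurable_coe_pdf q)]
  exact ae_of_all _ fun x hx => by simpa using hx

lemma law_eq_withDensity (P : Densities Q) {q j : Fin (Q + 1)} (hac : P.law q ≪ P.law j) :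
    P.law q = (P.law j).withDensity (likelihoodRatio P q j) := by
  have h1 : (P.law j).withDensity (likelihoodRatio P q j) = volume.withDensity
      ((fun x => (P.pdf j x : ℝ≥0∞)) * likelihoodRatio P q j) :=
    (withDensity_mul _ (P.measurable_coe_pdf j) (measurable_likelihoodRatio P q j)).symm
  rw [h1]
  refine withDensity_congr_ae ?_
  have h2 : ∀ᵐ x ∂P.law q, P.pdf j x ≠ 0 := hac.ae_le (ae_pdf_ne_zero P j)
  rw [Densities.law, ae_withDensity_iff (P.measurable_coe_pdf q)] at h2
  filter_upwards [h2] with x hx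
  by_cases hq : (P.pdf q x : ℝ≥0∞) = 0
  · simp [likelihoodRatio, hq]
  · have hj : (P.pdf j x : ℝ≥0∞) ≠ 0 := by simpa using hx hq
    simp only [Pi.mul_apply, likelihoodRatio]
    rw [ENNReal.mul_div_cancel hj (by simp)]

lemma ae_logRatio_eq (P : Densities Q) {q j : Fin (Q + 1)} (hac : P.law q ≪ P.law j) :
    ∀ᵐ x ∂P.law q, logRatio P q j x = ((logRatio P q j x).toReal : EReal) ∧
      (logRatio P q j x).toReal = llr (P.law q) (P.law j) x := by
  have hrn : ∀ᵐ x ∂P.law q, (P.law q).rnDeriv (P.law j) x = likelihoodRatio P q j x := by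
    refine hac.ae_le ?_
    have := Measure.rnDeriv_withDensity (P.law j) (measurable_likelihoodRatio P q j)
    rwa [← law_eq_withDensity P hac] at this
  filter_upwards [hrn, ae_pdf_ne_zero P q, hac.ae_le (ae_pdf_ne_zero P j)] with x h1 h2 h3
  have hne : likelihoodRatio P q j x ≠ 0 := by simp [likelihoodRatio, h2]
  have hnt : likelihoodRatio P q j x ≠ ⊤ := by
    simp [likelihoodRatio, ENNReal.div_eq_top, h3]
  have hlog : logRatio P q j x = ((Real.log (likelihoodRatio P q j x).toReal : ℝ) : EReal) :=
    ENNReal.log_pos_real hne hnt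
  rw [hlog, EReal.toReal_coe, llr, h1]
  exact ⟨rfl, rfl⟩

lemma absolutelyContinuous_of_I_lt_top {P : Densities Q} {q j : Fin (Q + 1)} (h : P.I q j < ⊤) :
    P.law q ≪ P.law j := (klDiv_ne_top_iff.1 h.ne).1

lemma integrable_logRatio {P : Densities Q} {q j : Fin (Q + 1)} (h : P.I q j < ⊤) :
    Integrable (fun x => (logRatio P q j x).toReal) (P.law q) := by
  have hi := (klDiv_ne_top_iff.1 h.ne).2
  refine hi.congr ?_
  filter_upwards [ae_logRatio_eq P (absolutelyContinuous_of_I_lt_top h)] with x hx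
  exact hx.2.symm

lemma integral_logRatio {P : Densities Q} {q j : Fin (Q + 1)} (h : P.I q j < ⊤) :
    ∫ x, (logRatio P q j x).toReal ∂P.law q = (P.I q j).toReal := by
  have hac := absolutelyContinuous_of_I_lt_top h
  rw [Densities.I, toReal_klDiv_of_measure_eq hac (by simp)]
  refine integral_congr_ae ?_
  filter_upwards [ae_logRatio_eq P hac] with x hx
  exact hx.2

/-! ### Log-likelihood ratio walks and CUSUM statistics -/

/-- The random walk of the log-likelihood ratios. -/
def llrSum (P : Densities Q) (q j : Fin (Q + 1)) (x : ℕ → ℝ) : ℕ → EReal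
  | 0 => 0
  | t + 1 => llrSum P q j x t + logRatio P q j (x t)

lemma exp_llrSum (P : Densities Q) (q j : Fin (Q + 1)) (x : ℕ → ℝ) (t : ℕ) :
    EReal.exp (llrSum P q j x t) = ∏ i ∈ Finset.range t, likelihoodRatio P q j (x i) := by
  induction t with
  | zero => simp [llrSum]
  | succ t ih => rw [llrSum, EReal.exp_add, ih, exp_logRatio, Finset.prod_range_succ]

lemma measurable_llrSum (P : Densities Q) (q j : Fin (Q + 1)) (t : ℕ) :
    Measurable fun x : ℕ → ℝ => llrSum P q j x t := by
  induction t with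
  | zero => exact measurable_const
  | succ t ih => exact ih.add ((measurable_logRatio P q j).comp (measurable_pi_apply t))

lemma dependsOn_llrSum (P : Densities Q) (q j : Fin (Q + 1)) (t : ℕ) :
    DependsOn (fun x : ℕ → ℝ => llrSum P q j x t) (Set.Iio t) := by
  induction t with
  | zero => exact fun _ _ _ => rfl
  | succ t ih =>
    intro x y hxy
    have h1 : llrSum P q j x t = llrSum P q j y t := ih fun i hi => hxy i (lt_trans hi t.lt_succ_self)
    simp only [llrSum, h1, hxy t (Set.mem_Iio.2 t.lt_succ_self)]

/-- As long as it is not reset, a CUSUM statistic dominates the random walk started at zero, from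
whatever state it begins. -/
lemma llrSum_le_of_cusumStep {P : Densities Q} {Y : ℕ → CusumMatrix Q} {x : ℕ → ℝ} {n : ℕ}
    {q : Fin Q} {j : Fin (Q + 1)} (h0 : 0 ≤ Y 0 q j)
    (hstep : ∀ i < n, Y (i + 1) = cusumStep P (Y i) (x i)) :
    llrSum P q.succ j x n ≤ Y n q j := by
  induction n with
  | zero => exact h0
  | succ n ih =>
    rw [hstep n n.lt_succ_self]
    exact (add_le_add_left (ih fun i hi => hstep i (by omega)) _).trans (le_max_left _ _)

/-- A sequence of CUSUM matrices driven by the observations `x`, with resets at arbitrary times. -/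
structure IsCusumPath (P : Densities Q) (x : ℕ → ℝ) (Y : ℕ → CusumMatrix Q) : Prop where
  zero : Y 0 = fun _ _ => 0
  succ : ∀ t, Y (t + 1) = cusumStep P (Y t) (x t) ∨ Y (t + 1) = cusumStep P (fun _ _ => 0) (x t)

lemma IsCusumPath.nonneg {P : Densities Q} {x : ℕ → ℝ} {Y : ℕ → CusumMatrix Q}
    (hY : IsCusumPath P x Y) (t : ℕ) (q : Fin Q) (j : Fin (Q + 1)) : 0 ≤ Y t q j := by
  cases t with
  | zero => rw [hY.zero]
  | succ t => rcases hY.succ t with h | h <;> rw [h] <;> exact le_max_right _ _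

/-- Resets only make CUSUM statistics smaller. -/
lemma IsCusumPath.exp_le_expCusum {P : Densities Q} {x : ℕ → ℝ} {Y : ℕ → CusumMatrix Q}
    (hY : IsCusumPath P x Y) (t : ℕ) (q : Fin Q) (j : Fin (Q + 1)) :
    EReal.exp (Y t q j) ≤ expCusum (likelihoodRatio P q.succ j) x t := by
  induction t with
  | zero => rw [hY.zero]; simp [expCusum]
  | succ t ih =>
    have key : ∀ Z : CusumMatrix Q, EReal.exp (Z q j) ≤ expCusum (likelihoodRatio P q.succ j) x t →
        EReal.exp (cusumStep P Z (x t) q j) ≤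
          expCusum (likelihoodRatio P q.succ j) x (t + 1) := by
      intro Z hZ
      rw [cusumStep, EReal.exp_monotone.map_max, EReal.exp_add, exp_logRatio, EReal.exp_zero,
        expCusum]
      gcongr
    rcases hY.succ t with h | h <;> rw [h]
    · exact key _ ih
    · exact key _ (by simpa using one_le_expCusum _ x t)

/-- A random walk that never falls below `-C` keeps its CUSUM statistic within distance `C`. -/
lemma IsCusumPath.le_add {P : Densities Q} {x : ℕ → ℝ} {Y : ℕ → CusumMatrix Q}
    (hY : IsCusumPath P x Y) {q : Fin Q} {j : Fin (Q + 1)} {s : ℕ → ℝ} {C : ℝ}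
    (hs : ∀ t, llrSum P q.succ j x t = s t) (hlow : ∀ t, -C ≤ s t) (t : ℕ) :
    Y t q j ≤ ((s t + C : ℝ) : EReal) := by
  induction t with
  | zero =>
    rw [hY.zero]
    exact EReal.coe_nonneg.2 (by linarith [hlow 0])
  | succ t ih =>
    have hfin : logRatio P q.succ j (x t) = ((s (t + 1) - s t : ℝ) : EReal) := by
      have h1 := hs (t + 1)
      rw [llrSum, hs t] at h1
      induction hl : logRatio P q.succ j (x t) with
      | bot => rw [hl] at h1; simp at h1
      | top => rw [hl] at h1; simp at h1
      | coe l =>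
        rw [hl, ← EReal.coe_add, EReal.coe_eq_coe_iff] at h1
        rw [← h1]; simp
    have key : ∀ Z : CusumMatrix Q, Z q j ≤ ((s t + C : ℝ) : EReal) →
        cusumStep P Z (x t) q j ≤ ((s (t + 1) + C : ℝ) : EReal) := by
      intro Z hZ
      rw [cusumStep, hfin]
      refine max_le ((add_le_add_left hZ _).trans ?_) ?_
      · rw [← EReal.coe_add]
        exact_mod_cast by linarith
      · exact_mod_cast by linarith [hlow (t + 1)]
    rcases hY.succ t with h | h <;> rw [h]
    · exact key _ ih
    · exact key _ (by exact_mod_cast by linarith [hlow t])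

lemma mem_acceptable {h : ℝ} {Y : CusumMatrix Q} {q : Fin Q} :
    q ∈ acceptable h Y ↔ ∀ j, j ≠ q.succ → (h : EReal) ≤ Y q j := by
  simp [acceptable, rowMin, le_iInf_iff]

/-- If a sensor finds `q` acceptable, then `exp (-h)` times the exponential of the unreset
statistic `Y(q, j)` is at least one. -/
lemma IsCusumPath.one_le_of_acceptable {P : Densities Q} {x : ℕ → ℝ} {Y : ℕ → CusumMatrix Q}
    (hY : IsCusumPath P x Y) {h : ℝ} {t : ℕ} {q : Fin Q} {j : Fin (Q + 1)} (hj : j ≠ q.succ)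
    (hq : q ∈ acceptable h (Y t)) :
    1 ≤ ENNReal.ofReal (Real.exp (-h)) * expCusum (likelihoodRatio P q.succ j) x t := by
  have h1 : ENNReal.ofReal (Real.exp h) ≤ expCusum (likelihoodRatio P q.succ j) x t := by
    rw [← EReal.exp_coe]
    exact (EReal.exp_monotone (mem_acceptable.1 hq j hj)).trans (hY.exp_le_expCusum t q j)
  calc (1 : ℝ≥0∞) = ENNReal.ofReal (Real.exp (-h)) * ENNReal.ofReal (Real.exp h) := by
        rw [← ENNReal.ofReal_mul (Real.exp_nonneg _), ← Real.exp_add]; simp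
    _ ≤ _ := by gcongr

/-! ### Observations of all sensors -/

/-- Law of the observations of all sensors at one time, sensor `k` having density `f k`. -/
def sensorLaw (P : Densities Q) (f : Fin K → Fin (Q + 1)) : Measure (Fin K → ℝ) :=
  Measure.pi fun k => P.law (f k)

instance (P : Densities Q) (f : Fin K → Fin (Q + 1)) : IsProbabilityMeasure (sensorLaw P f) := by
  unfold sensorLaw; infer_instance

/-- The observations of sensor `k`. -/
def sensorSeq (k : Fin K) (x : ℕ → Fin K → ℝ) : ℕ → ℝ := fun i => x i k

lemma measurable_sensorSeq (k : Fin K) : Measurable (sensorSeq k) :=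
  measurable_pi_lambda _ fun i => (measurable_pi_apply k).comp (measurable_pi_apply i)

/-- The exponential tail of the CUSUM statistics, jointly for the sensors in `A`. -/
lemma measure_accept_le (P : Densities Q) (f : Fin K → Fin (Q + 1)) (A : Finset (Fin K))
    (p q : Fin (Q + 1)) (hA : ∀ k ∈ A, f k = q) (t : ℕ) (b : ℝ≥0∞) :
    iid (sensorLaw P f)
      {x | ∀ k ∈ A, 1 ≤ b * expCusum (likelihoodRatio P p q) (sensorSeq k x) t} ≤ b ^ A.card := by
  have hr := measurable_likelihoodRatio P p q
  have h1 : ∀ (k : Fin K) (x : ℕ → Fin K → ℝ), expCusum (likelihoodRatio P p q) (sensorSeq k x) t =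
      expCusum (fun a : Fin K → ℝ => likelihoodRatio P p q (a k)) x t := by
    intro k x
    induction t with
    | zero => rfl
    | succ t ih => simp only [expCusum, ih]; rfl
  simp_rw [h1]
  refine (measure_expCusum_le (sensorLaw P f) A (fun k a => likelihoodRatio P p q (a k))
    (fun k => hr.comp (measurable_pi_apply k)) ?_ ?_ t fun _ => b).trans ?_
  · exact iIndepFun_pi (X := fun _ : Fin K => likelihoodRatio P p q) fun _ => hr.aemeasurable
  · intro k hk
    have := (measurePreserving_eval (fun k => P.law (f k)) k).lintegral_comp hr
    rw [sensorLaw]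
    refine this.le.trans ?_
    rw [hA k hk]
    exact lintegral_likelihoodRatio_le_one P p q
  · rw [Finset.prod_const]
    exact pow_le_pow_left' (min_le_right _ _) _

/-- All log-likelihood ratio walks of the density `q` at the sensors in `A` stay in cones around
their means. -/
def cone (P : Densities Q) (q : Fin (Q + 1)) (A : Finset (Fin K)) (ε C : ℝ) :
    Set (ℕ → Fin K → ℝ) :=
  {x | ∀ k ∈ A, ∀ j ≠ q, ∀ t : ℕ, ∃ s : ℝ, llrSum P q j (sensorSeq k x) t = s ∧
    |s - t * (P.I q j).toReal| ≤ ε * t + C}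

lemma exists_cone (P : Densities Q) (f : Fin K → Fin (Q + 1)) (A : Finset (Fin K))
    (q : Fin (Q + 1)) (hA : ∀ k ∈ A, f k = q) (hI : ∀ j ≠ q, P.I q j < ⊤) {ε : ℝ} (hε : 0 < ε)
    {η : ℝ≥0∞} (hη : η ≠ 0) :
    ∃ C : ℝ, 0 ≤ C ∧ iid (sensorLaw P f) (cone P q A ε C)ᶜ ≤ η := by
  classical
  -- The bound `η` is shared among all pairs of a sensor and a density.
  set n : ℝ≥0∞ := ((Finset.univ : Finset (Fin K × Fin (Q + 1))).card : ℝ≥0∞) + 1 with hn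
  have hη' : η / n ≠ 0 := ENNReal.div_ne_zero.2 ⟨hη, ENNReal.add_ne_top.2
    ⟨ENNReal.natCast_ne_top _, ENNReal.one_ne_top⟩⟩
  have hmp : ∀ k, MeasurePreserving (fun a : Fin K → ℝ => a k) (sensorLaw P f) (P.law (f k)) :=
    fun k => measurePreserving_eval (fun k => P.law (f k)) k
  have hpair : ∀ p : Fin K × Fin (Q + 1), ∃ C : ℝ, 0 ≤ C ∧ ∀ C', C ≤ C' →
      iid (sensorLaw P f) {x | ¬(p.1 ∈ A → p.2 ≠ q → ∀ t : ℕ, ∃ s : ℝ,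
        llrSum P q p.2 (sensorSeq p.1 x) t = s ∧
          |s - t * (P.I q p.2).toReal| ≤ ε * t + C')} ≤ η / n := by
    rintro ⟨k, j⟩
    by_cases hk : k ∈ A ∧ j ≠ q
    swap
    · refine ⟨0, le_rfl, fun C' _ => ?_⟩
      rw [show {x : ℕ → Fin K → ℝ | ¬(k ∈ A → j ≠ q → ∀ t : ℕ, ∃ s : ℝ,
        llrSum P q j (sensorSeq k x) t = s ∧ |s - t * (P.I q j).toReal| ≤ ε * t + C')} = ∅ from ?_]
      · simp
      · ext x
        simp only [Set.mem_ofPred_eq, Set.mem_empty_iff_false, iff_false, not_not]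
        intro h1 h2
        exact absurd ⟨h1, h2⟩ hk
    obtain ⟨hkA, hj⟩ := hk
    have hfk := hA k hkA
    have hlt := hI j hj
    have hmpk : MeasurePreserving (fun a : Fin K → ℝ => a k) (sensorLaw P f) (P.law q) :=
      hfk ▸ hmp k
    have hm : Measurable fun a : Fin K → ℝ => (logRatio P q j (a k)).toReal :=
      ((measurable_logRatio P q j).comp (measurable_pi_apply k)).ereal_toReal
    have hmean : ∫ a, (logRatio P q j (a k)).toReal ∂sensorLaw P f = (P.I q j).toReal := by
      have h1 := integral_map (μ := sensorLaw P f) hmpk.measurable.aemeasurable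
        (measurable_logRatio P q j).ereal_toReal.aestronglyMeasurable
      rw [hmpk.map_eq, integral_logRatio hlt] at h1
      exact h1.symm
    obtain ⟨C, hC0, hC⟩ := exists_linear_bound (sensorLaw P f) hm
      (hmpk.integrable_comp_of_integrable (integrable_logRatio hlt)) hε hη'
    refine ⟨C, hC0, fun C' hC' => ?_⟩
    have hfin : ∀ᵐ x ∂iid (sensorLaw P f), ∀ i : ℕ,
        logRatio P q j (x i k) = ((logRatio P q j (x i k)).toReal : EReal) := by
      refine ae_all_iff.2 fun i => ?_
      have h1 : ∀ᵐ a ∂sensorLaw P f,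
          logRatio P q j (a k) = ((logRatio P q j (a k)).toReal : EReal) :=
        hmpk.quasiMeasurePreserving.ae ((ae_logRatio_eq P
          (absolutelyContinuous_of_I_lt_top hlt)).mono fun x hx => hx.1)
      exact (measurePreserving_eval_infinitePi
        (fun _ : ℕ => sensorLaw P f) i).quasiMeasurePreserving.ae h1
    refine (measure_mono_ae ?_).trans (hC C' hC')
    filter_upwards [hfin] with x hx hbad hgood
    refine hbad fun _ _ t => ⟨∑ i ∈ Finset.range t, (logRatio P q j (x i k)).toReal, ?_, ?_⟩
    · clear hbad
      induction t with
      | zero => simp [llrSum]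
      | succ t ih =>
        rw [llrSum, ih, Finset.sum_range_succ, EReal.coe_add, ← hx t]
        rfl
    · rw [← hmean]
      exact hgood t
  choose C hC0 hC using hpair
  set D := ∑ p, C p with hD
  refine ⟨D, Finset.sum_nonneg fun p _ => hC0 p, ?_⟩
  have hsub : (cone P q A ε D)ᶜ ⊆ ⋃ p ∈ (Finset.univ : Finset (Fin K × Fin (Q + 1))),
      {x | ¬(p.1 ∈ A → p.2 ≠ q → ∀ t : ℕ, ∃ s : ℝ,
        llrSum P q p.2 (sensorSeq p.1 x) t = s ∧
          |s - t * (P.I q p.2).toReal| ≤ ε * t + D)} := by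
    intro x hx
    by_contra hno
    refine hx fun k hk j hj => ?_
    simp only [Set.mem_iUnion, not_exists, Set.mem_ofPred_eq, not_not] at hno
    exact hno (k, j) (Finset.mem_univ _) hk hj
  refine (measure_mono hsub).trans ((measure_biUnion_finset_le _ _).trans ?_)
  refine (Finset.sum_le_sum fun p hp => hC p D ?_).trans ?_
  · exact Finset.single_le_sum (f := C) (fun p _ => hC0 p) hp
  · rw [Finset.sum_const, nsmul_eq_mul]
    calc _ ≤ n * (η / n) := by gcongr; simp [hn]
      _ ≤ η := ENNReal.mul_div_le

/-! ### Alarm times -/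

lemma alarmTime_one_le {dec : ℕ → Option (Fin Q)} {t : ℕ} (ht : 1 ≤ t) (h : (dec t).isSome) :
    alarmTime dec 1 ≤ t := by
  refine iInf₂_le (f := fun (t : ℕ) (_ : alarmTime dec 0 < t ∧ (dec t).isSome) => (t : ℕ∞)) t
    ⟨?_, h⟩
  simp only [alarmTime]
  exact_mod_cast ht

lemma le_alarmTime_one {dec : ℕ → Option (Fin Q)} {n : ℕ}
    (h : ∀ t, 1 ≤ t → t < n → dec t = none) : (n : ℕ∞) ≤ alarmTime dec 1 := by
  refine le_iInf₂ fun t ht => ?_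
  by_contra hlt
  have h1 : 1 ≤ t := by
    have := ht.1
    simp only [alarmTime] at this
    exact_mod_cast this
  have h2 := ht.2
  rw [h t h1 (by exact_mod_cast not_le.1 hlt)] at h2
  simp at h2

lemma alarmTime_one_eq_top {dec : ℕ → Option (Fin Q)} (h : ∀ t, dec t = none) :
    alarmTime dec 1 = ⊤ := by
  refine ENat.eq_top_iff_forall_ge.2 fun n => le_alarmTime_one fun t _ _ => h t

/-- In the restarting version every alarm after time zero is one of the `T_ρ` with `ρ ≥ 1`. -/
lemma exists_alarmTime_eq {dec : ℕ → Option (Fin Q)} {t : ℕ} (ht : 1 ≤ t) (h : (dec t).isSome) :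
    ∃ ρ, 1 ≤ ρ ∧ alarmTime dec ρ = t := by
  classical
  induction t using Nat.strong_induction_on with
  | _ t ih =>
    by_cases hex : ∃ s, 1 ≤ s ∧ s < t ∧ (dec s).isSome
    · -- Continue from the last alarm before time `t`.
      have hne : ((Finset.range t).filter fun s => 1 ≤ s ∧ (dec s).isSome).Nonempty := by
        obtain ⟨s, h1, h2, h3⟩ := hex
        exact ⟨s, Finset.mem_filter.2 ⟨Finset.mem_range.2 h2, h1, h3⟩⟩
      obtain ⟨s, hs, hmax⟩ := Finset.exists_max_image _ id hne
      obtain ⟨hst, h1, h2⟩ := Finset.mem_filter.1 hs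
      have hst := Finset.mem_range.1 hst
      obtain ⟨ρ, hρ, hρs⟩ := ih s hst h1 h2
      refine ⟨ρ + 1, by omega, le_antisymm ?_ ?_⟩
      · refine iInf₂_le (f := fun (t : ℕ) (_ : alarmTime dec ρ < t ∧ (dec t).isSome) => (t : ℕ∞))
          t ⟨?_, h⟩
        rw [hρs]
        exact_mod_cast hst
      · refine le_iInf₂ fun u hu => ?_
        by_contra hlt
        have hut : u < t := by exact_mod_cast not_le.1 hlt
        have hsu : s < u := by
          have := hu.1
          rw [hρs] at this
          exact_mod_cast this
        have := hmax u (Finset.mem_filter.2 ⟨Finset.mem_range.2 hut, by omega, hu.2⟩)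
        simp only [id] at this
        omega
    · push Not at hex
      refine ⟨1, le_rfl, le_antisymm (alarmTime_one_le ht h) (le_alarmTime_one fun s h1 h2 => ?_)⟩
      exact Option.not_isSome_iff_eq_none.1 (hex s h1 h2)

lemma typeTime_restart_le {dec : ℕ → Option (Fin Q)} {t : ℕ} {q : Fin Q} (ht : 1 ≤ t)
    (h : dec t = some q) : typeTime Mode.restart dec q ≤ t := by
  have hs : (dec t).isSome := by rw [h]; rfl
  obtain ⟨ρ, hρ, hρt⟩ := exists_alarmTime_eq ht hs
  refine (iInf_le _ ρ).trans ((iInf_le _ t).trans (iInf_le _ ⟨hρ, (by intro hm; cases hm), hρt, h⟩))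

lemma le_typeTime {mode : Mode} {dec : ℕ → Option (Fin Q)} {n : ℕ} {q : Fin Q}
    (h : ∀ t < n, dec t ≠ some q) : (n : ℕ∞) ≤ typeTime mode dec q := by
  refine le_iInf fun ρ => le_iInf fun t => le_iInf fun ht => ?_
  by_contra hlt
  exact h t (by exact_mod_cast not_le.1 hlt) ht.2.2.2

/-! ### Decisions of the fusion center -/

lemma le_card_of_fusion_eq {sel : TieBreak Q} {d : ℕ} {s : Fin K → Finset (Fin Q)} {p : Fin Q}
    (h : fusion sel d s = some p) : d ≤ (Finset.univ.filter fun k => p ∈ s k).card := by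
  unfold fusion at h
  split_ifs at h with hne
  have h1 := sel.pick_mem _ hne
  rw [Option.some.inj h] at h1
  exact (Finset.mem_filter.1 h1).2

lemma fusion_isSome {sel : TieBreak Q} {d : ℕ} {s : Fin K → Finset (Fin Q)} {p : Fin Q}
    (h : d ≤ (Finset.univ.filter fun k => p ∈ s k).card) : (fusion sel d s).isSome := by
  have : (qualified d s).Nonempty := ⟨p, Finset.mem_filter.2 ⟨Finset.mem_univ _, h⟩⟩
  simp [fusion, this]

/-! ### Runs of the simultaneous alarm -/

/-- A run of the simultaneous alarm with observations `x` and arbitrary signals `a` of the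
compromised sensors. -/
structure IsSimRun (P : Densities Q) (sel : TieBreak Q) (d : ℕ) (h : ℝ) (B : Finset (Fin K))
    (x : ℕ → Fin K → ℝ) (a : ℕ → Fin K → Finset (Fin Q)) (st : ℕ → SimState Q K) : Prop where
  zero : st 0 = SimState.init Q K
  succ : ∀ t, st (t + 1) = (st t).step P sel d h B (x t) (a t)

section Sim

variable {P : Densities Q} {sel : TieBreak Q} {d : ℕ} {h : ℝ} {B : Finset (Fin K)}
  {x : ℕ → Fin K → ℝ} {a : ℕ → Fin K → Finset (Fin Q)} {st : ℕ → SimState Q K}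

lemma isSimRun_simState {M : ℕ} (P : Densities Q) (sel : TieBreak Q) (d : ℕ) (h : ℝ)
    (g : Attack K M (Finset (Fin Q))) (ω : Sample Q K) :
    IsSimRun P sel d h g.compromised ω.1 (fun t => g.signal (t + 1) fun i => ω.1 i)
      (simState P sel d h g ω) :=
  ⟨rfl, fun _ => rfl⟩

lemma IsSimRun.isCusumPath (hst : IsSimRun P sel d h B x a st) (k : Fin K) :
    IsCusumPath P (sensorSeq k x) fun t => (st t).Y k := by
  refine ⟨by simp only [hst.zero]; rfl, fun t => ?_⟩
  simp only [hst.succ, SimState.step, SimState.restart]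
  split_ifs
  · exact Or.inr rfl
  · exact Or.inl rfl

lemma IsSimRun.decision_zero (hst : IsSimRun P sel d h B x a st) : (st 0).decision = none := by
  rw [hst.zero]; rfl

lemma IsSimRun.le_card (hst : IsSimRun P sel d h B x a st) {t : ℕ} {p : Fin Q}
    (hp : (st (t + 1)).decision = some p) :
    d ≤ (Finset.univ.filter fun k =>
      p ∈ if k ∈ B then a t k else acceptable h ((st (t + 1)).Y k)).card := by
  rw [hst.succ] at hp ⊢
  exact le_card_of_fusion_eq hp

/-- If, over a block of observations, the walks of enough sensors climb above the threshold, then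
some alarm is raised within the block, whatever the state was before. -/
lemma IsSimRun.exists_alarm (hst : IsSimRun P sel d h B x a st) {t₀ n : ℕ} (hn : 0 < n)
    {p : Fin Q} {A : Finset (Fin K)} (hA : ∀ k ∈ A, k ∉ B → ∀ j, j ≠ p.succ →
      (h : EReal) ≤ llrSum P p.succ j (sensorSeq k (shift t₀ x)) n)
    (hB : ∀ k ∈ A, k ∈ B → ∀ t, p ∈ a t k) (hd : d ≤ A.card) :
    ∃ t, t₀ < t ∧ t ≤ t₀ + n ∧ (st t).decision.isSome := by
  by_contra hno
  push Not at hno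
  obtain ⟨m, rfl⟩ : ∃ m, n = m + 1 := ⟨n - 1, by omega⟩
  refine hno (t₀ + m + 1) (by omega) (by omega) ?_
  rw [hst.succ]
  refine fusion_isSome (p := p) (hd.trans (Finset.card_le_card fun k hk => ?_))
  refine Finset.mem_filter.2 ⟨Finset.mem_univ _, ?_⟩
  by_cases hkB : k ∈ B
  · simpa [hkB] using hB k hk hkB _
  · simp only [hkB, if_false]
    refine mem_acceptable.2 fun j hj => (hA k hk hkB j hj).trans ?_
    have := llrSum_le_of_cusumStep (P := P) (q := p) (j := j) (n := m + 1)
      (x := sensorSeq k (shift t₀ x))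
      (Y := fun i => if i = 0 then (st t₀).restart.Y k else (st (t₀ + i)).Y k) ?_ ?_
    · simp only [Nat.succ_ne_zero, if_false] at this
      rw [← add_assoc, hst.succ] at this
      exact this
    · simp only [if_true, SimState.restart]
      split_ifs
      · exact le_rfl
      · exact (hst.isCusumPath k).nonneg t₀ p j
    · intro i hi
      simp only [Nat.succ_ne_zero, if_false]
      rw [← add_assoc, hst.succ]
      rcases Nat.eq_zero_or_pos i with rfl | hipos
      · rfl
      · have hnone := hno (t₀ + i) (by omega) (by omega)
        simp only [SimState.step, SimState.restart, hnone, hipos.ne', if_false]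
        rfl

end Sim

/-! ### Runs of the multi-shot alarm -/

/-- A run of the multi-shot alarm with observations `x`, tie-breaking numbers `u` and arbitrary
signals `a` of the compromised sensors. -/
structure IsMultiRun (P : Densities Q) (sel : TieBreak Q) (d : ℕ) (h : ℝ) (B : Finset (Fin K))
    (x : ℕ → Fin K → ℝ) (u : ℕ → Fin K → Fin Q → ℝ) (a : ℕ → Fin K → Option (Fin Q))
    (st : ℕ → MultiState Q K) : Prop where
  zero : st 0 = MultiState.init Q K
  succ : ∀ t, st (t + 1) = (st t).step P sel d h B (x t) (u t) (a t)

lemma mem_reportOrder {Y : CusumMatrix Q} {u : Fin Q → ℝ} {S : Finset (Fin Q)} {p : Fin Q} :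
    p ∈ reportOrder Y u S ↔ p ∈ S := by
  simp [reportOrder, List.mem_insertionSort]

lemma nodup_reportOrder (Y : CusumMatrix Q) (u : Fin Q → ℝ) (S : Finset (Fin Q)) :
    (reportOrder Y u S).Nodup := by
  unfold reportOrder
  exact (List.perm_insertionSort _ _).nodup_iff.2 ((List.nodup_finRange Q).filter _)

section Multi

variable {P : Densities Q} {sel : TieBreak Q} {d : ℕ} {h : ℝ} {B : Finset (Fin K)}
  {x : ℕ → Fin K → ℝ} {u : ℕ → Fin K → Fin Q → ℝ} {a : ℕ → Fin K → Option (Fin Q)}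
  {st : ℕ → MultiState Q K}

lemma isMultiRun_multiState {M : ℕ} (P : Densities Q) (sel : TieBreak Q) (d : ℕ) (h : ℝ)
    (g : Attack K M (Option (Fin Q))) (ω : Sample Q K) :
    IsMultiRun P sel d h g.compromised ω.1 ω.2 (fun t => g.signal (t + 1) fun i => ω.1 i)
      (multiState P sel d h g ω) :=
  ⟨rfl, fun _ => rfl⟩

lemma IsMultiRun.decision_zero (hst : IsMultiRun P sel d h B x u a st) :
    (st 0).decision = none := by
  rw [hst.zero]; rfl

lemma IsMultiRun.isCusumPath (hst : IsMultiRun P sel d h B x u a st) (k : Fin K) :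
    IsCusumPath P (sensorSeq k x) fun t => ((st t).sensor k).Y := by
  refine ⟨by simp only [hst.zero]; rfl, fun t => ?_⟩
  simp only [hst.succ, MultiState.step, MultiState.restart]
  split_ifs
  · exact Or.inr rfl
  · exact Or.inl rfl

lemma IsMultiRun.le_card (hst : IsMultiRun P sel d h B x u a st) {t : ℕ} {p : Fin Q}
    (hp : (st (t + 1)).decision = some p) :
    d ≤ (Finset.univ.filter fun k => p ∈ (st (t + 1)).votes k).card := by
  rw [hst.succ] at hp ⊢
  exact le_card_of_fusion_eq hp

/-- An honest sensor reports only hypotheses that were acceptable there at some time. -/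
lemma IsMultiRun.exists_acceptable (hst : IsMultiRun P sel d h B x u a st) {k : Fin K}
    (hk : k ∉ B) {p : Fin Q} (t : ℕ) (hp : p ∈ ((st t).sensor k).queue ∨ p ∈ (st t).votes k) :
    ∃ s ≤ t, 1 ≤ s ∧ p ∈ acceptable h ((st s).sensor k).Y := by
  induction t with
  | zero =>
    rw [hst.zero] at hp
    simp [MultiState.init, SensorState.init] at hp
  | succ t ih =>
    have hprev : p ∈ ((st t).restart.sensor k).queue ∨ p ∈ (st t).restart.votes k →
        ∃ s ≤ t + 1, 1 ≤ s ∧ p ∈ acceptable h ((st s).sensor k).Y := by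
      unfold MultiState.restart
      split_ifs
      · simp [MultiState.init, SensorState.init]
      · intro hp
        obtain ⟨s, hs, h1, h2⟩ := ih hp
        exact ⟨s, by omega, h1, h2⟩
    have hqueue : p ∈ (((st t).restart.sensor k).enqueue P h (x t k) (u t k)).queue →
        ∃ s ≤ t + 1, 1 ≤ s ∧ p ∈ acceptable h ((st s).sensor k).Y := by
      intro hq
      rcases List.mem_append.1 hq with hq | hq
      · exact hprev (Or.inl hq)
      · refine ⟨t + 1, le_rfl, by omega, ?_⟩
        rw [hst.succ]
        exact (Finset.mem_sdiff.1 (mem_reportOrder.1 hq)).1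
    rw [hst.succ] at hp
    rcases hp with hp | hp
    · exact hqueue (List.mem_of_mem_tail hp)
    · rcases Finset.mem_union.1 hp with hp | hp
      · exact hprev (Or.inr hp)
      · simp only [hk, if_false, SensorState.report, Option.mem_toFinset, Option.mem_def] at hp
        exact hqueue (List.mem_of_head? hp)

/-- At an honest sensor, the queue lists each hypothesis once, and what has been found acceptable
is queued or reported. -/
lemma IsMultiRun.queue_invariant (hst : IsMultiRun P sel d h B x u a st) {k : Fin K}
    (hk : k ∉ B) (t : ℕ) : ((st t).sensor k).queue.Nodup ∧
      (∀ p ∈ ((st t).sensor k).queue, p ∈ ((st t).sensor k).seen) ∧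
      ∀ p ∈ ((st t).sensor k).seen, p ∈ ((st t).sensor k).queue ∨ p ∈ (st t).votes k := by
  induction t with
  | zero => rw [hst.zero]; simp [MultiState.init, SensorState.init]
  | succ t ih =>
    have ih' : ((st t).restart.sensor k).queue.Nodup ∧
        (∀ p ∈ ((st t).restart.sensor k).queue, p ∈ ((st t).restart.sensor k).seen) ∧
        ∀ p ∈ ((st t).restart.sensor k).seen,
          p ∈ ((st t).restart.sensor k).queue ∨ p ∈ (st t).restart.votes k := by
      unfold MultiState.restart
      split_ifs
      · simp [MultiState.init, SensorState.init]
      · exact ih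
    rw [hst.succ]
    simp only [MultiState.step, SensorState.dequeue, SensorState.enqueue, SensorState.report, hk,
      if_false]
    set s := (st t).restart.sensor k
    set S := acceptable h (cusumStep P s.Y (x t k))
    obtain ⟨h1, h2, h3⟩ := ih'
    refine ⟨?_, fun p hp => ?_, fun p hp => ?_⟩
    · refine List.Nodup.sublist (List.tail_sublist _) (List.Nodup.append h1
        (nodup_reportOrder _ _ _) fun p hp hp' => ?_)
      exact (Finset.mem_sdiff.1 (mem_reportOrder.1 hp')).2 (h2 p hp)
    · rcases List.mem_append.1 (List.mem_of_mem_tail hp) with hp | hp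
      · exact Finset.mem_union_left _ (h2 p hp)
      · exact Finset.mem_union_right _ (Finset.mem_sdiff.1 (mem_reportOrder.1 hp)).1
    · have hor : p ∈ s.queue ++ reportOrder (cusumStep P s.Y (x t k)) (u t k) (S \ s.seen) ∨
          p ∈ (st t).restart.votes k := by
        by_cases hps : p ∈ s.seen
        · rcases h3 p hps with h | h
          · exact Or.inl (List.mem_append_left _ h)
          · exact Or.inr h
        · refine Or.inl (List.mem_append_right _ (mem_reportOrder.2 (Finset.mem_sdiff.2 ⟨?_, hps⟩)))
          exact (Finset.mem_union.1 hp).resolve_left hps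
      rcases hor with hq | hv
      · generalize s.queue ++ reportOrder (cusumStep P s.Y (x t k)) (u t k) (S \ s.seen) = l at hq ⊢
        cases l with
        | nil => simp at hq
        | cons c l =>
          rcases List.mem_cons.1 hq with rfl | hq
          · exact Or.inr (Finset.mem_union_right _ (by simp))
          · exact Or.inl hq
      · exact Or.inr (Finset.mem_union_left _ hv)

/-- A hypothesis moves up in the queue by one place per time step. -/
lemma IsMultiRun.mem_votes_or_take (hst : IsMultiRun P sel d h B x u a st) {k : Fin K}
    (hk : k ∉ B) {p : Fin Q} {t m : ℕ} (ht : (st t).decision.isSome = false)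
    (hp : p ∈ (st t).votes k ∨ p ∈ ((st t).sensor k).queue.take (m + 1)) :
    p ∈ (st (t + 1)).votes k ∨ p ∈ ((st (t + 1)).sensor k).queue.take m := by
  have hr : (st t).restart = st t := by simp [MultiState.restart, ht]
  rw [hst.succ]
  simp only [MultiState.step, SensorState.dequeue, SensorState.enqueue, SensorState.report, hk,
    if_false, hr]
  rcases hp with hp | hp
  · exact Or.inl (Finset.mem_union_left _ hp)
  · cases hq : ((st t).sensor k).queue with
    | nil => simp [hq] at hp
    | cons c l =>
      rw [hq, List.take_succ_cons] at hp
      rcases List.mem_cons.1 hp with rfl | hp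
      · exact Or.inl (Finset.mem_union_right _ (by simp))
      · refine Or.inr ?_
        simp only [List.cons_append, List.tail_cons, List.take_append]
        exact List.mem_append_left _ hp

/-- If, over `n` observations, the walks of enough honest sensors climb above the threshold, then
some alarm is raised at most `Q` steps later, when all queues have been worked off. -/
lemma IsMultiRun.exists_alarm (hst : IsMultiRun P sel d h B x u a st) {t₀ n : ℕ} (hn : 0 < n)
    {p : Fin Q} {A : Finset (Fin K)} (hA : ∀ k ∈ A, k ∉ B ∧ ∀ j, j ≠ p.succ →
      (h : EReal) ≤ llrSum P p.succ j (sensorSeq k (shift t₀ x)) n)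
    (hd : d ≤ A.card) :
    ∃ t, t₀ < t ∧ t ≤ t₀ + (n + Q) ∧ (st t).decision.isSome := by
  by_contra hno
  push Not at hno
  have hseen : ∀ k ∈ A, p ∈ ((st (t₀ + n)).sensor k).seen := by
    intro k hk
    obtain ⟨m, rfl⟩ : ∃ m, n = m + 1 := ⟨n - 1, by omega⟩
    have hacc : p ∈ acceptable h ((st (t₀ + m + 1)).sensor k).Y := by
      refine mem_acceptable.2 fun j hj => ((hA k hk).2 j hj).trans ?_
      have := llrSum_le_of_cusumStep (P := P) (q := p) (j := j) (n := m + 1)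
        (x := sensorSeq k (shift t₀ x))
        (Y := fun i => if i = 0 then ((st t₀).restart.sensor k).Y
          else ((st (t₀ + i)).sensor k).Y) ?_ ?_
      · simpa [add_assoc] using this
      · simp only [if_true, MultiState.restart]
        split_ifs
        · exact le_rfl
        · exact (hst.isCusumPath k).nonneg t₀ p j
      · intro i hi
        simp only [Nat.succ_ne_zero, if_false]
        rw [← add_assoc, hst.succ]
        rcases Nat.eq_zero_or_pos i with rfl | hipos
        · rfl
        · have hnone := hno (t₀ + i) (by omega) (by omega)
          simp only [MultiState.step, MultiState.restart, hnone, hipos.ne', if_false]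
          rfl
    rw [← add_assoc, hst.succ] at *
    exact Finset.mem_union_right _ hacc
  have hvotes : ∀ k ∈ A, ∀ i ≤ Q, p ∈ (st (t₀ + n + i)).votes k ∨
      p ∈ ((st (t₀ + n + i)).sensor k).queue.take (Q - i) := by
    intro k hk i
    induction i with
    | zero =>
      intro _
      obtain ⟨h1, -, h3⟩ := hst.queue_invariant (hA k hk).1 (t₀ + n)
      rcases h3 p (hseen k hk) with h | h
      · right
        have hlen : ((st (t₀ + n)).sensor k).queue.length ≤ Q := by
          simpa using h1.length_le_card
        simpa [List.take_of_length_le hlen] using h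
      · exact Or.inl h
    | succ i ih =>
      intro hi
      have hnone := hno (t₀ + n + i) (by omega) (by omega)
      have := ih (by omega)
      rw [show Q - i = Q - (i + 1) + 1 by omega] at this
      exact hst.mem_votes_or_take (hA k hk).1 (by simpa using hnone) this
  refine hno (t₀ + n + Q) (by omega) (by omega) ?_
  have hle : d ≤ (Finset.univ.filter fun k => p ∈ (st (t₀ + n + Q)).votes k).card := by
    refine hd.trans (Finset.card_le_card fun k hk => Finset.mem_filter.2 ⟨Finset.mem_univ _, ?_⟩)
    simpa using hvotes k hk Q le_rfl
  obtain ⟨m, hm⟩ : ∃ m, t₀ + n + Q = m + 1 := ⟨t₀ + n + Q - 1, by omega⟩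
  rw [hm, hst.succ] at hle ⊢
  exact fusion_isSome hle

end Multi

end

section

variable {Q K M : ℕ}

/-! ### Bounds for the performance metrics -/

instance isProbabilityMeasure_obsLaw (P : Densities Q) (q : Fin (Q + 1)) (ν : ℕ) :
    IsProbabilityMeasure (obsLaw K P q ν) := by
  unfold obsLaw; infer_instance

instance isProbabilityMeasure_coinLaw : IsProbabilityMeasure (coinLaw Q K) := by
  unfold coinLaw; infer_instance

instance isProbabilityMeasure_sampleLaw (P : Densities Q) (q : Fin (Q + 1)) (ν : ℕ) :
    IsProbabilityMeasure (sampleLaw K P q ν) := by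
  unfold sampleLaw; infer_instance

lemma obsLaw_zero (P : Densities Q) (q : Fin (Q + 1)) :
    obsLaw K P q 0 = iid (sensorLaw P fun _ : Fin K => q) := by
  simp only [obsLaw, Nat.not_lt_zero, if_false]; rfl

lemma measurePreserving_fst_sampleLaw (P : Densities Q) (q : Fin (Q + 1)) (ν : ℕ) :
    MeasurePreserving Prod.fst (sampleLaw K P q ν) (obsLaw K P q ν) :=
  measurePreserving_fst

lemma past_le (Q K ν : ℕ) : past Q K ν ≤ (inferInstance : MeasurableSpace (Sample Q K)) := by
  rw [past, ← measurable_iff_comap_le]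
  exact measurable_pi_lambda _ fun i => (measurable_pi_apply (i : ℕ)).comp measurable_fst

/-- A bound on the conditional mean given the past by a function of the future observations. -/
lemma essSup_condLExp_le (P : Densities Q) (q : Fin (Q + 1)) (ν : ℕ) {D : Sample Q K → ℝ≥0∞}
    {F : (ℕ → Fin K → ℝ) → ℝ≥0∞} (hF : Measurable F) (hD : ∀ ω, D ω ≤ F (shift ν ω.1)) :
    essSup (condLExp (past Q K ν) (sampleLaw K P q ν) D) (sampleLaw K P q ν) ≤
      ∫⁻ x, F x ∂iid (sensorLaw P fun _ : Fin K => q) := by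
  set c := ∫⁻ x, F x ∂iid (sensorLaw P fun _ : Fin K => q) with hc
  have hm := past_le Q K ν
  have h1 : condLExp (past Q K ν) (sampleLaw K P q ν) D ≤ᵐ[sampleLaw K P q ν]
      condLExp (past Q K ν) (sampleLaw K P q ν) fun ω => F (shift ν ω.1) :=
    condLExp_mono (ae_of_all _ hD)
  have h2 : (fun _ => c) =ᵐ[sampleLaw K P q ν]
      condLExp (past Q K ν) (sampleLaw K P q ν) fun ω => F (shift ν ω.1) := by
    refine ae_eq_condLExp hm _ _ measurable_const fun s hs => ?_
    obtain ⟨s', hs', rfl⟩ := hs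
    set s'' : Set (ℕ → Fin K → ℝ) := (fun x (i : Fin ν) => x i) ⁻¹' s' with hs''
    have hs''m : MeasurableSet s'' :=
      (measurable_pi_lambda _ fun i : Fin ν => measurable_pi_apply (i : ℕ)) hs'
    have hmp := measurePreserving_fst_sampleLaw (K := K) P q ν
    have hset : (fun (ω : Sample Q K) (i : Fin ν) => ω.1 i) ⁻¹' s' = Prod.fst ⁻¹' s'' := rfl
    have hdep : DependsOn (· ∈ s'') (Set.Iio ν) := fun x y hxy => by
      have : (fun i : Fin ν => x i) = fun i : Fin ν => y i := funext fun i => hxy i i.2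
      simp only [hs'', Set.mem_preimage, this]
    rw [hset, setLIntegral_const, hmp.measure_preimage hs''m.nullMeasurableSet,
      ← lintegral_indicator (hmp.measurable hs''m)]
    have h3 : ∀ ω : Sample Q K, (Prod.fst ⁻¹' s'').indicator (fun ω => F (shift ν ω.1)) ω =
        s''.indicator 1 ω.1 * F (shift ν ω.1) := fun ω => by
      by_cases h : ω.1 ∈ s'' <;> simp [h]
    simp_rw [h3]
    rw [hmp.lintegral_comp (f := fun x => s''.indicator 1 x * F (shift ν x))
      ((measurable_one.indicator hs''m).mul (hF.comp (measurable_shift ν))), obsLaw,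
      lintegral_prefix_mul_shift ν _ (measurable_one.indicator hs''m) hF
        (dependsOn_indicator_one hdep), lintegral_indicator_one hs''m, mul_comm]
    simp only [Nat.not_lt.2 (Nat.le_add_right ν _), if_false]
    rfl
  refine essSup_le_of_ae_le c ?_
  filter_upwards [h1, h2] with ω ha hb
  rw [← hb] at ha
  exact ha

/-- If an alarm is raised within every block of `l` observations in `G`, whatever happened before,
then the conditional mean delay is at most `l / P(G)`. -/
lemma essSup_delayAfter_le (P : Densities Q) (q : Fin (Q + 1)) (ν : ℕ) {l : ℕ} (hl : 0 < l)
    {G : Set (ℕ → Fin K → ℝ)} (hG : MeasurableSet G) (hGl : DependsOn (· ∈ G) (Set.Iio l))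
    (dec : Sample Q K → ℕ → Option (Fin Q))
    (hdec : ∀ ω t₀, shift t₀ ω.1 ∈ G → ∃ t, t₀ < t ∧ t ≤ t₀ + l ∧ (dec ω t).isSome) :
    essSup (condLExp (past Q K ν) (sampleLaw K P q ν) fun ω => delayAfter (dec ω) ν)
      (sampleLaw K P q ν) ≤ l / iid (sensorLaw P fun _ : Fin K => q) G := by
  refine (essSup_condLExp_le P q ν (measurable_blockTime hG) fun ω => ?_).trans
    (lintegral_blockTime _ hG hGl).le
  refine le_blockTime hl fun m hm => ?_
  rw [shift_shift] at hm
  obtain ⟨t, h1, h2, h3⟩ := hdec ω _ hm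
  have h4 : ((alarmTime (dec ω) 1 : ℕ∞) : ℝ≥0∞) ≤ ((t : ℕ) : ℝ≥0∞) := by
    exact_mod_cast alarmTime_one_le (by omega) h3
  unfold delayAfter
  refine tsub_le_iff_right.2 (h4.trans ?_)
  rw [← Nat.cast_add]
  exact_mod_cast by rw [Nat.succ_mul]; omega

/-- All random walks for `q` at the sensors in `A` are above `h` at time `n`. -/
def climb (P : Densities Q) (q : Fin Q) (A : Finset (Fin K)) (h : ℝ) (n : ℕ) :
    Set (ℕ → Fin K → ℝ) :=
  {x | ∀ k ∈ A, ∀ j, j ≠ q.succ → (h : EReal) ≤ llrSum P q.succ j (sensorSeq k x) n}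

lemma measurableSet_climb (P : Densities Q) (q : Fin Q) (A : Finset (Fin K)) (h : ℝ) (n : ℕ) :
    MeasurableSet (climb P q A h n) := by
  have : climb P q A h n = ⋂ k ∈ A, ⋂ j ∈ {j | j ≠ q.succ},
      {x | (h : EReal) ≤ llrSum P q.succ j (sensorSeq k x) n} := by
    ext x; simp [climb]
  rw [this]
  exact Finset.measurableSet_biInter _ fun k _ => MeasurableSet.biInter (Set.to_countable _)
    fun j _ => measurableSet_le measurable_const
      ((measurable_llrSum P q.succ j n).comp (measurable_sensorSeq k))

lemma dependsOn_climb (P : Densities Q) (q : Fin Q) (A : Finset (Fin K)) (h : ℝ) (n : ℕ) :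
    DependsOn (· ∈ climb P q A h n) (Set.Iio n) := fun x y hxy => by
  have h1 : ∀ k j, llrSum P q.succ j (sensorSeq k x) n = llrSum P q.succ j (sensorSeq k y) n :=
    fun k j => dependsOn_llrSum P q.succ j n fun i hi => congrFun (hxy i hi) k
  simp only [climb, Set.mem_ofPred_eq, h1]

lemma Densities.Imin_le (P : Densities Q) {q : Fin Q} {j : Fin (Q + 1)} (hj : j ≠ q.succ) :
    P.Imin q ≤ P.I q.succ j :=
  iInf_le (fun j : {j : Fin (Q + 1) // j ≠ q.succ} => P.I q.succ j) ⟨j, hj⟩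

lemma Densities.Regular.Imin_lt_top {P : Densities Q} (hP : P.Regular) (q : Fin Q) :
    P.Imin q < ⊤ :=
  (P.Imin_le (Fin.succ_ne_zero q).symm).trans_lt (hP.I_lt_top q 0 (Fin.succ_ne_zero q).symm)

lemma Densities.Regular.Imin_toReal_le {P : Densities Q} (hP : P.Regular) {q : Fin Q}
    {j : Fin (Q + 1)} (hj : j ≠ q.succ) : (P.Imin q).toReal ≤ (P.I q.succ j).toReal :=
  ENNReal.toReal_mono (hP.I_lt_top q j hj).ne (P.Imin_le hj)

lemma Densities.Regular.exists_Imin {P : Densities Q} (hP : P.Regular) (q : Fin Q) :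
    ∃ j, j ≠ q.succ ∧ P.I q.succ j = P.Imin q :=
  (hP.unique_min q).exists

lemma Densities.Regular.Imin_toReal_pos {P : Densities Q} (hP : P.Regular) (q : Fin Q) :
    0 < (P.Imin q).toReal := by
  obtain ⟨j, hj, h⟩ := hP.exists_Imin q
  exact ENNReal.toReal_pos (h ▸ (hP.I_pos q j hj).ne') (hP.Imin_lt_top q).ne

lemma Densities.exists_Istar (P : Densities Q) (hQ : 0 < Q) : ∃ q, P.Imin q = P.Istar := by
  have : Nonempty (Fin Q) := ⟨⟨0, hQ⟩⟩
  exact exists_eq_ciInf_of_finite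

/-- Inside the cones, the random walks climb above a level within the expected time. -/
lemma cone_subset_climb {P : Densities Q} (hP : P.Regular) (q : Fin Q) (A : Finset (Fin K))
    {ε C h : ℝ} {n : ℕ} (hn : h + C ≤ n * ((P.Imin q).toReal - ε)) :
    cone P q.succ A ε C ⊆ climb P q A h n := by
  intro x hx k hk j hj
  obtain ⟨s, hs, hb⟩ := hx k hk j hj n
  rw [hs]
  have h1 := (abs_le.1 hb).1
  have h2 : (n : ℝ) * (P.Imin q).toReal ≤ n * (P.I q.succ j).toReal :=
    mul_le_mul_of_nonneg_left (hP.Imin_toReal_le hj) n.cast_nonneg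
  exact_mod_cast by linarith

/-! ### False alarms are rare -/

/-- Before time `n`, some `m` sensors simultaneously have a large statistic for `p` against `q`. -/
def jointExcess (K : ℕ) (P : Densities Q) (p q : Fin (Q + 1)) (b : ℝ≥0∞) (m n : ℕ) :
    Set (ℕ → Fin K → ℝ) :=
  {x | ∃ t < n, ∃ A : Finset (Fin K), A.card = m ∧
    ∀ k ∈ A, 1 ≤ b * expCusum (likelihoodRatio P p q) (sensorSeq k x) t}

lemma measure_jointExcess_le (P : Densities Q) (p q : Fin (Q + 1)) (b : ℝ≥0∞) (m n : ℕ) :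
    iid (sensorLaw P fun _ : Fin K => q) (jointExcess K P p q b m n) ≤ n * 2 ^ K * b ^ m := by
  classical
  have hsub : jointExcess K P p q b m n ⊆ ⋃ t ∈ Finset.range n,
      ⋃ A ∈ (Finset.univ : Finset (Fin K)).powersetCard m,
        {x | ∀ k ∈ A, 1 ≤ b * expCusum (likelihoodRatio P p q) (sensorSeq k x) t} := by
    rintro x ⟨t, ht, A, hA, h⟩
    simp only [Set.mem_iUnion]
    exact ⟨t, Finset.mem_range.2 ht, A,
      Finset.mem_powersetCard.2 ⟨Finset.subset_univ _, hA⟩, h⟩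
  refine (measure_mono hsub).trans ((measure_biUnion_finset_le _ _).trans ?_)
  have hterm : ∀ t ∈ Finset.range n, iid (sensorLaw P fun _ : Fin K => q)
      (⋃ A ∈ (Finset.univ : Finset (Fin K)).powersetCard m,
        {x | ∀ k ∈ A, 1 ≤ b * expCusum (likelihoodRatio P p q) (sensorSeq k x) t}) ≤
      2 ^ K * b ^ m := by
    intro t _
    refine (measure_biUnion_finset_le _ _).trans ((Finset.sum_le_sum (g := fun _ => b ^ m)
      fun A hA => ?_).trans ?_)
    · refine (measure_accept_le P (fun _ => q) A p q (fun _ _ => rfl) t b).trans ?_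
      rw [(Finset.mem_powersetCard.1 hA).2]
    · rw [Finset.sum_const, nsmul_eq_mul, Finset.card_powersetCard, Finset.card_univ,
        Fintype.card_fin]
      gcongr
      exact_mod_cast Nat.choose_le_two_pow K m
  refine (Finset.sum_le_sum hterm).trans ?_
  rw [Finset.sum_const, nsmul_eq_mul, Finset.card_range, mul_assoc]

/-- If every false alarm requires `m` sensors with statistics above `h`, then false alarms occur
only after times of order `exp (m * h)`. -/
lemma half_le_falseTime {A : Type} (P : Densities Q) (mode : Mode) (T : Rule Q K M A) (h : ℝ)
    (m n : ℕ) (hT : ∀ (g : Attack K M A) (ω : Sample Q K) (t : ℕ) (p : Fin Q), T g ω t = some p →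
      ∀ q, q ≠ p.succ → ∃ s ≤ t, ∃ S : Finset (Fin K), S.card = m ∧ ∀ k ∈ S,
        1 ≤ ENNReal.ofReal (Real.exp (-h)) *
          expCusum (likelihoodRatio P p.succ q) (sensorSeq k ω.1) s)
    (hn : (n : ℝ≥0∞) * 2 ^ K * ENNReal.ofReal (Real.exp (-h)) ^ m ≤ 1 / 2) :
    (n : ℝ≥0∞) / 2 ≤ falseTime P mode T := by
  refine le_iInf fun q => le_iInf fun g => le_iInf fun p => le_iInf fun hp => ?_
  set V := toMeasurable (iid (sensorLaw P fun _ : Fin K => q))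
    (jointExcess K P p.succ q (ENNReal.ofReal (Real.exp (-h))) m n)
  have hV : MeasurableSet V := measurableSet_toMeasurable _ _
  have hmp := measurePreserving_fst_sampleLaw (K := K) P q 0
  have hVle : sampleLaw K P q 0 (Prod.fst ⁻¹' V) ≤ 1 / 2 := by
    rw [hmp.measure_preimage hV.nullMeasurableSet, obsLaw_zero, measure_toMeasurable]
    exact (measure_jointExcess_le P p.succ q _ m n).trans hn
  calc (n : ℝ≥0∞) / 2 = n * (1 - 1 / 2) := by
        rw [one_div, ENNReal.one_sub_inv_two, div_eq_mul_inv]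
    _ ≤ n * sampleLaw K P q 0 (Prod.fst ⁻¹' V)ᶜ := by
        rw [prob_compl_eq_one_sub (hmp.measurable hV)]
        gcongr
    _ = ∫⁻ ω, (Prod.fst ⁻¹' V)ᶜ.indicator (fun _ => (n : ℝ≥0∞)) ω ∂sampleLaw K P q 0 :=
        (lintegral_indicator_const (hmp.measurable hV).compl _).symm
    _ ≤ _ := by
        refine lintegral_mono fun ω => ?_
        by_cases hω : ω.1 ∈ V
        · simp [hω]
        · rw [Set.indicator_of_mem (show ω ∈ (Prod.fst ⁻¹' V)ᶜ from hω)]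
          have : (n : ℕ∞) ≤ typeTime mode (T g ω) p := le_typeTime fun t ht heq => by
            obtain ⟨s, hs, S, hS, hk⟩ := hT g ω t p heq q (Ne.symm hp)
            exact hω (subset_toMeasurable _ _ ⟨s, by omega, S, hS, hk⟩)
          simpa using ENat.toENNReal_le.2 this

/-- Thresholds for which the mean time to a false alarm is at least `γ`. -/
lemma le_falseTime {A : Type} (P : Densities Q) (mode : Mode) (T : Rule Q K M A) (γ : ℝ)
    {m : ℕ} (hm : 0 < m) (hT : ∀ (g : Attack K M A) (ω : Sample Q K) (t : ℕ) (p : Fin Q),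
      T g ω t = some p → ∀ q, q ≠ p.succ → ∃ s ≤ t, ∃ S : Finset (Fin K), S.card = m ∧ ∀ k ∈ S,
        1 ≤ ENNReal.ofReal (Real.exp (-((Real.log (max γ 1) + Real.log (6 * 2 ^ K)) / m))) *
          expCusum (likelihoodRatio P p.succ q) (sensorSeq k ω.1) s) :
    ENNReal.ofReal γ ≤ falseTime P mode T := by
  set Γ := max γ 1 with hΓ
  have hΓ1 : 1 ≤ Γ := le_max_right _ _
  set n := ⌈2 * Γ⌉₊
  have hn1 : 2 * Γ ≤ n := Nat.le_ceil _
  have hn2 : (n : ℝ) ≤ 3 * Γ := by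
    have := (Nat.ceil_lt_add_one (a := 2 * Γ) (by linarith)).le
    linarith
  refine le_trans ?_ (half_le_falseTime P mode T _ m n hT ?_)
  · rw [← ENNReal.ofReal_natCast, ← ENNReal.ofReal_ofNat, ← ENNReal.ofReal_div_of_pos two_pos]
    refine ENNReal.ofReal_le_ofReal ?_
    have : γ ≤ Γ := le_max_left _ _
    linarith
  · have hexp : Real.exp (-((Real.log Γ + Real.log (6 * 2 ^ K)) / m)) ^ m =
        (Γ * (6 * 2 ^ K))⁻¹ := by
      rw [← Real.exp_nat_mul, mul_neg, mul_div_cancel₀ _ (by positivity), Real.exp_neg,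
        Real.exp_add, Real.exp_log (by linarith), Real.exp_log (by positivity)]
    rw [← ENNReal.ofReal_pow (Real.exp_nonneg _), hexp, ← ENNReal.ofReal_natCast,
      show (2 : ℝ≥0∞) ^ K = ENNReal.ofReal (2 ^ K) by
        rw [ENNReal.ofReal_pow two_pos.le, ENNReal.ofReal_ofNat],
      ← ENNReal.ofReal_mul (by positivity), ← ENNReal.ofReal_mul (by positivity),
      show (1 / 2 : ℝ≥0∞) = ENNReal.ofReal (1 / 2) by
        rw [ENNReal.ofReal_div_of_pos two_pos, ENNReal.ofReal_one, ENNReal.ofReal_ofNat]]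
    refine ENNReal.ofReal_le_ofReal ?_
    rw [← div_eq_mul_inv, div_le_iff₀ (by positivity)]
    have : (0 : ℝ) < 2 ^ K := by positivity
    nlinarith

/-- A false alarm of the simultaneous rule requires many honest sensors that are wrong at the same
time. -/
lemma simRule_excess {N : ℕ} (P : Densities Q) (sel : TieBreak Q) (h : ℝ)
    (g : Attack (N + M) M (Finset (Fin Q))) (ω : Sample Q (N + M)) (t : ℕ) (p : Fin Q)
    (ht : simRule P sel N h g ω t = some p) (q : Fin (Q + 1)) (hq : q ≠ p.succ) :
    ∃ s ≤ t, ∃ S : Finset (Fin (N + M)), S.card = N - M ∧ ∀ k ∈ S,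
      1 ≤ ENNReal.ofReal (Real.exp (-h)) *
        expCusum (likelihoodRatio P p.succ q) (sensorSeq k ω.1) s := by
  have hst := isSimRun_simState P sel N h g ω
  cases t with
  | zero => simp [simRule, hst.decision_zero] at ht
  | succ t =>
    have hcard := hst.le_card ht
    set F := Finset.univ.filter fun k => p ∈ if k ∈ g.compromised
      then g.signal (t + 1) (fun i => ω.1 i) k
      else acceptable h ((simState P sel N h g ω (t + 1)).Y k)
    have h1 : N - M ≤ (F \ g.compromised).card := by
      have := Finset.le_card_sdiff g.compromised F
      have := g.card_le
      omega
    obtain ⟨S, hS, hScard⟩ := Finset.exists_subset_card_eq h1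
    refine ⟨t + 1, le_rfl, S, hScard, fun k hk => ?_⟩
    obtain ⟨hkF, hkB⟩ := Finset.mem_sdiff.1 (hS hk)
    have := (Finset.mem_filter.1 hkF).2
    rw [if_neg hkB] at this
    exact (hst.isCusumPath k).one_le_of_acceptable hq this

/-- A false alarm of the multi-shot rule requires an honest sensor that was wrong at some time. -/
lemma multiRule_excess {d : ℕ} (hd : M < d) (P : Densities Q) (sel : TieBreak Q)
    (h : ℝ) (g : Attack K M (Option (Fin Q))) (ω : Sample Q K) (t : ℕ) (p : Fin Q)
    (ht : multiRule P sel d h g ω t = some p) (q : Fin (Q + 1)) (hq : q ≠ p.succ) :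
    ∃ s ≤ t, ∃ S : Finset (Fin K), S.card = 1 ∧ ∀ k ∈ S,
      1 ≤ ENNReal.ofReal (Real.exp (-h)) *
        expCusum (likelihoodRatio P p.succ q) (sensorSeq k ω.1) s := by
  have hst := isMultiRun_multiState P sel d h g ω
  cases t with
  | zero => simp [multiRule, hst.decision_zero] at ht
  | succ t =>
    have hcard := hst.le_card ht
    obtain ⟨k, hk, hkB⟩ := Finset.exists_mem_notMem_of_card_lt_card
      ((g.card_le.trans_lt hd).trans_le hcard)
    obtain ⟨s, hs, -, hacc⟩ := hst.exists_acceptable hkB (t + 1)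
      (Or.inr (Finset.mem_filter.1 hk).2)
    refine ⟨s, hs, {k}, by simp, fun k' hk' => ?_⟩
    rw [Finset.mem_singleton.1 hk']
    exact (hst.isCusumPath k).one_le_of_acceptable hq hacc

/-! ### Detection is fast -/

/-- If an alarm is raised within `n + c` steps whenever all walks for the true hypothesis climb
above `h` in `n` steps, then the delay is asymptotically at most `h / I^*`. -/
lemma eventually_delay_le {A : Type} {P : Densities Q} (hP : P.Regular) (hQ : 0 < Q)
    (T : ℝ → Rule Q K M A) (c : ℕ)
    (hT : ∀ (h : ℝ) (q : Fin Q) (g : Attack K M A) (ω : Sample Q K) (t₀ n : ℕ), 0 < n →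
      shift t₀ ω.1 ∈ climb P q Finset.univ h n →
      ∃ t, t₀ < t ∧ t ≤ t₀ + (n + c) ∧ (T h g ω t).isSome)
    {δ : ℝ} (hδ : 0 < δ) :
    ∀ᶠ h in atTop, delay P (T h) ≤ ENNReal.ofReal ((1 + δ) * h / P.Istar.toReal) := by
  set I := P.Istar.toReal with hI
  obtain ⟨q₀, hq₀⟩ := P.exists_Istar hQ
  have hIpos : 0 < I := by rw [hI, ← hq₀]; exact hP.Imin_toReal_pos q₀
  -- The slack `δ` is split between the slope of the cones and the probability of a good block.
  obtain ⟨ρ, hρ1, hρ2⟩ : ∃ ρ : ℝ, 1 < ρ ∧ ρ * ρ < 1 + δ := by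
    refine ⟨1 + min δ 1 / 4, by have := lt_min hδ one_pos; linarith, ?_⟩
    have h1 := lt_min hδ one_pos
    have h2 := min_le_left δ 1
    have h3 := min_le_right δ 1
    nlinarith
  have hρ0 : 0 < ρ := by linarith
  have hρinv : ρ⁻¹ < 1 := inv_lt_one_of_one_lt₀ hρ1
  have hε : 0 < I - I / ρ := by
    rw [div_eq_mul_inv]; nlinarith
  have hη : ENNReal.ofReal (1 - ρ⁻¹) ≠ 0 := by
    rw [Ne, ENNReal.ofReal_eq_zero]; linarith
  suffices hq : ∀ q : Fin Q, ∀ᶠ h in atTop, ∀ (g : Attack K M A) (ν : ℕ),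
      essSup (condLExp (past Q K ν) (sampleLaw K P q.succ ν) fun ω => delayAfter (T h g ω) ν)
        (sampleLaw K P q.succ ν) ≤ ENNReal.ofReal ((1 + δ) * h / I) by
    filter_upwards [eventually_all.2 hq] with h hh
    exact iSup_le fun q => iSup_le fun g => iSup_le fun ν => hh q g ν
  intro q
  obtain ⟨C, hC0, hC⟩ := exists_cone (K := K) P (fun _ => q.succ) Finset.univ q.succ
    (fun _ _ => rfl) (hP.I_lt_top q) hε hη
  have hlarge : ∀ᶠ h : ℝ in atTop,
      ((C * (ρ / I) + 1 + c) * ρ) ≤ (1 + δ - ρ * ρ) / I * h := by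
    have : 0 < (1 + δ - ρ * ρ) / I := div_pos (by linarith) hIpos
    exact (tendsto_id.const_mul_atTop this).eventually_ge_atTop _
  filter_upwards [hlarge, eventually_gt_atTop 0] with h hh hh0 g ν
  set n := ⌈(h + C) * (ρ / I)⌉₊ with hn
  have hxpos : 0 < (h + C) * (ρ / I) := by positivity
  have hnpos : 0 < n := Nat.ceil_pos.2 hxpos
  have hclimb : cone P q.succ (Finset.univ : Finset (Fin K)) (I - I / ρ) C ⊆
      climb P q Finset.univ h n := by
    refine cone_subset_climb hP q _ ?_
    have h1 : (h + C) * (ρ / I) ≤ n := Nat.le_ceil _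
    have h2 : I ≤ (P.Imin q).toReal :=
      ENNReal.toReal_mono (hP.Imin_lt_top q).ne (iInf_le _ q)
    calc h + C = (h + C) * (ρ / I) * (I / ρ) := by field_simp
      _ ≤ n * (I / ρ) := by gcongr
      _ ≤ n * ((P.Imin q).toReal - (I - I / ρ)) := by gcongr; linarith
  set G := climb P q (Finset.univ : Finset (Fin K)) h n with hG
  have hGm : MeasurableSet G := measurableSet_climb P q _ h n
  have hp : ENNReal.ofReal ρ⁻¹ ≤ iid (sensorLaw P fun _ : Fin K => q.succ) G := by
    have h1 : iid (sensorLaw P fun _ : Fin K => q.succ) Gᶜ ≤ ENNReal.ofReal (1 - ρ⁻¹) :=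
      (measure_mono (Set.compl_subset_compl.2 hclimb)).trans hC
    have h2 := prob_compl_eq_one_sub (μ := iid (sensorLaw P fun _ : Fin K => q.succ)) hGm.compl
    rw [compl_compl] at h2
    rw [h2]
    refine le_trans ?_ (tsub_le_tsub_left h1 1)
    rw [← ENNReal.ofReal_one, ← ENNReal.ofReal_sub _ (by linarith)]
    exact ENNReal.ofReal_le_ofReal (by linarith)
  refine (essSup_delayAfter_le P q.succ ν (l := n + c) (by omega) hGm
    ((dependsOn_climb P q _ h n).mono fun i (hi : i < n) => Set.mem_Iio.2 (by omega))
    (T h g) fun ω t₀ hω => hT h q g ω t₀ n hnpos hω).trans ?_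
  calc ((n + c : ℕ) : ℝ≥0∞) / iid (sensorLaw P fun _ : Fin K => q.succ) G
      ≤ ((n + c : ℕ) : ℝ≥0∞) / ENNReal.ofReal ρ⁻¹ := ENNReal.div_le_div_left hp _
    _ = ENNReal.ofReal ((n + c) * ρ) := by
        rw [← ENNReal.ofReal_natCast, ← ENNReal.ofReal_div_of_pos (by positivity)]
        congr 1
        push_cast
        field_simp
    _ ≤ ENNReal.ofReal ((1 + δ) * h / I) := by
        refine ENNReal.ofReal_le_ofReal ?_
        have h1 : (n : ℝ) ≤ (h + C) * (ρ / I) + 1 := (Nat.ceil_lt_add_one hxpos.le).le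
        calc ((n : ℝ) + c) * ρ ≤ ((h + C) * (ρ / I) + 1 + c) * ρ := by gcongr
          _ = (C * (ρ / I) + 1 + c) * ρ + ρ * ρ / I * h := by ring
          _ ≤ (1 + δ - ρ * ρ) / I * h + ρ * ρ / I * h := by gcongr
          _ = (1 + δ) * h / I := by ring

/-! ### Attacks with constant signals -/

/-- The sensors in `B` send the same signals at all times, whatever they observe. -/
def constAttack {A : Type} (B : Finset (Fin K)) (hB : B.card ≤ M) (a : Fin K → A) :
    Attack K M A :=
  ⟨B, hB, fun _ _ => a, fun _ _ _ => .const _⟩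

section ConstAttack

variable (P : Densities Q) (sel : TieBreak Q) (d : ℕ) (h : ℝ) (B : Finset (Fin K))
  (hB : B.card ≤ M) (a : Fin K → Finset (Fin Q))

/-- The declarations of the simultaneous alarm under a constant attack, as a function of the
observations. -/
def constDec (x : ℕ → Fin K → ℝ) (t : ℕ) : Option (Fin Q) :=
  simRule P sel d h (constAttack (M := M) B hB a) (x, fun _ _ _ => 0) t

/-- The tie-breaking numbers play no role for the simultaneous alarm. -/
lemma simRule_constAttack (ω : Sample Q K) (t : ℕ) :
    simRule P sel d h (constAttack (M := M) B hB a) ω t = constDec P sel d h B hB a ω.1 t := by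
  have : ∀ t, simState P sel d h (constAttack (M := M) B hB a) ω t =
      simState P sel d h (constAttack (M := M) B hB a) (ω.1, fun _ _ _ => 0) t := fun t => by
    induction t with
    | zero => rfl
    | succ t ih => simp only [simState, ih]
  simp only [simRule, constDec, this]

lemma isSimRun_constDec (x : ℕ → Fin K → ℝ) :
    ∃ st : ℕ → SimState Q K, IsSimRun P sel d h B x (fun _ => a) st ∧
      ∀ t, constDec P sel d h B hB a x t = (st t).decision :=
  ⟨_, isSimRun_simState P sel d h (constAttack (M := M) B hB a) (x, fun _ _ _ => 0),
    fun _ => rfl⟩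

lemma constDec_dependsOn (t : ℕ) :
    DependsOn (fun x => constDec P sel d h B hB a x t) (Set.Iio t) := by
  suffices hs : DependsOn (fun x => simState P sel d h (constAttack (M := M) B hB a)
      (x, fun _ _ _ => 0) t) (Set.Iio t) from fun x y hxy => congrArg _ (hs hxy)
  induction t with
  | zero => exact fun _ _ _ => rfl
  | succ t ih =>
    intro x y hxy
    have h1 := ih fun i (hi : i < t) => hxy i (lt_trans hi t.lt_succ_self)
    simp only at h1
    simp only [simState, h1, hxy t (Set.mem_Iio.2 t.lt_succ_self)]
    rfl

lemma constDec_regenerate (x : ℕ → Fin K → ℝ) (n : ℕ)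
    (hn : (constDec P sel d h B hB a x n).isSome) (t : ℕ) (ht : 1 ≤ t) :
    constDec P sel d h B hB a x (n + t) = constDec P sel d h B hB a (shift n x) t := by
  set g := constAttack (M := M) B hB a
  suffices hs : ∀ t, simState P sel d h g (x, fun _ _ _ => 0) (n + (t + 1)) =
      simState P sel d h g (shift n x, fun _ _ _ => 0) (t + 1) by
    obtain ⟨s, rfl⟩ : ∃ s, t = s + 1 := ⟨t - 1, by omega⟩
    exact congrArg SimState.decision (hs s)
  intro t
  induction t with
  | zero =>
    have hr : (simState P sel d h g (x, fun _ _ _ => 0) n).restart =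
        (SimState.init Q K).restart := by
      have h2 : (simState P sel d h g (x, fun _ _ _ => 0) n).decision.isSome := hn
      simp [SimState.restart, h2, SimState.init]
    change SimState.step _ _ _ _ _ (simState P sel d h g (x, fun _ _ _ => 0) n) _ _ =
      SimState.step _ _ _ _ _ (SimState.init Q K) _ _
    simp only [SimState.step, hr]
    rfl
  | succ t ih =>
    change SimState.step _ _ _ _ _ (simState P sel d h g (x, fun _ _ _ => 0) (n + (t + 1))) _ _ =
      SimState.step _ _ _ _ _ (simState P sel d h g (shift n x, fun _ _ _ => 0) (t + 1)) _ _
    rw [ih]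
    rfl

lemma measurableSet_mem_acceptable {Ω : Type*} [MeasurableSpace Ω] {Y : Ω → CusumMatrix Q}
    (hY : ∀ q j, Measurable fun ω => Y ω q j) (p : Fin Q) :
    MeasurableSet {ω | p ∈ acceptable h (Y ω)} := by
  have : {ω | p ∈ acceptable h (Y ω)} =
      ⋂ j ∈ {j : Fin (Q + 1) | j ≠ p.succ}, {ω | (h : EReal) ≤ Y ω p j} := by
    ext ω; simp [mem_acceptable]
  rw [this]
  exact MeasurableSet.biInter (Set.to_countable _) fun j _ =>
    measurableSet_le measurable_const (hY p j)

lemma measurableSet_fusion_eq {Ω : Type*} [MeasurableSpace Ω]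
    {s : Ω → Fin K → Finset (Fin Q)} (hs : ∀ k p, MeasurableSet {ω | p ∈ s ω k})
    (o : Option (Fin Q)) : MeasurableSet {ω | fusion sel d (s ω) = o} := by
  have hfib : ∀ f : Fin K → Finset (Fin Q), MeasurableSet {ω | s ω = f} := fun f => by
    have : {ω | s ω = f} = ⋂ k, ⋂ p, {ω | p ∈ s ω k ↔ p ∈ f k} := by
      ext ω; simp [funext_iff, Finset.ext_iff]
    rw [this]
    refine MeasurableSet.iInter fun k => MeasurableSet.iInter fun p => ?_
    by_cases hp : p ∈ f k
    · simpa [hp] using hs k p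
    · have h1 : {ω | p ∈ s ω k ↔ p ∈ f k} = {ω | p ∈ s ω k}ᶜ := by ext ω; simp [hp]
      rw [h1]
      exact (hs k p).compl
  have : {ω | fusion sel d (s ω) = o} =
      ⋃ f ∈ {f : Fin K → Finset (Fin Q) | fusion sel d f = o}, {ω | s ω = f} := by
    ext ω; simp
  rw [this]
  exact MeasurableSet.biUnion (Set.to_countable _) fun f _ => hfib f

lemma measurableSet_constDec (t : ℕ) (o : Option (Fin Q)) :
    MeasurableSet {x | constDec P sel d h B hB a x t = o} := by
  set st : (ℕ → Fin K → ℝ) → ℕ → SimState Q K := fun x =>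
    simState P sel d h (constAttack (M := M) B hB a) (x, fun _ _ _ => 0) with hst
  suffices hs : (∀ k q j, Measurable fun x => (st x t).Y k q j) ∧
      ∀ o, MeasurableSet {x | (st x t).decision = o} from hs.2 o
  induction t with
  | zero => exact ⟨fun _ _ _ => measurable_const,
      fun o => MeasurableSet.const ((SimState.init Q K).decision = o)⟩
  | succ t ih =>
    have hY : ∀ k q j, Measurable fun x => (st x (t + 1)).Y k q j := by
      intro k q j
      have hr : Measurable fun x => (st x t).restart.Y k q j := by
        have : (fun x => (st x t).restart.Y k q j) =
            fun x => if (st x t).decision = none then (st x t).Y k q j else 0 := by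
          funext x
          cases hd : (st x t).decision <;> simp [SimState.restart, hd, SimState.init]
        rw [this]
        exact Measurable.ite (ih.2 none) (ih.1 k q j) measurable_const
      exact (hr.add ((measurable_logRatio P q.succ j).comp
        ((measurable_pi_apply k).comp (measurable_pi_apply t)))).max measurable_const
    refine ⟨hY, fun o => ?_⟩
    refine measurableSet_fusion_eq sel d (s := fun x k =>
      if k ∈ B then a k else acceptable h ((st x (t + 1)).Y k)) (fun k p => ?_) o
    by_cases hk : k ∈ B
    · simp [hk]
    · simpa [hk] using measurableSet_mem_acceptable h (fun q j => hY k q j) p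

/-- The mean time to a false alarm is at most that under a constant attack. -/
lemma falseTime_le_waiting (q : Fin (Q + 1)) (p : Fin Q) (hp : p.succ ≠ q) :
    falseTime P Mode.restart (simRule (K := K) (M := M) P sel d h) ≤
      ∫⁻ x, waiting (constDec P sel d h B hB a) {p} x ∂iid (sensorLaw P fun _ : Fin K => q) := by
  classical
  refine (iInf_le _ q).trans ((iInf_le _ (constAttack B hB a)).trans ((iInf_le _ p).trans
    ((iInf_le _ hp).trans ?_)))
  rw [← obsLaw_zero, ← (measurePreserving_fst_sampleLaw (K := K) P q 0).lintegral_comp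
    (measurable_waiting (fun t o => measurableSet_constDec P sel d h B hB a t o) _)]
  refine lintegral_mono fun ω => ?_
  have hdec : simRule P sel d h (constAttack (M := M) B hB a) ω =
      constDec P sel d h B hB a ω.1 := funext fun t => simRule_constAttack P sel d h B hB a ω t
  rw [hdec]
  set dec := constDec P sel d h B hB a
  by_cases hex : ∃ t, 1 ≤ t ∧ dec ω.1 t = some p
  · obtain ⟨h1, h2⟩ := Nat.find_spec hex
    have hq : ω.1 ∈ quiet dec {p} (Nat.find hex - 1) := fun t ht1 ht2 p' hp' hc => by
      rw [Set.mem_singleton_iff.1 hp'] at hc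
      exact Nat.find_min hex (by omega) ⟨ht1, hc⟩
    refine le_trans ?_ (le_waiting_of_mem_quiet hq)
    have := ENat.toENNReal_le.2 (typeTime_restart_le h1 h2)
    rw [Nat.sub_add_cancel h1]
    simpa using this
  · push Not at hex
    have : waiting dec {p} ω.1 = ⊤ := by
      refine ENNReal.eq_top_of_forall_nnreal_le fun r => ?_
      obtain ⟨n, hn⟩ := exists_nat_ge r
      have hq : ω.1 ∈ quiet dec {p} n := fun t ht _ p' hp' => by
        rw [Set.mem_singleton_iff.1 hp']; exact hex t ht
      refine le_trans ?_ (le_waiting_of_mem_quiet hq)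
      have h3 : r ≤ ((n + 1 : ℕ) : ℝ≥0) := hn.trans (by exact_mod_cast n.le_succ)
      exact_mod_cast h3
    rw [this]
    exact le_top

end ConstAttack

section Waiting

variable {X D : Type*} {dec : (ℕ → X) → ℕ → Option D}

lemma waiting_le_of_alarm {x : ℕ → X} {t : ℕ} (ht : 1 ≤ t) (h : (dec x t).isSome) :
    waiting dec Set.univ x ≤ t := by
  obtain ⟨p, hp⟩ := Option.isSome_iff_exists.1 h
  unfold waiting
  rw [tsum_eq_sum (s := Finset.range t)]
  · refine (Finset.sum_le_sum (g := fun _ => 1) fun n _ =>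
      Set.indicator_le_self' (by simp) x).trans (by simp)
  · intro n hn
    refine Set.indicator_of_notMem (fun hq => ?_) _
    exact hq t ht (by simpa using hn) p (Set.mem_univ p) hp

lemma lintegral_waiting_le [MeasurableSpace X] (μ : Measure X) [IsProbabilityMeasure μ] {l : ℕ}
    (hl : 0 < l) {G : Set (ℕ → X)} (hG : MeasurableSet G) (hGl : DependsOn (· ∈ G) (Set.Iio l))
    (hdec : ∀ x t₀, shift t₀ x ∈ G → ∃ t, t₀ < t ∧ t ≤ t₀ + l ∧ (dec x t).isSome) :
    ∫⁻ x, waiting dec Set.univ x ∂iid μ ≤ l / iid μ G := by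
  refine (lintegral_mono fun x => le_blockTime hl fun m hm => ?_).trans
    (lintegral_blockTime μ hG hGl).le
  obtain ⟨t, h1, h2, h3⟩ := hdec x _ hm
  refine (waiting_le_of_alarm (by omega) h3).trans ?_
  exact_mod_cast by rw [Nat.succ_mul]; omega

/-- A finite mean waiting time means that some alarm is raised almost surely. -/
lemma measure_firstAlarmIn_univ [MeasurableSpace X] [Countable D] (μ : Measure X)
    [IsProbabilityMeasure μ] (hdec : ∀ t o, MeasurableSet {x | dec x t = o})
    (hfin : ∫⁻ x, waiting dec Set.univ x ∂iid μ ≠ ⊤) : iid μ (firstAlarmIn dec Set.univ) = 1 := by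
  classical
  refine (mem_ae_iff_prob_eq_one (measurableSet_firstAlarmIn hdec _)).1 ?_
  filter_upwards [ae_lt_top (measurable_waiting hdec _) hfin] with x hx
  have hex : ∃ t, 1 ≤ t ∧ dec x t ≠ none := by
    by_contra hno
    push Not at hno
    refine hx.ne (ENNReal.eq_top_of_forall_nnreal_le fun r => ?_)
    obtain ⟨n, hn⟩ := exists_nat_ge r
    have hq : x ∈ quiet dec Set.univ n := fun t ht _ p _ => by simp [hno t ht]
    refine le_trans ?_ (le_waiting_of_mem_quiet hq)
    have h3 : r ≤ ((n + 1 : ℕ) : ℝ≥0) := hn.trans (by exact_mod_cast n.le_succ)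
    exact_mod_cast h3
  obtain ⟨h1, h2⟩ := Nat.find_spec hex
  obtain ⟨p, hp⟩ := Option.ne_none_iff_exists'.1 h2
  refine ⟨Nat.find hex, h1, fun s hs1 hs2 => ?_, p, Set.mem_univ p, hp⟩
  by_contra hc
  exact Nat.find_min hex hs2 ⟨hs1, hc⟩

end Waiting

end

section

variable {Q K N M : ℕ}

/-! ### Growth of elementary functions -/

lemma eventually_linear_mul_exp_le (a b c : ℝ) {κ κ' : ℝ} (hκ : κ < κ') :
    ∀ᶠ h : ℝ in atTop, (a * h + b) * Real.exp (κ * h + c) ≤ Real.exp (κ' * h) := by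
  have hδ : 0 < (κ' - κ) := by linarith
  have h1 : (fun h : ℝ => a * h + b) =o[atTop] fun h => Real.exp ((κ' - κ) * h) := by
    have h2 := isLittleO_pow_exp_pos_mul_atTop 1 hδ
    have h3 := isLittleO_pow_exp_pos_mul_atTop 0 hδ
    refine ((h2.const_mul_left a).add (h3.const_mul_left b)).congr_left fun h => by simp
  have h4 := h1.bound (Real.exp_pos (-c))
  filter_upwards [h4] with h hh
  have h5 : a * h + b ≤ Real.exp (-c) * Real.exp ((κ' - κ) * h) := by
    have := (le_abs_self _).trans hh
    rwa [Real.norm_eq_abs, Real.abs_exp] at this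
  calc (a * h + b) * Real.exp (κ * h + c)
      ≤ Real.exp (-c) * Real.exp ((κ' - κ) * h) * Real.exp (κ * h + c) := by gcongr
    _ = Real.exp (κ' * h) := by rw [← Real.exp_add, ← Real.exp_add]; congr 1; ring

lemma eventually_linear_mul_exp_neg_le (a b : ℝ) {η : ℝ} (hη : 0 < η) :
    ∀ᶠ h : ℝ in atTop, (a * h + b) * Real.exp (-h) ≤ η := by
  have h1 : Tendsto (fun h : ℝ => Real.exp (-(1 / 2) * h)) atTop (nhds 0) :=
    Real.tendsto_exp_atBot.comp (tendsto_id.const_mul_atTop_of_neg (by norm_num))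
  filter_upwards [eventually_linear_mul_exp_le a b 0 (κ := -1) (κ' := -(1 / 2)) (by norm_num),
    h1.eventually_le_const hη] with h h2 h3
  refine le_trans ?_ (h2.trans h3)
  rw [neg_one_mul, add_zero]

/-! ### Wrong acceptances -/

/-- Before time `n`, a sensor in `A` has a large statistic for some type against the density `q`. -/
def wrongExcess (P : Densities Q) (q : Fin (Q + 1)) (A : Finset (Fin K)) (b : ℝ≥0∞) (n : ℕ) :
    Set (ℕ → Fin K → ℝ) :=
  {x | ∃ t < n, ∃ k ∈ A, ∃ p : Fin Q, p.succ ≠ q ∧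
    1 ≤ b * expCusum (likelihoodRatio P p.succ q) (sensorSeq k x) t}

lemma wrongExcess_eq (P : Densities Q) (q : Fin (Q + 1)) (A : Finset (Fin K)) (b : ℝ≥0∞) (n : ℕ) :
    wrongExcess P q A b n = ⋃ t ∈ Finset.range n, ⋃ k ∈ A,
      ⋃ p ∈ (Finset.univ.filter fun p : Fin Q => p.succ ≠ q),
        {x | 1 ≤ b * expCusum (likelihoodRatio P p.succ q) (sensorSeq k x) t} := by
  ext x; simp [wrongExcess]

lemma measurableSet_wrongExcess (P : Densities Q) (q : Fin (Q + 1)) (A : Finset (Fin K))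
    (b : ℝ≥0∞) (n : ℕ) : MeasurableSet (wrongExcess P q A b n) := by
  rw [wrongExcess_eq]
  refine Finset.measurableSet_biUnion _ fun t _ => Finset.measurableSet_biUnion _ fun k _ =>
    Finset.measurableSet_biUnion _ fun p _ => measurableSet_le measurable_const ?_
  exact ((measurable_expCusum (measurable_likelihoodRatio P p.succ q) t).comp
    (measurable_sensorSeq k)).const_mul b

lemma dependsOn_wrongExcess (P : Densities Q) (q : Fin (Q + 1)) (A : Finset (Fin K)) (b : ℝ≥0∞)
    (n : ℕ) : DependsOn (· ∈ wrongExcess P q A b (n + 1)) (Set.Iio n) := fun x y hxy => by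
  have h1 : ∀ t < n + 1, ∀ k (p : Fin Q),
      expCusum (likelihoodRatio P p.succ q) (sensorSeq k x) t =
        expCusum (likelihoodRatio P p.succ q) (sensorSeq k y) t := fun t ht k p =>
    dependsOn_expCusum _ t fun i (hi : i < t) => congrFun (hxy i (Set.mem_Iio.2 (by omega))) k
  refine propext (exists_congr fun t => and_congr_right fun ht => ?_)
  simp only [h1 t ht]

lemma measure_wrongExcess_le (P : Densities Q) (q : Fin (Q + 1)) (A : Finset (Fin K))
    (f : Fin K → Fin (Q + 1)) (hA : ∀ k ∈ A, f k = q) (b : ℝ≥0∞) (n : ℕ) :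
    iid (sensorLaw P f) (wrongExcess P q A b n) ≤ n * (K * (Q * b)) := by
  classical
  rw [wrongExcess_eq]
  have hcardA : (A.card : ℝ≥0∞) ≤ K := by exact_mod_cast (card_finset_fin_le A)
  have h3 : ∀ t, ∀ k ∈ A, ∀ p : Fin Q, iid (sensorLaw P f)
      {x | 1 ≤ b * expCusum (likelihoodRatio P p.succ q) (sensorSeq k x) t} ≤ b := by
    intro t k hk p
    have := measure_accept_le P f {k} p.succ q (by simpa using hA k hk) t b
    simpa using this
  have h2 : ∀ t, ∀ k ∈ A, iid (sensorLaw P f)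
      (⋃ p ∈ (Finset.univ.filter fun p : Fin Q => p.succ ≠ q),
        {x | 1 ≤ b * expCusum (likelihoodRatio P p.succ q) (sensorSeq k x) t}) ≤ Q * b := by
    intro t k hk
    refine (measure_biUnion_finset_le _ _).trans ((Finset.sum_le_sum fun p _ => h3 t k hk p).trans ?_)
    rw [Finset.sum_const, nsmul_eq_mul]
    gcongr
    exact_mod_cast card_finset_fin_le _
  have h1 : ∀ t, iid (sensorLaw P f) (⋃ k ∈ A,
      ⋃ p ∈ (Finset.univ.filter fun p : Fin Q => p.succ ≠ q),
        {x | 1 ≤ b * expCusum (likelihoodRatio P p.succ q) (sensorSeq k x) t}) ≤ K * (Q * b) := by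
    intro t
    refine (measure_biUnion_finset_le _ _).trans ((Finset.sum_le_sum fun k hk => h2 t k hk).trans ?_)
    rw [Finset.sum_const, nsmul_eq_mul]
    gcongr
  refine (measure_biUnion_finset_le _ _).trans ((Finset.sum_le_sum fun t _ => h1 t).trans ?_)
  rw [Finset.sum_const, nsmul_eq_mul, Finset.card_range]

/-! ### Attacks that provoke false alarms -/

lemma exists_disjoint_sets (N M : ℕ) : ∃ B A : Finset (Fin (N + M)),
    B.card = M ∧ A.card = N - M ∧ Disjoint A B := by
  obtain ⟨B, -, hB⟩ := Finset.exists_subset_card_eq (s := (Finset.univ : Finset (Fin (N + M))))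
    (n := M) (by simp)
  have hc : Bᶜ.card = N := by rw [Finset.card_compl, hB]; simp
  obtain ⟨A, hA, hAc⟩ := Finset.exists_subset_card_eq (s := Bᶜ) (n := N - M) (by omega)
  exact ⟨B, A, hB, hAc, Finset.disjoint_left.2 fun k hk => Finset.mem_compl.1 (hA hk)⟩

/-- Before the change all alarms are false, so the type which is most likely to be declared by the
first alarm gives a bound for the mean time to a false alarm. -/
lemma falseTime_le_of_block (P : Densities Q) (sel : TieBreak Q) (d : ℕ) (h : ℝ)
    (B : Finset (Fin K)) (hB : B.card ≤ M) (a : Fin K → Finset (Fin Q)) {l : ℕ} (hl : 0 < l)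
    {G : Set (ℕ → Fin K → ℝ)} (hG : MeasurableSet G) (hGl : DependsOn (· ∈ G) (Set.Iio l))
    (hdec : ∀ x t₀, shift t₀ x ∈ G → ∃ t, t₀ < t ∧ t ≤ t₀ + l ∧
      (constDec P sel d h B hB a x t).isSome)
    (hpos : iid (sensorLaw P fun _ : Fin K => 0) G ≠ 0) :
    falseTime P Mode.restart (simRule (K := K) (M := M) P sel d h) ≤
      Q * (l / iid (sensorLaw P fun _ : Fin K => 0) G) := by
  have hmeas := fun t o => measurableSet_constDec P sel d h B hB a t o
  have hV := lintegral_waiting_le (sensorLaw P fun _ : Fin K => 0) hl hG hGl hdec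
  have hfin : (l : ℝ≥0∞) / iid (sensorLaw P fun _ : Fin K => 0) G ≠ ⊤ :=
    ENNReal.div_ne_top (by simp) hpos
  have hone := measure_firstAlarmIn_univ _ hmeas (ne_top_of_le_ne_top hfin hV)
  obtain ⟨p, -, hp⟩ := exists_lintegral_waiting_le (sensorLaw P fun _ : Fin K => 0) hmeas
    (constDec_dependsOn P sel d h B hB a) (constDec_regenerate P sel d h B hB a) Finset.univ
    one_ne_zero (by rw [Finset.coe_univ, hone])
  refine (falseTime_le_waiting P sel d h B hB a 0 p (Fin.succ_ne_zero p)).trans (hp.trans ?_)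
  rw [div_one, Finset.card_univ, Fintype.card_fin]
  gcongr

/-- If the compromised sensors can raise alarms on their own, false alarms are immediate. -/
lemma falseTime_le_of_le (hQ : 0 < Q) (P : Densities Q) (sel : TieBreak Q) {d : ℕ} (hd : d ≤ M)
    (h : ℝ) : falseTime P Mode.restart (simRule (K := N + M) (M := M) P sel d h) ≤ Q := by
  obtain ⟨B, -, hB, -, -⟩ := exists_disjoint_sets N M
  have := falseTime_le_of_block P sel d h B hB.le (fun _ => {⟨0, hQ⟩}) (l := 1) one_pos
    (G := Set.univ) MeasurableSet.univ (fun _ _ _ => rfl) (fun x t₀ _ => by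
      obtain ⟨st, hst, hdec⟩ := isSimRun_constDec P sel d h B hB.le (fun _ => {⟨0, hQ⟩}) x
      simp only [hdec]
      exact hst.exists_alarm one_pos (p := ⟨0, hQ⟩) (A := B) (fun k hk hkB => absurd hk hkB)
        (fun _ _ _ _ => by simp) (by omega)) (by simp)
  simpa using this

/-- If more sensors are required than are honest, compromised sensors can suppress all alarms. -/
lemma delay_eq_top (hQ : 0 < Q) (P : Densities Q) (sel : TieBreak Q) {d : ℕ} (hd : N < d) (h : ℝ) :
    delay P (simRule (K := N + M) (M := M) P sel d h) = ⊤ := by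
  obtain ⟨B, -, hB, -, -⟩ := exists_disjoint_sets N M
  have hnone : ∀ (ω : Sample Q (N + M)) t,
      simRule P sel d h (constAttack (M := M) B hB.le fun _ => ∅) ω t = none := by
    intro ω t
    have hst := isSimRun_simState P sel d h (constAttack (M := M) B hB.le fun _ => ∅) ω
    cases t with
    | zero => exact hst.decision_zero
    | succ t =>
      by_contra hne
      obtain ⟨p, hp⟩ := Option.ne_none_iff_exists'.1 hne
      have h1 := hst.le_card hp
      have h2 : (Finset.univ.filter fun k => p ∈ if k ∈ B then ∅ else acceptable h
          ((simState P sel d h (constAttack (M := M) B hB.le fun _ => ∅) ω (t + 1)).Y k)) ⊆ Bᶜ := by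
        intro k hk
        rw [Finset.mem_compl]
        intro hkB
        have := (Finset.mem_filter.1 hk).2
        simp [hkB] at this
      have h3 := Finset.card_le_card h2
      have hc : Bᶜ.card = N := by rw [Finset.card_compl, hB, Fintype.card_fin]; omega
      have h4 : d ≤ N := h1.trans (h3.trans hc.le)
      omega
  refine top_le_iff.1 (le_trans ?_ (le_iSup_of_le (⟨0, hQ⟩ : Fin Q)
    (le_iSup_of_le (constAttack (M := M) B hB.le fun _ => ∅) (le_iSup_of_le 0 le_rfl))))
  have hD : (fun ω : Sample Q (N + M) => delayAfter
      (simRule P sel d h (constAttack (M := M) B hB.le fun _ => ∅) ω) 0) = fun _ => ⊤ := by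
    funext ω
    rw [delayAfter, alarmTime_one_eq_top (hnone ω)]
    simp
  rw [hD, condLExp_const (past_le Q (N + M) 0), essSup_const _ (IsProbabilityMeasure.ne_zero _)]

/-- The price of a change of measure at the sensors in `A` from the density `j` to that of type `q`,
over `n` observations. -/
lemma half_le_exp_mul_of_tilt {P : Densities Q} {q : Fin Q} {j : Fin (Q + 1)} (hj : j ≠ q.succ)
    (hI : P.I q.succ j < ⊤) (A : Finset (Fin K)) {ε C : ℝ} {n : ℕ} {E : Set (ℕ → Fin K → ℝ)}
    (hE : MeasurableSet E) (hEn : DependsOn (· ∈ E) (Set.Iio n))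
    (h1 : iid (sensorLaw P fun k => if k ∈ A then q.succ else j) Eᶜ ≤ 1 / 4)
    (h2 : iid (sensorLaw P fun k => if k ∈ A then q.succ else j) (cone P q.succ A ε C)ᶜ ≤ 1 / 4) :
    1 / 2 ≤ ENNReal.ofReal (Real.exp (A.card * (n * ((P.I q.succ j).toReal + ε) + C))) *
      iid (sensorLaw P fun _ : Fin K => j) E := by
  classical
  set μ := sensorLaw P fun _ : Fin K => j with hμ
  set ρ := sensorLaw P fun k => if k ∈ A then q.succ else j with hρ
  set r : (Fin K → ℝ) → ℝ≥0∞ := fun a => ∏ k ∈ A, likelihoodRatio P q.succ j (a k) with hr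
  have hlr := measurable_likelihoodRatio P q.succ j
  have hrm : Measurable r := Finset.measurable_fun_prod _ fun k _ => hlr.comp (measurable_pi_apply k)
  have hρμ : ρ = μ.withDensity r := by
    rw [hρ, hμ, sensorLaw, sensorLaw, ← Measure.infinitePi_eq_pi, ← Measure.infinitePi_eq_pi]
    refine infinitePi_withDensity _ _ A (fun _ => likelihoodRatio P q.succ j) (fun _ => hlr)
      (fun k hk => ?_) (fun k hk => by simp [hk])
    simp only [hk, if_true]
    exact law_eq_withDensity P (absolutelyContinuous_of_I_lt_top hI)
  set c := ENNReal.ofReal (Real.exp (A.card * (n * ((P.I q.succ j).toReal + ε) + C))) with hc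
  have hfm : Measurable fun x : ℕ → Fin K → ℝ => ∏ i ∈ Finset.range n, r (x i) :=
    Finset.measurable_fun_prod _ fun i _ => hrm.comp (measurable_pi_apply i)
  set F : Set (ℕ → Fin K → ℝ) := E ∩ {x | ∏ i ∈ Finset.range n, r (x i) ≤ c} with hF
  have hFm : MeasurableSet F := hE.inter (measurableSet_le hfm measurable_const)
  have hFn : DependsOn (· ∈ F) (Set.Iio n) := fun x y hxy => by
    have ha : (x ∈ E) = (y ∈ E) := hEn hxy
    have hb : ∏ i ∈ Finset.range n, r (x i) = ∏ i ∈ Finset.range n, r (y i) :=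
      Finset.prod_congr rfl fun i hi => by rw [hxy i (Finset.mem_range.1 hi)]
    simp only [hF, Set.mem_inter_iff, Set.mem_ofPred_eq, ha, hb]
  have hsub : Fᶜ ⊆ Eᶜ ∪ (cone P q.succ A ε C)ᶜ := by
    rw [← Set.compl_inter]
    refine Set.compl_subset_compl.2 fun x hx => ⟨hx.1, ?_⟩
    change ∏ i ∈ Finset.range n, ∏ k ∈ A, likelihoodRatio P q.succ j (x i k) ≤ c
    rw [Finset.prod_comm]
    calc ∏ k ∈ A, ∏ i ∈ Finset.range n, likelihoodRatio P q.succ j (x i k)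
        ≤ ∏ k ∈ A, ENNReal.ofReal (Real.exp (n * ((P.I q.succ j).toReal + ε) + C)) := by
          refine Finset.prod_le_prod' fun k hk => ?_
          obtain ⟨s, hs, hb⟩ := hx.2 k hk j hj n
          have he := exp_llrSum P q.succ j (sensorSeq k x) n
          rw [hs, EReal.exp_coe] at he
          refine le_trans (le_of_eq he.symm) (ENNReal.ofReal_le_ofReal (Real.exp_le_exp.2 ?_))
          linarith [(abs_le.1 hb).2]
      _ = c := by
          rw [Finset.prod_const, ← ENNReal.ofReal_pow (Real.exp_nonneg _), ← Real.exp_nat_mul]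
  have hhalf : 1 / 2 ≤ iid ρ F := by
    have h3 : iid ρ Fᶜ ≤ 1 / 2 := by
      refine (measure_mono hsub).trans ((measure_union_le _ _).trans ((add_le_add h1 h2).trans ?_))
      rw [← ENNReal.toReal_le_toReal (by finiteness) (by finiteness)]
      norm_num [ENNReal.toReal_add]
    have h4 := prob_compl_eq_one_sub (μ := iid ρ) hFm.compl
    rw [compl_compl] at h4
    rw [h4]
    refine le_trans ?_ (tsub_le_tsub_left h3 1)
    rw [one_div, ENNReal.one_sub_inv_two]
  calc 1 / 2 ≤ iid ρ F := hhalf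
    _ ≤ c * iid μ F := measure_le_mul_of_tilt μ ρ hrm hρμ n hFm hFn fun x hx => hx.2
    _ ≤ c * iid μ E := by gcongr; exact Set.inter_subset_left

/-! ### Upper bounds for the mean time to a false alarm -/

lemma exists_level {C r h : ℝ} (hC : 0 ≤ C) (hr : 0 < r) (hh : 0 ≤ h) :
    ∃ n : ℕ, 0 < n ∧ h + C ≤ n * r ∧ (n : ℝ) ≤ h / r + (C / r + 2) := by
  refine ⟨⌈(h + C) / r⌉₊ + 1, Nat.succ_pos _, ?_, ?_⟩
  · rw [← div_le_iff₀ hr]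
    push_cast
    linarith [Nat.le_ceil ((h + C) / r)]
  · push_cast
    have := (Nat.ceil_lt_add_one (a := (h + C) / r) (by positivity)).le
    rw [add_div] at this ⊢
    linarith

lemma ofReal_div_le_of_half_le {X y : ℝ} (hy : 0 ≤ y) {π : ℝ≥0∞}
    (h : 1 / 2 ≤ ENNReal.ofReal X * π) :
    ENNReal.ofReal y / π ≤ ENNReal.ofReal (2 * y * X) := by
  refine ENNReal.div_le_of_le_mul ?_
  rw [ENNReal.ofReal_mul (by positivity), mul_assoc]
  calc ENNReal.ofReal y = ENNReal.ofReal (2 * y) * (1 / 2) := by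
        rw [show (1 / 2 : ℝ≥0∞) = ENNReal.ofReal (1 / 2) by
          rw [ENNReal.ofReal_div_of_pos two_pos, ENNReal.ofReal_one, ENNReal.ofReal_ofNat],
          ← ENNReal.ofReal_mul (by positivity)]
        congr 1; ring
    _ ≤ _ := by gcongr

/-- Before the change, the compromised sensors vote for `q`, and the first alarm is raised as soon
as `N - M` honest sensors join them. A change of measure at these sensors shows that this takes a
time that is exponential in the threshold. -/
lemma exists_falseTime_le_of_zero {P : Densities Q} (hP : P.Regular) (sel : TieBreak Q) {d : ℕ}
    (hM : M ≤ N) (hd : d ≤ N) (q : Fin Q) {ε : ℝ} (hε : 0 < ε) (hεI : ε < (P.Imin q).toReal) :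
    ∃ a b c : ℝ, ∀ h' : ℝ, 0 ≤ h' → ∀ h ≤ h',
      falseTime P Mode.restart (simRule (K := N + M) (M := M) P sel d h) ≤
        ENNReal.ofReal ((a * h' + b) * Real.exp
          ((N - M : ℕ) * (((P.I q.succ 0).toReal + ε) / ((P.Imin q).toReal - ε)) * h' + c)) := by
  obtain ⟨B, A, hB, hA, hAB⟩ := exists_disjoint_sets N M
  have hq0 : (0 : Fin (Q + 1)) ≠ q.succ := (Fin.succ_ne_zero q).symm
  set r := (P.Imin q).toReal - ε with hr
  have hr0 : 0 < r := by rw [hr]; linarith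
  set J := (P.I q.succ 0).toReal + ε with hJ
  have hJ0 : 0 ≤ J := by positivity
  obtain ⟨C, hC0, hC⟩ := exists_cone (K := N + M) P (fun k => if k ∈ A then q.succ else 0) A q.succ
    (fun k hk => by simp [hk]) (hP.I_lt_top q) hε (η := 1 / 4) (by simp)
  set m : ℝ := ((N - M : ℕ) : ℝ) with hm
  refine ⟨2 * Q / r, 2 * Q * (C / r + 2), m * ((C / r + 2) * J + C), fun h' hh' h hh => ?_⟩
  obtain ⟨n, hn0, hn1, hn2⟩ := exists_level hC0 hr0 hh'
  have hclimb := cone_subset_climb hP q A (ε := ε) hn1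
  have hG := measurableSet_climb P q A h' n
  have hGn := dependsOn_climb P q A h' n
  have hhalf := half_le_exp_mul_of_tilt hq0 (hP.I_lt_top q 0 hq0) A hG hGn
    ((measure_mono (Set.compl_subset_compl.2 hclimb)).trans hC) hC
  have hpos : iid (sensorLaw P fun _ : Fin (N + M) => 0) (climb P q A h' n) ≠ 0 := by
    intro h0
    rw [h0, mul_zero] at hhalf
    simp at hhalf
  refine (falseTime_le_of_block P sel d h B hB.le (fun _ => {q}) hn0 hG hGn (fun x t₀ hx => ?_)
    hpos).trans ?_
  · obtain ⟨st, hst, hdec⟩ := isSimRun_constDec P sel d h B hB.le (fun _ => {q}) x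
    simp only [hdec]
    refine hst.exists_alarm hn0 (p := q) (A := A ∪ B) (fun k hk hkB j hj => ?_)
      (fun _ _ _ _ => by simp) (by rw [Finset.card_union_of_disjoint hAB]; omega)
    exact (EReal.coe_le_coe_iff.2 hh).trans
      (hx k ((Finset.mem_union.1 hk).resolve_right hkB) j hj)
  · rw [hA] at hhalf
    have h1 := ofReal_div_le_of_half_le n.cast_nonneg hhalf
    rw [ENNReal.ofReal_natCast] at h1
    refine (mul_le_mul_right h1 (Q : ℝ≥0∞)).trans ?_
    rw [← ENNReal.ofReal_natCast Q, ← ENNReal.ofReal_mul Q.cast_nonneg]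
    refine ENNReal.ofReal_le_ofReal ?_
    have h2 : m * (n * J + C) ≤ m * (J / r) * h' + m * ((C / r + 2) * J + C) := by
      calc m * (n * J + C) ≤ m * ((h' / r + (C / r + 2)) * J + C) := by gcongr
        _ = _ := by ring
    calc Q * (2 * n * Real.exp (m * (n * J + C)))
        ≤ Q * (2 * (h' / r + (C / r + 2)) *
          Real.exp (m * (J / r) * h' + m * ((C / r + 2) * J + C))) := by gcongr
      _ = _ := by ring

/-- After a change to the type `q₁`, the compromised sensors vote for another type `q`. Alarms are
raised after times which are linear in the threshold, and a change of measure at `N - M` honest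
sensors bounds the probability that the first one has the type `q`. -/
lemma exists_falseTime_le_of_succ {P : Densities Q} (hP : P.Regular) (sel : TieBreak Q) {d : ℕ}
    (hM : M < d) (hd : d ≤ N) {q q₁ : Fin Q} (hq : q₁ ≠ q) {ε : ℝ} (hε : 0 < ε)
    (hεI : ε < (P.Imin q).toReal) :
    ∃ a b c : ℝ, ∀ᶠ h in atTop,
      falseTime P Mode.restart (simRule (K := N + M) (M := M) P sel d h) ≤
        ENNReal.ofReal ((a * h + b) * Real.exp
          ((N - M : ℕ) * (((P.I q.succ q₁.succ).toReal + ε) / ((P.Imin q).toReal - ε)) * h + c)) := by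
  obtain ⟨B, A, hB, hA, hAB⟩ := exists_disjoint_sets N M
  have hq' : q₁.succ ≠ q.succ := fun h => hq (Fin.succ_injective Q h)
  set r := (P.Imin q).toReal - ε with hr
  have hr0 : 0 < r := by rw [hr]; linarith
  set J := (P.I q.succ q₁.succ).toReal + ε with hJ
  have hJ0 : 0 ≤ J := by positivity
  set f : Fin (N + M) → Fin (Q + 1) := fun k => if k ∈ A then q.succ else q₁.succ with hf
  have hfA : ∀ k ∈ A, f k = q.succ := fun k hk => by simp [hf, hk]
  obtain ⟨C, hC0, hC⟩ := exists_cone (K := N + M) P f A q.succ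
    hfA (hP.I_lt_top q) hε (η := 1 / 8) (by simp)
  set r₁ := (P.Imin q₁).toReal / 2 with hr₁
  have hr₁0 : 0 < r₁ := half_pos (hP.Imin_toReal_pos q₁)
  obtain ⟨C₁, hC₁0, hC₁⟩ := exists_cone (K := N + M) P (fun _ => q₁.succ) Finset.univ q₁.succ
    (fun _ _ => rfl) (hP.I_lt_top q₁) hr₁0 (η := 1 / 2) (by simp)
  set m : ℝ := ((N - M : ℕ) : ℝ) with hm
  refine ⟨4 / r₁, 4 * (C₁ / r₁ + 2), m * ((C / r + 2) * J + C), ?_⟩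
  filter_upwards [eventually_ge_atTop 0, eventually_linear_mul_exp_neg_le
    ((N + M : ℕ) * Q / r) ((N + M : ℕ) * Q * (C / r + 3)) (η := 1 / 8) (by norm_num)] with h hh hexp
  set dec := constDec P sel d h B hB.le (fun _ => {q}) with hdecdef
  have hmeas : ∀ t o, MeasurableSet {x | dec x t = o} :=
    fun t o => measurableSet_constDec P sel d h B hB.le _ t o
  -- Some alarm is raised soon.
  obtain ⟨n₁, hn₁0, hn₁1, hn₁2⟩ := exists_level hC₁0 hr₁0 hh
  have hclimb₁ : cone P q₁.succ (Finset.univ : Finset (Fin (N + M))) r₁ C₁ ⊆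
      climb P q₁ Finset.univ h n₁ := cone_subset_climb hP q₁ _ (by
        rw [hr₁, sub_half, ← hr₁]; exact hn₁1)
  have hG₁ := measurableSet_climb P q₁ (Finset.univ : Finset (Fin (N + M))) h n₁
  have hBc : Bᶜ.card = N := by rw [Finset.card_compl, hB, Fintype.card_fin]; omega
  have hV := lintegral_waiting_le (dec := dec) (sensorLaw P fun _ : Fin (N + M) => q₁.succ) hn₁0 hG₁
    (dependsOn_climb P q₁ _ h n₁) fun x t₀ hx => by
      obtain ⟨st, hst, hdec⟩ := isSimRun_constDec P sel d h B hB.le (fun _ => {q}) x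
      simp only [hdecdef, hdec]
      exact hst.exists_alarm hn₁0 (p := q₁) (A := Bᶜ)
        (fun k _ _ j hj => hx k (Finset.mem_univ k) j hj)
        (fun k hk hkB => absurd hkB (Finset.mem_compl.1 hk)) (by omega)
  have hG₁half : 1 / 2 ≤ ENNReal.ofReal 1 * iid (sensorLaw P fun _ : Fin (N + M) => q₁.succ)
      (climb P q₁ Finset.univ h n₁) := by
    have h1 := (measure_mono (Set.compl_subset_compl.2 hclimb₁)).trans hC₁
    have h2 := prob_compl_eq_one_sub
      (μ := iid (sensorLaw P fun _ : Fin (N + M) => q₁.succ)) hG₁.compl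
    rw [compl_compl] at h2
    rw [h2, ENNReal.ofReal_one, one_mul]
    refine le_trans ?_ (tsub_le_tsub_left h1 1)
    rw [one_div, ENNReal.one_sub_inv_two]
  have hV' : ∫⁻ x, waiting dec Set.univ x ∂iid (sensorLaw P fun _ : Fin (N + M) => q₁.succ) ≤
      ENNReal.ofReal (2 * n₁) := by
    have h3 := ofReal_div_le_of_half_le n₁.cast_nonneg hG₁half
    rw [ENNReal.ofReal_natCast, mul_one] at h3
    exact hV.trans h3
  -- The first alarm has type `q` on the following event.
  obtain ⟨n, hn0, hn1, hn2⟩ := exists_level hC0 hr0 hh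
  have hclimb := cone_subset_climb hP q A (ε := ε) hn1
  set b := ENNReal.ofReal (Real.exp (-h)) with hb
  set E := climb P q A h n ∩ (wrongExcess P q.succ A b (n + 1))ᶜ with hE
  have hEm : MeasurableSet E :=
    (measurableSet_climb P q A h n).inter (measurableSet_wrongExcess P q.succ A b (n + 1)).compl
  have hEn : DependsOn (· ∈ E) (Set.Iio n) := fun x y hxy => by
    have h1 : (x ∈ climb P q A h n) = (y ∈ climb P q A h n) := dependsOn_climb P q A h n hxy
    have h2 : (x ∈ wrongExcess P q.succ A b (n + 1)) = (y ∈ wrongExcess P q.succ A b (n + 1)) :=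
      dependsOn_wrongExcess P q.succ A b n hxy
    simp only [hE, Set.mem_inter_iff, Set.mem_compl_iff, h1, h2]
  have hEfirst : E ⊆ firstAlarmIn dec ({q} : Finset (Fin Q)) := by
    rintro x ⟨hx1, hx2⟩
    obtain ⟨st, hst, hdec⟩ := isSimRun_constDec P sel d h B hB.le (fun _ => {q}) x
    have hex : ∃ t, 0 < t ∧ t ≤ 0 + n ∧ (dec x t).isSome := by
      simp only [hdecdef, hdec]
      refine hst.exists_alarm hn0 (p := q) (A := A ∪ B) (fun k hk hkB j hj => ?_)
        (fun _ _ _ _ => by simp) (by rw [Finset.card_union_of_disjoint hAB]; omega)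
      rw [shift_zero]
      exact hx1 k ((Finset.mem_union.1 hk).resolve_right hkB) j hj
    obtain ⟨h1, h2, h3⟩ := Nat.find_spec hex
    obtain ⟨p, hp⟩ := Option.isSome_iff_exists.1 h3
    refine ⟨Nat.find hex, h1, fun s hs1 hs2 => ?_, p, ?_, hp⟩
    · by_contra hc
      exact Nat.find_min hex hs2 ⟨hs1, by omega, Option.isSome_iff_ne_none.2 hc⟩
    · by_contra hpq
      have hpq' : p ≠ q := by simpa using hpq
      obtain ⟨t, ht⟩ : ∃ t, Nat.find hex = t + 1 := ⟨Nat.find hex - 1, by omega⟩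
      rw [ht, hdecdef, hdec] at hp
      have hcard := hst.le_card hp
      -- Only the `M` remaining sensors may support another type.
      have hsub : (Finset.univ.filter fun k => p ∈ if k ∈ B then {q} else
          acceptable h ((st (t + 1)).Y k)) ⊆ (A ∪ B)ᶜ := by
        intro k hk
        have hk' := (Finset.mem_filter.1 hk).2
        rw [Finset.mem_compl, Finset.mem_union]
        have hkB : k ∉ B := fun hkB => by
          rw [if_pos hkB] at hk'
          exact hpq' (Finset.mem_singleton.1 hk')
        rw [if_neg hkB] at hk'
        rintro (hkA | hkB')
        · exact hx2 ⟨t + 1, by omega, k, hkA, p, fun he => hpq' (Fin.succ_injective Q he),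
            (hst.isCusumPath k).one_le_of_acceptable
              (fun he => hpq' (Fin.succ_injective Q he).symm) hk'⟩
        · exact hkB hkB'
      have h4 := Finset.card_le_card hsub
      have h5 : (A ∪ B)ᶜ.card = M := by
        rw [Finset.card_compl, Finset.card_union_of_disjoint hAB, Fintype.card_fin]; omega
      have h6 : d ≤ M := hcard.trans (h4.trans h5.le)
      omega
  have hwrong : iid (sensorLaw P f) (wrongExcess P q.succ A b (n + 1)) ≤ 1 / 8 := by
    refine (measure_wrongExcess_le P q.succ A f hfA b (n + 1)).trans ?_
    rw [hb, ← ENNReal.ofReal_natCast, ← ENNReal.ofReal_natCast, ← ENNReal.ofReal_natCast,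
      ← ENNReal.ofReal_mul (by positivity), ← ENNReal.ofReal_mul (by positivity),
      ← ENNReal.ofReal_mul (by positivity),
      show (1 / 8 : ℝ≥0∞) = ENNReal.ofReal (1 / 8) by
        rw [ENNReal.ofReal_div_of_pos (by norm_num), ENNReal.ofReal_one, ENNReal.ofReal_ofNat]]
    refine ENNReal.ofReal_le_ofReal (le_trans ?_ hexp)
    calc ((n + 1 : ℕ) : ℝ) * ((N + M : ℕ) * (Q * Real.exp (-h)))
        ≤ (h / r + (C / r + 2) + 1) * ((N + M : ℕ) * (Q * Real.exp (-h))) := by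
          push_cast; gcongr
      _ = _ := by ring
  have hEc : iid (sensorLaw P f) Eᶜ ≤ 1 / 4 := by
    rw [hE, Set.compl_inter, compl_compl]
    refine (measure_union_le _ _).trans ((add_le_add
      ((measure_mono (Set.compl_subset_compl.2 hclimb)).trans hC) hwrong).trans ?_)
    rw [← ENNReal.toReal_le_toReal (by finiteness) (by finiteness)]
    norm_num [ENNReal.toReal_add]
  have hhalf := half_le_exp_mul_of_tilt hq' (hP.I_lt_top q _ hq') A hEm hEn hEc
    (hC.trans (by
      rw [← ENNReal.toReal_le_toReal (by finiteness) (by finiteness)]; norm_num))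
  rw [hA] at hhalf
  have hpos : iid (sensorLaw P fun _ : Fin (N + M) => q₁.succ) E ≠ 0 := by
    intro h0
    rw [h0, mul_zero] at hhalf
    simp at hhalf
  obtain ⟨p, hp, hle⟩ := exists_lintegral_waiting_le (sensorLaw P fun _ : Fin (N + M) => q₁.succ)
    hmeas (constDec_dependsOn P sel d h B hB.le _) (constDec_regenerate P sel d h B hB.le _)
    {q} hpos (measure_mono hEfirst)
  rw [Finset.mem_singleton] at hp
  subst hp
  refine (falseTime_le_waiting P sel d h B hB.le _ q₁.succ p hq'.symm).trans (hle.trans ?_)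
  rw [Finset.card_singleton, Nat.cast_one, one_mul]
  refine (ENNReal.div_le_div_right hV' _).trans
    ((ofReal_div_le_of_half_le (by positivity) hhalf).trans
      (ENNReal.ofReal_le_ofReal ?_))
  have h2 : m * (n * J + C) ≤ m * (J / r) * h + m * ((C / r + 2) * J + C) := by
    calc m * (n * J + C) ≤ m * ((h / r + (C / r + 2)) * J + C) := by gcongr
      _ = _ := by ring
  calc 2 * (2 * (n₁ : ℝ)) * Real.exp (m * (n * J + C))
      ≤ 2 * (2 * (h / r₁ + (C₁ / r₁ + 2))) *
        Real.exp (m * (J / r) * h + m * ((C / r + 2) * J + C)) := by gcongr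
    _ = _ := by ring

/-- The mean time to a false alarm is asymptotically at most `exp ((N - M) * h)`: the hypothesis
that is closest to `q` is mistaken for `q` at this rate. -/
lemma eventually_falseTime_le {P : Densities Q} (hP : P.Regular) (sel : TieBreak Q) {d : ℕ}
    (hM : M < d) (hd : d ≤ N) (q : Fin Q) {ρ : ℝ} (hρ : 1 < ρ) :
    ∀ᶠ h in atTop, falseTime P Mode.restart (simRule (K := N + M) (M := M) P sel d h) ≤
      ENNReal.ofReal (Real.exp ((N - M : ℕ) * ρ * h)) := by
  obtain ⟨j, hj, hjI⟩ := hP.exists_Imin q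
  set I := (P.Imin q).toReal with hI
  have hI0 : 0 < I := hP.Imin_toReal_pos q
  obtain ⟨ε, hε0, hεI, hερ⟩ : ∃ ε, 0 < ε ∧ ε < I ∧ (I + ε) / (I - ε) < ρ := by
    have h1 : I * ((ρ - 1) / (2 * (ρ + 1))) * (ρ + 1) = I * (ρ - 1) / 2 := by
      field_simp
    have h2 : 0 < I * (ρ - 1) := mul_pos hI0 (by linarith)
    have h3 : 0 < I * ((ρ - 1) / (2 * (ρ + 1))) := by
      have : 0 < (ρ - 1) / (2 * (ρ + 1)) := div_pos (by linarith) (by linarith)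
      positivity
    have h4 : I * ((ρ - 1) / (2 * (ρ + 1))) < I := by nlinarith
    exact ⟨_, h3, h4, by rw [div_lt_iff₀ (by linarith)]; nlinarith⟩
  have hNM : (0 : ℝ) < ((N - M : ℕ) : ℝ) := by exact_mod_cast (by omega : 0 < N - M)
  have hκ : ((N - M : ℕ) : ℝ) * ((I + ε) / (I - ε)) < (N - M : ℕ) * ρ := by gcongr
  obtain ⟨a, b, c, habc⟩ : ∃ a b c : ℝ, ∀ᶠ h in atTop,
      falseTime P Mode.restart (simRule (K := N + M) (M := M) P sel d h) ≤
        ENNReal.ofReal ((a * h + b) * Real.exp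
          ((N - M : ℕ) * ((I + ε) / (I - ε)) * h + c)) := by
    rcases Fin.eq_zero_or_eq_succ j with rfl | ⟨q₁, rfl⟩
    · obtain ⟨a, b, c, habc⟩ := exists_falseTime_le_of_zero (M := M) hP sel (by omega) hd q hε0 hεI
      rw [hjI] at habc
      exact ⟨a, b, c, (eventually_ge_atTop 0).mono fun h hh => habc h hh h le_rfl⟩
    · have hne : q₁ ≠ q := fun he => hj (congrArg Fin.succ he)
      have := exists_falseTime_le_of_succ hP sel hM hd hne hε0 hεI
      rwa [hjI] at this
  filter_upwards [habc, eventually_linear_mul_exp_le a b c hκ] with h h1 h2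
  exact h1.trans (ENNReal.ofReal_le_ofReal h2)

/-- Bounded thresholds give a bounded mean time to a false alarm. -/
lemma exists_forall_falseTime_le {P : Densities Q} (hP : P.Regular) (sel : TieBreak Q) {d : ℕ}
    (hM : M ≤ N) (hd : d ≤ N) (q : Fin Q) (h₀ : ℝ) :
    ∃ c : ℝ, ∀ h ≤ h₀, falseTime P Mode.restart (simRule (K := N + M) (M := M) P sel d h) ≤
      ENNReal.ofReal c := by
  have hI0 := hP.Imin_toReal_pos q
  obtain ⟨a, b, c, habc⟩ := exists_falseTime_le_of_zero (M := M) hP sel hM hd q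
    (half_pos hI0) (half_lt_self hI0)
  exact ⟨_, fun h hh => habc (max h₀ 0) (le_max_right _ _) h (hh.trans (le_max_left _ _))⟩

/-! ### A lower bound for the delay -/

/-- Without attack and with an immediate change to the type whose divergence is smallest, no sensor
accepts anything before its statistic has climbed up to the threshold. -/
lemma eventually_le_delay {P : Densities Q} (hP : P.Regular) (hQ : 0 < Q) (sel : TieBreak Q)
    {d : ℕ} (hd : 0 < d) {ρ : ℝ} (hρ : 1 < ρ) :
    ∀ᶠ h in atTop, ENNReal.ofReal (h / (ρ * P.Istar.toReal)) ≤
      delay P (simRule (K := K) (M := M) P sel d h) := by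
  obtain ⟨q, hq⟩ := P.exists_Istar hQ
  obtain ⟨j, hj, hjI⟩ := hP.exists_Imin q
  rw [hq] at hjI
  set I := P.Istar.toReal with hI
  have hI0 : 0 < I := by rw [hI, ← hq]; exact hP.Imin_toReal_pos q
  -- The slack `ρ` is split between the slope of the cones and the probability of a good run.
  obtain ⟨θ, hθ1, hθ2, hθρ⟩ : ∃ θ : ℝ, 1 < θ ∧ θ ≤ 2 ∧ θ * θ < ρ := by
    have h1 := lt_min (sub_pos.2 hρ) one_pos
    have h2 := min_le_left (ρ - 1) 1
    have h3 := min_le_right (ρ - 1) 1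
    exact ⟨1 + min (ρ - 1) 1 / 4, by linarith, by linarith, by nlinarith⟩
  have hθ0 : 0 < θ := by linarith
  have hθinv : θ⁻¹ < 1 := inv_lt_one_of_one_lt₀ hθ1
  set ε := (θ - 1) * I with hε
  have hε0 : 0 < ε := mul_pos (by linarith) hI0
  have hεI : ε ≤ I := by nlinarith
  set η := (1 - θ⁻¹) / 2 with hη
  have hη0 : 0 < η := half_pos (by linarith)
  obtain ⟨C, hC0, hC⟩ := exists_cone (K := K) P (fun _ => q.succ) Finset.univ q.succ
    (fun _ _ => rfl) (hP.I_lt_top q) hε0 (η := ENNReal.ofReal η) (ENNReal.ofReal_pos.2 hη0).ne'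
  have hlarge : ∀ᶠ h : ℝ in atTop, 2 * C * ρ ≤ (ρ - θ * θ) * h :=
    (tendsto_id.const_mul_atTop (sub_pos.2 hθρ)).eventually_ge_atTop _
  filter_upwards [hlarge, eventually_ge_atTop (2 * C),
    eventually_linear_mul_exp_neg_le (K * Q / (θ * I)) (K * Q) hη0] with h hh1 hh2 hh3
  set n := ⌈(h - 2 * C) / (θ * I)⌉₊ with hn
  set b := ENNReal.ofReal (Real.exp (-h)) with hb
  set μ := iid (sensorLaw P fun _ : Fin K => q.succ) with hμ
  set bad := (cone P q.succ (Finset.univ : Finset (Fin K)) ε C)ᶜ ∪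
    wrongExcess P q.succ Finset.univ b n with hbad
  have hbadle : μ bad ≤ ENNReal.ofReal (1 - θ⁻¹) := by
    have h1 : μ (wrongExcess P q.succ Finset.univ b n) ≤ ENNReal.ofReal η := by
      refine (measure_wrongExcess_le P q.succ Finset.univ (fun _ => q.succ) (fun _ _ => rfl)
        b n).trans ?_
      rw [hb, ← ENNReal.ofReal_natCast, ← ENNReal.ofReal_natCast, ← ENNReal.ofReal_natCast,
        ← ENNReal.ofReal_mul (by positivity), ← ENNReal.ofReal_mul (by positivity),
        ← ENNReal.ofReal_mul (by positivity)]
      refine ENNReal.ofReal_le_ofReal (le_trans ?_ hh3)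
      have h2 : (n : ℝ) ≤ h / (θ * I) + 1 := by
        have h3 : 0 ≤ (h - 2 * C) / (θ * I) := div_nonneg (by linarith) (by positivity)
        refine (Nat.ceil_lt_add_one h3).le.trans ?_
        gcongr
        linarith
      calc (n : ℝ) * (K * (Q * Real.exp (-h)))
          ≤ (h / (θ * I) + 1) * (K * (Q * Real.exp (-h))) := by gcongr
        _ = _ := by ring
    refine (measure_union_le _ _).trans ((add_le_add hC h1).trans ?_)
    rw [← ENNReal.ofReal_add hη0.le hη0.le, hη, add_halves]
  set g : Attack K M (Finset (Fin Q)) := constAttack ∅ (by simp) fun _ => ∅ with hg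
  have hquiet : ∀ ω : Sample Q K, ω.1 ∉ bad →
      (n : ℝ≥0∞) ≤ delayAfter (simRule P sel d h g ω) 0 := by
    intro ω hω
    have hst := isSimRun_simState P sel d h g ω
    rw [hbad, Set.mem_union, not_or, Set.mem_compl_iff, not_not] at hω
    have h1 : (n : ℕ∞) ≤ alarmTime (simRule P sel d h g ω) 1 := le_alarmTime_one fun t ht htn => by
      obtain ⟨t, rfl⟩ : ∃ s, t = s + 1 := ⟨t - 1, by omega⟩
      by_contra hne
      obtain ⟨p, hp⟩ := Option.ne_none_iff_exists'.1 hne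
      have hcard := hst.le_card hp
      obtain ⟨k, hk⟩ := Finset.card_pos.1 (hd.trans_le hcard)
      have hacc : p ∈ acceptable h ((simState P sel d h g ω (t + 1)).Y k) := by
        have := (Finset.mem_filter.1 hk).2
        rwa [if_neg (by simp [hg, constAttack])] at this
      by_cases hpq : p = q
      · subst hpq
        choose s hs hsb using hω.1 k (Finset.mem_univ k) j hj
        rw [hjI] at hsb
        have hlow : ∀ u, -C ≤ s u := fun u => by
          have h2 := (abs_le.1 (hsb u)).1
          have h3 : ε * u ≤ u * I := by rw [mul_comm]; gcongr
          linarith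
        have hY := (hst.isCusumPath k).le_add hs hlow (t + 1)
        have h4 := (mem_acceptable.1 hacc j hj).trans hY
        have h5 : h ≤ s (t + 1) + C := by exact_mod_cast h4
        have h6 := (abs_le.1 (hsb (t + 1))).2
        have h7 : ((t + 1 : ℕ) : ℝ) < (h - 2 * C) / (θ * I) := Nat.lt_ceil.1 htn
        rw [lt_div_iff₀ (by positivity)] at h7
        have h8 : ((t + 1 : ℕ) : ℝ) * (θ * I) = (t + 1 : ℕ) * I + ε * (t + 1 : ℕ) := by
          rw [hε]; ring
        linarith
      · exact hω.2 ⟨t + 1, htn, k, Finset.mem_univ k, p,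
          fun he => hpq (Fin.succ_injective Q he), (hst.isCusumPath k).one_le_of_acceptable
            (fun he => hpq (Fin.succ_injective Q he).symm) hacc⟩
    simpa [delayAfter] using ENat.toENNReal_le.2 h1
  -- Before the first observation, conditioning on the past is trivial.
  have hpast : past Q K 0 = ⊥ := by
    rw [past, eq_bot_iff]
    rintro s ⟨s', -, rfl⟩
    rcases Set.eq_empty_or_nonempty s' with rfl | hne
    · simp
    · rw [Subsingleton.eq_univ_of_nonempty hne]; simp
  refine le_trans ?_ (le_iSup_of_le q (le_iSup_of_le g (le_iSup_of_le 0 le_rfl)))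
  rw [hpast, condLExp_bot, essSup_const _ (IsProbabilityMeasure.ne_zero _)]
  have hmp := measurePreserving_fst_sampleLaw (K := K) P q.succ 0
  set V := toMeasurable μ bad
  have hV : MeasurableSet V := measurableSet_toMeasurable _ _
  have hVle : sampleLaw K P q.succ 0 (Prod.fst ⁻¹' V) ≤ ENNReal.ofReal (1 - θ⁻¹) := by
    rw [hmp.measure_preimage hV.nullMeasurableSet, obsLaw_zero, measure_toMeasurable]
    exact hbadle
  calc ENNReal.ofReal (h / (ρ * I)) ≤ ENNReal.ofReal (n * θ⁻¹) := by
        refine ENNReal.ofReal_le_ofReal ?_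
        have h1 : (h - 2 * C) / (θ * I) ≤ n := Nat.le_ceil _
        refine le_trans ?_ (mul_le_mul_of_nonneg_right h1 (by positivity))
        rw [← div_eq_mul_inv, div_div, div_le_div_iff₀ (by positivity) (by positivity)]
        have h2 : 0 < I := hI0
        nlinarith
    _ = n * (1 - ENNReal.ofReal (1 - θ⁻¹)) := by
        rw [ENNReal.ofReal_mul n.cast_nonneg, ENNReal.ofReal_natCast, ← ENNReal.ofReal_one,
          ← ENNReal.ofReal_sub _ (by linarith)]
        congr 2; ring
    _ ≤ n * sampleLaw K P q.succ 0 (Prod.fst ⁻¹' V)ᶜ := by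
        rw [prob_compl_eq_one_sub (hmp.measurable hV)]
        gcongr
    _ = ∫⁻ ω, (Prod.fst ⁻¹' V)ᶜ.indicator (fun _ => (n : ℝ≥0∞)) ω ∂sampleLaw K P q.succ 0 :=
        (lintegral_indicator_const (hmp.measurable hV).compl _).symm
    _ ≤ _ := by
        refine lintegral_mono fun ω => ?_
        by_cases hω : ω.1 ∈ V
        · simp [hω]
        · rw [Set.indicator_of_mem (show ω ∈ (Prod.fst ⁻¹' V)ᶜ from hω)]
          exact hquiet ω fun hb => hω (subset_toMeasurable _ _ hb)

/-! ### First-order asymptotics of the delay -/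

lemma asympLE_of_forall {f : ℝ → ℝ≥0∞} {b : ℝ → ℝ} (hb : ∀ᶠ γ in atTop, 0 < b γ)
    (h : ∀ δ : ℝ, 0 < δ → ∀ᶠ γ in atTop, f γ ≤ ENNReal.ofReal ((1 + δ) * b γ)) :
    AsympLE f b := by
  refine ENNReal.le_of_forall_pos_le_add fun δ hδ _ => ?_
  refine limsup_le_of_le (by isBoundedDefault) ?_
  filter_upwards [hb, h δ (by exact_mod_cast hδ)] with γ h1 h2
  refine ENNReal.div_le_of_le_mul (h2.trans (le_of_eq ?_))
  rw [ENNReal.ofReal_mul (by positivity), ENNReal.ofReal_add zero_le_one (by positivity),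
    ENNReal.ofReal_one, ENNReal.ofReal_coe_nnreal]

lemma asympGE_of_forall {f : ℝ → ℝ≥0∞} {b : ℝ → ℝ} (hb : ∀ᶠ γ in atTop, 0 < b γ)
    (h : ∀ θ : ℝ, 0 < θ → θ < 1 → ∀ᶠ γ in atTop, ENNReal.ofReal (θ * b γ) ≤ f γ) :
    AsympGE f b := by
  refine le_of_forall_lt fun c hc => ?_
  obtain ⟨θ, hcθ, hθ⟩ := ENNReal.lt_iff_exists_nnreal_btwn.1 hc
  refine hcθ.trans_le (le_liminf_of_le (by isBoundedDefault) ?_)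
  have hθ0 : 0 < θ := by exact_mod_cast (zero_le (a := c)).trans_lt hcθ
  filter_upwards [hb, h θ (by exact_mod_cast hθ0) (by exact_mod_cast hθ)] with γ h1 h2
  rw [ENNReal.ofReal_mul (by positivity), ENNReal.ofReal_coe_nnreal] at h2
  exact (ENNReal.le_div_iff_mul_le (Or.inl (ENNReal.ofReal_pos.2 h1).ne')
    (Or.inl ENNReal.ofReal_ne_top)).2 h2

lemma Densities.Regular.Istar_toReal_pos {P : Densities Q} (hP : P.Regular) (hQ : 0 < Q) :
    0 < P.Istar.toReal := by
  obtain ⟨q, hq⟩ := P.exists_Istar hQ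
  rw [← hq]
  exact hP.Imin_toReal_pos q

/-- The delay for thresholds of the form `(log γ + a) / m`. -/
lemma asympLE_delay {A : Type} {P : Densities Q} (hP : P.Regular) (hQ : 0 < Q)
    (T : ℝ → Rule Q K M A) {m a : ℝ} (hm : 0 < m)
    (hT : ∀ δ : ℝ, 0 < δ →
      ∀ᶠ h in atTop, delay P (T h) ≤ ENNReal.ofReal ((1 + δ) * h / P.Istar.toReal)) :
    AsympLE (fun γ => delay P (T ((Real.log (max γ 1) + a) / m)))
      (fun γ => Real.log γ / (m * P.Istar.toReal)) := by
  have hI := hP.Istar_toReal_pos hQ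
  have hlim : Tendsto (fun γ : ℝ => (Real.log (max γ 1) + a) / m) atTop atTop :=
    (tendsto_atTop_add_const_right _ _ (Real.tendsto_log_atTop.comp
      (tendsto_atTop_mono (fun γ => le_max_left γ 1) tendsto_id))).atTop_div_const hm
  refine asympLE_of_forall ?_ fun δ hδ => ?_
  · filter_upwards [eventually_gt_atTop 1] with γ hγ
    exact div_pos (Real.log_pos hγ) (by positivity)
  · filter_upwards [hlim.eventually (hT (δ / 2) (half_pos hδ)), eventually_ge_atTop 1,
      Real.tendsto_log_atTop.eventually_ge_atTop ((1 + δ / 2) * a / (δ / 2))] with γ h1 h2 h3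
    refine h1.trans (ENNReal.ofReal_le_ofReal ?_)
    rw [max_eq_left h2, ← mul_div_assoc, div_div, ← mul_div_assoc]
    rw [div_le_iff₀ (half_pos hδ)] at h3
    gcongr ?_ / _
    linarith

/-- Thresholds with a mean time to a false alarm of at least `γ` are asymptotically at least
`log γ / (N - M)`, so the delay is large. -/
lemma asympGE_delay {P : Densities Q} (hP : P.Regular) (hQ : 0 < Q) (sel : TieBreak Q)
    (hNM : M < N) (d : ℕ) (h : ℝ → ℝ)
    (hh : ∀ᶠ γ in atTop, ENNReal.ofReal γ ≤
      falseTime P Mode.restart (simRule (K := N + M) (M := M) P sel d (h γ))) :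
    AsympGE (fun γ => delay P (simRule (K := N + M) (M := M) P sel d (h γ)))
      (fun γ => Real.log γ / (((N : ℝ) - M) * P.Istar.toReal)) := by
  have hI := hP.Istar_toReal_pos hQ
  have hm : (0 : ℝ) < (N : ℝ) - M := sub_pos.2 (by exact_mod_cast hNM)
  have hb : ∀ᶠ γ : ℝ in atTop, 0 < Real.log γ / (((N : ℝ) - M) * P.Istar.toReal) := by
    filter_upwards [eventually_gt_atTop 1] with γ hγ
    exact div_pos (Real.log_pos hγ) (by positivity)
  refine asympGE_of_forall hb fun θ hθ0 hθ1 => ?_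
  rcases le_or_gt d M with hdM | hdM
  · obtain ⟨γ, h1, h2⟩ := (hh.and (eventually_gt_atTop (Q : ℝ))).exists
    have h3 := h1.trans (falseTime_le_of_le hQ P sel hdM (h γ))
    rw [← ENNReal.ofReal_natCast, ENNReal.ofReal_le_ofReal_iff Q.cast_nonneg] at h3
    exact absurd h3 (not_le.2 h2)
  rcases lt_or_ge N d with hdN | hdN
  · filter_upwards with γ
    rw [delay_eq_top hQ P sel hdN]
    exact le_top
  -- The factor `θ` is split between the two comparisons with the threshold.
  obtain ⟨ρ, hρ1, hρθ⟩ : ∃ ρ : ℝ, 1 < ρ ∧ θ * (ρ * ρ) ≤ 1 := by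
    refine ⟨1 + min (θ⁻¹ - 1) 1 / 4, ?_, ?_⟩
    · have := lt_min (sub_pos.2 ((one_lt_inv₀ hθ0).2 hθ1)) one_pos
      linarith
    · have h1 := lt_min (sub_pos.2 ((one_lt_inv₀ hθ0).2 hθ1)) one_pos
      have h2 := min_le_left (θ⁻¹ - 1) 1
      have h3 := min_le_right (θ⁻¹ - 1) 1
      rw [← le_div_iff₀' hθ0, one_div]
      nlinarith
  have hρ0 : 0 < ρ := by linarith
  obtain ⟨q, -⟩ := P.exists_Istar hQ
  obtain ⟨h₀, hh₀⟩ := eventually_atTop.1 ((eventually_falseTime_le hP sel hdM hdN q hρ1).and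
    (eventually_le_delay (K := N + M) (M := M) hP hQ sel (by omega : 0 < d) hρ1))
  obtain ⟨c, hc⟩ := exists_forall_falseTime_le (M := M) hP sel hNM.le hdN q h₀
  filter_upwards [hh, eventually_gt_atTop (max c 1)] with γ h1 h2
  have hγ1 : 1 < γ := (le_max_right _ _).trans_lt h2
  have hγc : c < γ := (le_max_left _ _).trans_lt h2
  have hge : h₀ ≤ h γ := by
    by_contra hlt
    have h3 := h1.trans (hc (h γ) (not_le.1 hlt).le)
    exact absurd h3 (not_le.2 ((ENNReal.ofReal_lt_ofReal_iff (by linarith)).2 hγc))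
  obtain ⟨h4, h5⟩ := hh₀ (h γ) hge
  refine le_trans (ENNReal.ofReal_le_ofReal ?_) h5
  have h6 : γ ≤ Real.exp ((N - M : ℕ) * ρ * h γ) :=
    (ENNReal.ofReal_le_ofReal_iff (Real.exp_nonneg _)).1 (h1.trans h4)
  have h7 : Real.log γ ≤ ((N : ℝ) - M) * ρ * h γ := by
    rw [← Nat.cast_sub hNM.le, Real.log_le_iff_le_exp (by linarith)]
    exact h6
  have h8 : 0 ≤ h γ := by
    have h9 : 0 < ((N : ℝ) - M) * ρ * h γ := (Real.log_pos hγ1).trans_le h7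
    exact (pos_of_mul_pos_right h9 (by positivity)).le
  calc θ * (Real.log γ / (((N : ℝ) - M) * P.Istar.toReal))
      ≤ θ * (((N : ℝ) - M) * ρ * h γ / (((N : ℝ) - M) * P.Istar.toReal)) := by gcongr
    _ = θ * (ρ * ρ) * (h γ / (ρ * P.Istar.toReal)) := by field_simp
    _ ≤ 1 * (h γ / (ρ * P.Istar.toReal)) := by gcongr
    _ = _ := one_mul _

end

end ByzantineQCD

end

open ByzantineQCD in
/-- `N` is the number of honest sensors, `M` the number of sensors that may be compromised, and
`N + M` the total number of sensors. -/
theorem theorem5 (Q N M : ℕ) (hQ : 0 < Q) (hM : M < N) (P : Densities Q) (hP : P.Regular)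
    (sel : TieBreak Q) :
    -- (a) the simultaneous `N`-th alarm achieves the bound
    (∃ h : ℝ → ℝ,
      (∀ γ, 0 < h γ ∧ ∀ mode, ENNReal.ofReal γ ≤
        falseTime P mode (simRule (K := N + M) (M := M) P sel N (h γ))) ∧
      AsympLE (fun γ => delay P (simRule (K := N + M) (M := M) P sel N (h γ)))
        (fun γ => Real.log γ / (((N : ℝ) - M) * P.Istar.toReal))) ∧
    -- (a) and no simultaneous `d`-th alarm does better
    (∀ (d : ℕ) (h : ℝ → ℝ),
      (∀ γ, 0 < h γ) →
      (∀ᶠ γ in atTop, ENNReal.ofReal γ ≤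
        falseTime P Mode.restart (simRule (K := N + M) (M := M) P sel d (h γ))) →
      AsympGE (fun γ => delay P (simRule (K := N + M) (M := M) P sel d (h γ)))
        (fun γ => Real.log γ / (((N : ℝ) - M) * P.Istar.toReal))) ∧
    -- (b) the multi-shot `d`-th alarm
    (∀ d : ℕ, M + 1 ≤ d → d ≤ N → ∃ h : ℝ → ℝ,
      (∀ γ, 0 < h γ ∧ ∀ mode, ENNReal.ofReal γ ≤
        falseTime P mode (multiRule (K := N + M) (M := M) P sel d (h γ))) ∧
      AsympLE (fun γ => delay P (multiRule (K := N + M) (M := M) P sel d (h γ)))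
        (fun γ => Real.log γ / P.Istar.toReal)) := by
  have hpos : ∀ γ : ℝ, 0 < Real.log (max γ 1) + Real.log (6 * 2 ^ (N + M)) := fun γ =>
    add_pos_of_nonneg_of_pos (Real.log_nonneg (le_max_right _ _)) (Real.log_pos (by
      have : (1 : ℝ) ≤ 2 ^ (N + M) := one_le_pow₀ one_le_two
      linarith))
  have hcard : ∀ {A : Type} (g : Attack (N + M) M A), N ≤ (g.compromised)ᶜ.card := fun g => by
    have := g.card_le
    rw [Finset.card_compl, Fintype.card_fin]
    omega
  refine ⟨⟨fun γ => (Real.log (max γ 1) + Real.log (6 * 2 ^ (N + M))) / ((N - M : ℕ) : ℝ),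
    fun γ => ⟨div_pos (hpos γ) (by exact_mod_cast Nat.sub_pos_of_lt hM), fun mode =>
      le_falseTime P mode _ γ (Nat.sub_pos_of_lt hM) fun g ω t p =>
        simRule_excess P sel _ g ω t p⟩, ?_⟩,
    fun d h _ hh => asympGE_delay hP hQ sel hM d h hh,
    fun d hd hdN => ⟨fun γ => (Real.log (max γ 1) + Real.log (6 * 2 ^ (N + M))) / ((1 : ℕ) : ℝ),
      fun γ => ⟨div_pos (hpos γ) (by simp), fun mode =>
        le_falseTime P mode _ γ one_pos fun g ω t p => multiRule_excess hd P sel _ g ω t p⟩, ?_⟩⟩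
  · have := asympLE_delay hP hQ (fun h => simRule (K := N + M) (M := M) P sel N h)
      (m := ((N - M : ℕ) : ℝ)) (a := Real.log (6 * 2 ^ (N + M)))
      (by exact_mod_cast Nat.sub_pos_of_lt hM) fun δ hδ => eventually_delay_le hP hQ _ 0
        (fun h q g ω t₀ n hn hx => (isSimRun_simState P sel N h g ω).exists_alarm hn
          (fun k _ _ j hj => hx k (Finset.mem_univ k) j hj)
          (fun k hk hkB => absurd hkB (Finset.mem_compl.1 hk)) (hcard g)) hδ
    simpa only [Nat.cast_sub hM.le] using this
  · have := asympLE_delay hP hQ (fun h => multiRule (K := N + M) (M := M) P sel d h)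
      (m := ((1 : ℕ) : ℝ)) (a := Real.log (6 * 2 ^ (N + M)))
      (by simp) fun δ hδ => eventually_delay_le hP hQ _ Q
        (fun h q g ω t₀ n hn hx => (isMultiRun_multiState P sel d h g ω).exists_alarm hn
          (A := (g.compromised)ᶜ)
          (fun k hk => ⟨Finset.mem_compl.1 hk, fun j hj => hx k (Finset.mem_univ k) j hj⟩)
          (hdN.trans (hcard g))) hδ
    simpa only [Nat.cast_one, one_mul] using this
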